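/- \textbf{Setting.} Let $\mathbb H=\mathbb R^3$ be the Heisenberg group with group law $(p,q,t)(p',q',t')=(p+p',q+q',t+t'+(pq'-p'q)/2)$ and Haar measure equal to Lebesgue measure. For $\lambda\neq 0$ let $\rho_\lambda(p,q,t)=e^{-2\pi i\lambda(t-pq/2)}\,T_{\lambda p}M_q$ be the Schrödinger representation on $L^2(\mathbb R)$, where $(T_yg)(x)=g(x-y)$ and $(M_\xi g)(x)=e^{2\pi i\xi x}g(x)$. For $f\in L^1\cap L^2(\mathbb H)$ put $\rho_\lambda(f)=\int_{\mathbb H}f(x)\rho_\lambda(x)\,dx$ (weak operator sense). The Plancherel transform $f\mapsto\widehat f=(\widehat f(\lambda))_{\lambda\ne0}$ is the continuous extension of $f\mapsto(\rho_\lambda(f))_\lambda$ to $L^2(\mathbb H)$, with values in the direct integral $\int^\oplus HS(L^2(\mathbb R))\,|\lambda|\,d\lambda$ of Hilbert–Schmidt operators; fields that agree for almost every $\lambda$ are identified. For smooth $f$ let $(Pf)(x)=\frac{d}{dh}\big|_{h=0}f(x\,(h,0,0))$ and $(Qf)(x)=\frac{d}{dh}\big|_{h=0}f(x\,(0,h,0))$,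 and let the sub-Laplacian $\mathcal L$ be the closure in $L^2(\mathbb H)$ of the operator $-P^2-\frac{1}{4\pi^2}Q^2$ with domain $C_c^\infty(\mathbb H)$. Let $h_n(x)=\frac{(-1)^n}{\sqrt{2^nn!\sqrt\pi}}\,e^{x^2/2}\frac{d^n}{dx^n}e^{-x^2}$ $(n\ge0)$ be the Hermite functions and, for $\lambda\neq0$, put $h_{n,\lambda}(x)=|\lambda|^{-1/4}h_n(|\lambda|^{-1/2}x)$, \[ d(\lambda)=\Big\lfloor\frac1{2|\lambda|}-\frac12\Big\rfloor,\qquad \widehat P_\lambda=\sum_{n=0}^{d(\lambda)}h_{n,\lambda}\otimes h_{n,\lambda}, \] where $(\eta\otimes\varphi)(z)=\langle z,\varphi\rangle\eta$ and the sum is $0$ if $d(\lambda)=-1$. \textbf{Proposition.} The Plancherel transform is well defined on $L^2(\mathbb H)$ (every $f\in L^2(\mathbb H)$ has exactly one, up to equality for almost every $\lambda$), and $\mathcal L=\int t\,d\Pi_{\mathcal L}(t)$ for a projection-valued measure $\Pi_{\mathcal L}$ on the Borel sets of $\mathbb R$. For every $\lambda\ne0$, $\widehat P_\lambda$ is the orthogonal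 projection of $L^2(\mathbb R)$ onto $\operatorname{span}\{h_{n,\lambda}:0\le n\le d(\lambda)\}$. Moreover, for every such spectral measure $\Pi_{\mathcal L}$ of $\mathcal L$: \begin{enumerate} \item for all $f\in L^2(\mathbb H)$, \[\big(\Pi_{\mathcal L}([0,1])f\big)^\wedge(\lambda)=\widehat f(\lambda)\circ\widehat P_\lambda\quad\text{for almost every }\lambda;\] \item there is $p\in L^2(\mathbb H)$ whose Plancherel transform is the field $(\widehat P_\lambda)_\lambda$, and for every $f\in L^2(\mathbb H)$ \[\Pi_{\mathcal L}([0,1])f=f*p,\qquad (f*p)(x)=\int_{\mathbb H}f(y)\,p(y^{-1}x)\,dy,\] where the integral converges absolutely for every $x\in\mathbb H$ and the equality holds for almost every $x$. \end{enumerate} -/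

import Mathlib

open MeasureTheory Filter
open scoped Topology ENNReal ContDiff

noncomputable section

/-! ### The Heisenberg group -/

/-- The Heisenberg group: the space `ℝ³` of triples `(p, q, t)`, with the topology, smooth structure
and Lebesgue measure of `ℝ³`. -/
def Heisenberg : Type := ℝ × ℝ × ℝ

namespace Heisenberg

instance : NormedAddCommGroup Heisenberg := inferInstanceAs (NormedAddCommGroup (ℝ × ℝ × ℝ))
instance : NormedSpace ℝ Heisenberg := inferInstanceAs (NormedSpace ℝ (ℝ × ℝ × ℝ))
instance : MeasureSpace Heisenberg := inferInstanceAs (MeasureSpace (ℝ × ℝ × ℝ))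
instance : BorelSpace Heisenberg := inferInstanceAs (BorelSpace (ℝ × ℝ × ℝ))
instance : SecondCountableTopology Heisenberg :=
  inferInstanceAs (SecondCountableTopology (ℝ × ℝ × ℝ))
instance : LocallyCompactSpace Heisenberg := inferInstanceAs (LocallyCompactSpace (ℝ × ℝ × ℝ))
instance : (volume : Measure Heisenberg).IsOpenPosMeasure :=
  inferInstanceAs (volume : Measure (ℝ × ℝ × ℝ)).IsOpenPosMeasure
instance : IsFiniteMeasureOnCompacts (volume : Measure Heisenberg) :=
  inferInstanceAs (IsFiniteMeasureOnCompacts (volume : Measure (ℝ × ℝ × ℝ)))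
instance : SigmaFinite (volume : Measure Heisenberg) :=
  inferInstanceAs (SigmaFinite (volume : Measure (ℝ × ℝ × ℝ)))

/-- The point `(p, q, t)`. -/
def mk (p q t : ℝ) : Heisenberg := (p, q, t)

/-- First coordinate. -/
def p (x : Heisenberg) : ℝ := Prod.fst (α := ℝ) (β := ℝ × ℝ) x

/-- Second coordinate. -/
def q (x : Heisenberg) : ℝ := Prod.fst (Prod.snd (α := ℝ) (β := ℝ × ℝ) x)

/-- Third (central) coordinate. -/
def t (x : Heisenberg) : ℝ := Prod.snd (Prod.snd (α := ℝ) (β := ℝ × ℝ) x)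

theorem ext_coord {x y : Heisenberg} (h1 : x.p = y.p) (h2 : x.q = y.q) (h3 : x.t = y.t) : x = y :=
  Prod.ext h1 (Prod.ext h2 h3)

/-- The group law
`(p,q,t)(p',q',t') = (p + p', q + q', t + t' + (p q' - p' q)/2)`. -/
instance : Group Heisenberg where
  mul x y := mk (x.p + y.p) (x.q + y.q) (x.t + y.t + (x.p * y.q - y.p * x.q) / 2)
  one := mk 0 0 0
  inv x := mk (-x.p) (-x.q) (-x.t)
  mul_assoc x y z := by
    refine ext_coord ?_ ?_ ?_
    · exact add_assoc _ _ _
    · exact add_assoc _ _ _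
    · change (x.t + y.t + (x.p * y.q - y.p * x.q) / 2) + z.t
          + ((x.p + y.p) * z.q - z.p * (x.q + y.q)) / 2
        = x.t + (y.t + z.t + (y.p * z.q - z.p * y.q) / 2)
          + (x.p * (y.q + z.q) - (y.p + z.p) * x.q) / 2
      ring
  one_mul x := by
    refine ext_coord ?_ ?_ ?_
    · exact zero_add _
    · exact zero_add _
    · change 0 + x.t + (0 * x.q - x.p * 0) / 2 = x.t
      ring
  mul_one x := by
    refine ext_coord ?_ ?_ ?_
    · exact add_zero _
    · exact add_zero _
    · change x.t + 0 + (x.p * 0 - 0 * x.q) / 2 = x.t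
      ring
  inv_mul_cancel x := by
    refine ext_coord ?_ ?_ ?_
    · exact neg_add_cancel _
    · exact neg_add_cancel _
    · change -x.t + x.t + (-x.p * x.q - x.p * -x.q) / 2 = 0
      ring

end Heisenberg

/-- The Hilbert space `L²(ℝ)` of complex-valued functions. -/
abbrev L2R : Type := Lp ℂ 2 (volume : Measure ℝ)

/-- The Hilbert space `L²(ℍ)` of complex-valued functions. -/
abbrev L2H : Type := Lp ℂ 2 (volume : Measure Heisenberg)

/-! ### The Schrödinger representations and the Plancherel transform -/

/-- Translation `(T_a g)(x) = g(x - a)` on `L²(ℝ)`. -/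
def translationL2 (a : ℝ) : L2R →L[ℂ] L2R :=
  (Lp.compMeasurePreservingₗᵢ ℂ (fun x : ℝ => x - a)
    (measurePreserving_sub_right volume a)).toContinuousLinearMap

/-- The unimodular function `x ↦ exp(2 π i b x)`. -/
def modulationFun (b x : ℝ) : ℂ := Complex.exp (2 * Real.pi * Complex.I * b * x)

theorem norm_modulationFun (b x : ℝ) : ‖modulationFun b x‖ = 1 := by
  have h : (2 * Real.pi * Complex.I * b * x : ℂ) = ((2 * Real.pi * b * x : ℝ) : ℂ) * Complex.I := by
    push_cast; ring
  rw [modulationFun, h, Complex.norm_exp_ofReal_mul_I]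

theorem memLp_modulation (b : ℝ) (g : L2R) :
    MemLp (fun x => modulationFun b x * g x) 2 (volume : Measure ℝ) := by
  have hc : Continuous (modulationFun b) := by unfold modulationFun; fun_prop
  refine (Lp.memLp g).of_le (hc.aestronglyMeasurable.mul (Lp.aestronglyMeasurable g)) ?_
  exact Eventually.of_forall fun x => by simp [norm_modulationFun]

/-- Modulation `(M_b g)(x) = exp(2 π i b x) g(x)` on `L²(ℝ)`. -/
def modulationL2 (b : ℝ) : L2R →L[ℂ] L2R :=
  LinearMap.mkContinuous
    { toFun := fun g => (memLp_modulation b g).toLp _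
      map_add' := fun g g' => by
        rw [← MemLp.toLp_add, MemLp.toLp_eq_toLp_iff]
        filter_upwards [Lp.coeFn_add g g'] with x hx
        rw [hx, Pi.add_apply, Pi.add_apply, mul_add]
      map_smul' := fun c g => by
        rw [RingHom.id_apply, ← MemLp.toLp_const_smul, MemLp.toLp_eq_toLp_iff]
        filter_upwards [Lp.coeFn_smul c g] with x hx
        simp only [hx, Pi.smul_apply, smul_eq_mul]
        ring }
    1 (fun g => by
      rw [one_mul]
      refine Lp.norm_le_norm_of_ae_le ?_
      filter_upwards [(memLp_modulation b g).coeFn_toLp] with x hx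
      simp only [LinearMap.coe_mk, AddHom.coe_mk, hx, norm_mul, norm_modulationFun, one_mul, le_refl])

/-- The Schrödinger representation
`ρ_λ(p,q,t) = exp(-2 π i λ (t - pq/2)) T_{λp} M_q` of `ℍ` on `L²(ℝ)`. -/
def schrodinger (lam : ℝ) (x : Heisenberg) : L2R →L[ℂ] L2R :=
  Complex.exp (-(2 * Real.pi * Complex.I * lam * (x.t - x.p * x.q / 2))) •
    (translationL2 (lam * x.p)).comp (modulationL2 x.q)

/-- `A = ρ_λ(f) = ∫ f(x) ρ_λ(x) dx` in the weak operator sense (used for integrable `f`). -/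
def IsGroupFourier (lam : ℝ) (f : Heisenberg → ℂ) (A : L2R →L[ℂ] L2R) : Prop :=
  ∀ g h : L2R, inner ℂ h (A g) = ∫ x, f x * inner ℂ h (schrodinger lam x g)

section HilbertSchmidt

variable {H : Type*} [NormedAddCommGroup H] [InnerProductSpace ℂ H] [CompleteSpace H]

/-- The squared Hilbert-Schmidt norm `∑ ‖T η_i‖²` (possibly infinite), computed in some Hilbert
basis; by `hsNormSq_eq` below every Hilbert basis gives the same value. -/
def hsNormSq (T : H →L[ℂ] H) : ℝ≥0∞ :=
  ∑' i : (exists_hilbertBasis ℂ H).choose, ‖T (i : H)‖ₑ ^ 2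

theorem HilbertBasis.tsum_enorm_inner_sq {ι : Type*} (b : HilbertBasis ι ℂ H) (x : H) :
    ∑' i, ‖inner ℂ (b i) x‖ₑ ^ 2 = ‖x‖ₑ ^ 2 := by
  have h := b.hasSum_inner_mul_inner x x
  have h2 : HasSum (fun i => ‖inner ℂ (b i) x‖ ^ 2) (‖x‖ ^ 2) := by
    have h3 := (Complex.hasSum_re h)
    rw [inner_self_eq_norm_sq_to_K] at h3
    convert h3 using 1
    · funext i
      rw [← inner_conj_symm x (b i), ← Complex.normSq_eq_conj_mul_self, Complex.ofReal_re,
        Complex.normSq_eq_norm_sq]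
    · norm_cast
  have h4 := ENNReal.ofReal_tsum_of_nonneg (fun i => sq_nonneg ‖inner ℂ (b i) x‖) h2.summable
  rw [h2.tsum_eq] at h4
  simp only [ENNReal.ofReal_pow (norm_nonneg _), ofReal_norm] at h4
  exact h4.symm

theorem HilbertBasis.tsum_enorm_sq_adjoint {ι κ : Type*} (b : HilbertBasis ι ℂ H)
    (c : HilbertBasis κ ℂ H) (T : H →L[ℂ] H) :
    ∑' i, ‖T (b i)‖ₑ ^ 2 = ∑' j, ‖T.adjoint (c j)‖ₑ ^ 2 := by
  simp_rw [← c.tsum_enorm_inner_sq (T _), ← b.tsum_enorm_inner_sq (T.adjoint _)]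
  rw [ENNReal.tsum_comm]
  refine tsum_congr fun j => tsum_congr fun i => ?_
  rw [ContinuousLinearMap.adjoint_inner_right, ← inner_conj_symm, RCLike.enorm_conj]

theorem hsNormSq_eq {ι : Type*} (b : HilbertBasis ι ℂ H) (T : H →L[ℂ] H) :
    hsNormSq T = ∑' i, ‖T (b i)‖ₑ ^ 2 := by
  obtain ⟨c, hc⟩ := (exists_hilbertBasis ℂ H).choose_spec
  have h : hsNormSq T = ∑' i, ‖T (c i)‖ₑ ^ 2 := by
    rw [hc]; rfl
  rw [h, c.tsum_enorm_sq_adjoint b, ← b.tsum_enorm_sq_adjoint b]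

end HilbertSchmidt

/-- The Plancherel measure `|λ| dλ`. -/
def plancherelMeasure : Measure ℝ := volume.withDensity fun lam => ‖lam‖ₑ

/-- The field of operators `F` (read modulo null sets) is the Plancherel transform of `f ∈ L²(ℍ)`:
the value at `f` of the continuous extension of the group Fourier transform
`f ↦ (ρ_λ(f))_λ` from `L¹ ∩ L²(ℍ)` to `L²(ℍ)`, with values in the direct integral of
Hilbert-Schmidt operators with respect to `|λ| dλ`. That is, `F` is a measurable field and the
limit, in the norm of the direct integral, of the fields `ρ_λ(f_n)`, for a sequence `f_n` in
`L¹ ∩ L²(ℍ)` that tends to `f` in `L²(ℍ)`. -/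
def IsPlancherelTransform (f : L2H) (F : ℝ → L2R →L[ℂ] L2R) : Prop :=
  (∀ g h : L2R, AEMeasurable (fun lam => inner ℂ h (F lam g)) volume) ∧
  ∃ (f' : ℕ → L2H) (F' : ℕ → ℝ → L2R →L[ℂ] L2R),
    (∀ n, Integrable (f' n) volume) ∧
    (∀ n, ∀ lam : ℝ, lam ≠ 0 → IsGroupFourier lam (f' n) (F' n lam)) ∧
    Tendsto f' atTop (𝓝 f) ∧
    Tendsto (fun n => ∫⁻ lam, hsNormSq (F' n lam - F lam) ∂plancherelMeasure) atTop (𝓝 0)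

/-! ### The sub-Laplacian -/

/-- The derivative of `f` along the one-parameter subgroup `(hp, hq, 0)`, `h ∈ ℝ`, acting from
the right. -/
def leftInvariantDeriv (a b : ℝ) (f : Heisenberg → ℂ) (x : Heisenberg) : ℂ :=
  deriv (fun h : ℝ => f (x * Heisenberg.mk (h * a) (h * b) 0)) 0

/-- The left-invariant field `P`, of the subgroup `ℝ × {0} × {0}`. -/
abbrev fieldP : (Heisenberg → ℂ) → Heisenberg → ℂ := leftInvariantDeriv 1 0

/-- The left-invariant field `Q`, of the subgroup `{0} × ℝ × {0}`. -/
abbrev fieldQ : (Heisenberg → ℂ) → Heisenberg → ℂ := leftInvariantDeriv 0 1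

/-- The differential expression `-P² - Q²/(4π²)`. -/
def subLaplacianFun (f : Heisenberg → ℂ) (x : Heisenberg) : ℂ :=
  -fieldP (fieldP f) x - fieldQ (fieldQ f) x / (4 * Real.pi ^ 2)

/-- Test functions: smooth and compactly supported. -/
def IsTestFunction (f : Heisenberg → ℂ) : Prop := ContDiff ℝ ∞ f ∧ HasCompactSupport f

theorem IsTestFunction.add {f g : Heisenberg → ℂ} (hf : IsTestFunction f) (hg : IsTestFunction g) :
    IsTestFunction (f + g) := ⟨hf.1.add hg.1, hf.2.add hg.2⟩

theorem IsTestFunction.smul {f : Heisenberg → ℂ} (c : ℂ) (hf : IsTestFunction f) :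
    IsTestFunction (c • f) := ⟨hf.1.const_smul c, hf.2.smul_left (f := fun _ => c)⟩

theorem IsTestFunction.memLp {f : Heisenberg → ℂ} (hf : IsTestFunction f) :
    MemLp f 2 (volume : Measure Heisenberg) := hf.1.continuous.memLp_of_hasCompactSupport hf.2

theorem IsTestFunction.eq_of_ae {f g : Heisenberg → ℂ} (hf : IsTestFunction f)
    (hg : IsTestFunction g) (h : f =ᵐ[volume] g) : f = g :=
  (hf.1.continuous.ae_eq_iff_eq volume hg.1.continuous).1 h

theorem hasDerivAt_oneParam (a b : ℝ) {f : Heisenberg → ℂ} (hf : Differentiable ℝ f)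
    (x : Heisenberg) :
    HasDerivAt (fun h : ℝ => f (x * Heisenberg.mk (h * a) (h * b) 0))
      (fderiv ℝ f x (Heisenberg.mk a b ((x.p * b - a * x.q) / 2))) 0 := by
  have h1 : (fun h : ℝ => x * Heisenberg.mk (h * a) (h * b) 0)
      = fun h : ℝ => x + h • Heisenberg.mk a b ((x.p * b - a * x.q) / 2) := by
    funext h
    refine Heisenberg.ext_coord rfl rfl ?_
    change x.t + 0 + (x.p * (h * b) - h * a * x.q) / 2 = x.t + h * ((x.p * b - a * x.q) / 2)
    ring
  have h2 : HasDerivAt (fun h : ℝ => x * Heisenberg.mk (h * a) (h * b) 0)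
      (Heisenberg.mk a b ((x.p * b - a * x.q) / 2)) 0 := by
    rw [h1]
    simpa using ((hasDerivAt_id (0 : ℝ)).smul_const
      (Heisenberg.mk a b ((x.p * b - a * x.q) / 2))).const_add x
  have h3 : x * Heisenberg.mk ((0 : ℝ) * a) ((0 : ℝ) * b) 0 = x := by
    have := congrFun h1 0
    simpa using this
  have h4 : HasFDerivAt f (fderiv ℝ f x) (x * Heisenberg.mk ((0 : ℝ) * a) ((0 : ℝ) * b) 0) := by
    rw [h3]
    exact (hf x).hasFDerivAt
  exact h4.comp_hasDerivAt (0 : ℝ) h2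

theorem leftInvariantDeriv_eq (a b : ℝ) {f : Heisenberg → ℂ} (hf : Differentiable ℝ f) :
    leftInvariantDeriv a b f
      = fun x => fderiv ℝ f x (Heisenberg.mk a b ((x.p * b - a * x.q) / 2)) :=
  funext fun x => (hasDerivAt_oneParam a b hf x).deriv

theorem IsTestFunction.differentiable {f : Heisenberg → ℂ} (hf : IsTestFunction f) :
    Differentiable ℝ f := hf.1.differentiable (by simp)

theorem contDiff_direction (a b : ℝ) :
    ContDiff ℝ ∞ (fun x : Heisenberg => Heisenberg.mk a b ((x.p * b - a * x.q) / 2)) := by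
  have hp : ContDiff ℝ ∞ (fun x : ℝ × ℝ × ℝ => x.1) := contDiff_fst
  have hq : ContDiff ℝ ∞ (fun x : ℝ × ℝ × ℝ => x.2.1) := contDiff_fst.comp contDiff_snd
  have h : ContDiff ℝ ∞ (fun x : ℝ × ℝ × ℝ => (a, b, (x.1 * b - a * x.2.1) / 2)) :=
    contDiff_const.prodMk (contDiff_const.prodMk
      (((hp.mul contDiff_const).sub (contDiff_const.mul hq)).div_const 2))
  exact h

theorem IsTestFunction.leftInvariantDeriv (a b : ℝ) {f : Heisenberg → ℂ} (hf : IsTestFunction f) :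
    IsTestFunction (leftInvariantDeriv a b f) := by
  rw [leftInvariantDeriv_eq a b hf.differentiable]
  refine ⟨(hf.1.fderiv_right (by simp)).clm_apply (contDiff_direction a b), ?_⟩
  refine (hf.2.fderiv ℝ).mono' ?_
  refine fun x hx => subset_tsupport _ ?_
  intro h0
  apply hx
  simp [h0]

theorem leftInvariantDeriv_add (a b : ℝ) {f g : Heisenberg → ℂ} (hf : IsTestFunction f)
    (hg : IsTestFunction g) : leftInvariantDeriv a b (f + g)
      = leftInvariantDeriv a b f + leftInvariantDeriv a b g := by
  funext x
  exact ((hasDerivAt_oneParam a b hf.differentiable x).differentiableAt.hasDerivAt.add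
    (hasDerivAt_oneParam a b hg.differentiable x).differentiableAt.hasDerivAt).deriv

theorem leftInvariantDeriv_smul (a b : ℝ) (c : ℂ) {f : Heisenberg → ℂ} (hf : IsTestFunction f) :
    leftInvariantDeriv a b (c • f) = c • leftInvariantDeriv a b f := by
  funext x
  exact ((hasDerivAt_oneParam a b hf.differentiable x).differentiableAt.hasDerivAt.const_smul
    c).deriv

theorem IsTestFunction.subLaplacianFun {f : Heisenberg → ℂ} (hf : IsTestFunction f) :
    IsTestFunction (subLaplacianFun f) := by
  have h1 := ((hf.leftInvariantDeriv 1 0).leftInvariantDeriv 1 0).smul (-1)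
  have h2 := ((hf.leftInvariantDeriv 0 1).leftInvariantDeriv 0 1).smul (-(1 / (4 * Real.pi ^ 2)))
  convert h1.add h2 using 1
  funext x
  simp only [_root_.subLaplacianFun, Pi.add_apply, Pi.smul_apply, smul_eq_mul]
  ring

theorem subLaplacianFun_add {f g : Heisenberg → ℂ} (hf : IsTestFunction f)
    (hg : IsTestFunction g) :
    subLaplacianFun (f + g) = subLaplacianFun f + subLaplacianFun g := by
  funext x
  simp only [subLaplacianFun, leftInvariantDeriv_add _ _ hf hg,
    leftInvariantDeriv_add _ _ (hf.leftInvariantDeriv _ _) (hg.leftInvariantDeriv _ _),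
    Pi.add_apply]
  ring

theorem subLaplacianFun_smul (c : ℂ) {f : Heisenberg → ℂ} (hf : IsTestFunction f) :
    subLaplacianFun (c • f) = c • subLaplacianFun f := by
  funext x
  simp only [subLaplacianFun, leftInvariantDeriv_smul _ _ c hf,
    leftInvariantDeriv_smul _ _ c (hf.leftInvariantDeriv _ _), Pi.smul_apply, smul_eq_mul]
  ring

/-- The subspace `C_c^∞(ℍ)` of `L²(ℍ)`. -/
def testSubmodule : Submodule ℂ L2H where
  carrier := {u | ∃ f, IsTestFunction f ∧ u =ᵐ[volume] f}
  add_mem' := by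
    rintro u v ⟨f, hf, hu⟩ ⟨g, hg, hv⟩
    exact ⟨f + g, hf.add hg, (Lp.coeFn_add u v).trans (hu.add hv)⟩
  zero_mem' := ⟨0, ⟨contDiff_const, HasCompactSupport.zero⟩, Lp.coeFn_zero _ _ _⟩
  smul_mem' := by
    rintro c u ⟨f, hf, hu⟩
    exact ⟨c • f, hf.smul c, (Lp.coeFn_smul c u).trans (hu.const_smul c)⟩

/-- The smooth representative of an element of `C_c^∞(ℍ)`. -/
def testRep (u : testSubmodule) : Heisenberg → ℂ := u.2.choose

theorem isTestFunction_testRep (u : testSubmodule) : IsTestFunction (testRep u) :=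
  u.2.choose_spec.1

theorem coeFn_ae_eq_testRep (u : testSubmodule) : (u : L2H) =ᵐ[volume] testRep u :=
  u.2.choose_spec.2

/-- The sub-Laplacian with domain `C_c^∞(ℍ)`, as an unbounded operator on `L²(ℍ)`. -/
def subLaplacianCore : L2H →ₗ.[ℂ] L2H where
  domain := testSubmodule
  toFun :=
    { toFun := fun u => (isTestFunction_testRep u).subLaplacianFun.memLp.toLp _
      map_add' := fun u v => by
        have h : testRep (u + v) = testRep u + testRep v :=
          (isTestFunction_testRep _).eq_of_ae
            ((isTestFunction_testRep u).add (isTestFunction_testRep v))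
            ((coeFn_ae_eq_testRep (u + v)).symm.trans ((Lp.coeFn_add (u : L2H) v).trans
              ((coeFn_ae_eq_testRep u).add (coeFn_ae_eq_testRep v))))
        rw [← MemLp.toLp_add, MemLp.toLp_eq_toLp_iff, h,
          subLaplacianFun_add (isTestFunction_testRep u) (isTestFunction_testRep v)]
      map_smul' := fun c u => by
        have h : testRep (c • u) = c • testRep u :=
          (isTestFunction_testRep _).eq_of_ae ((isTestFunction_testRep u).smul c)
            ((coeFn_ae_eq_testRep (c • u)).symm.trans ((Lp.coeFn_smul c (u : L2H)).trans
              ((coeFn_ae_eq_testRep u).const_smul c)))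
        rw [RingHom.id_apply, ← MemLp.toLp_const_smul, MemLp.toLp_eq_toLp_iff, h,
          subLaplacianFun_smul c (isTestFunction_testRep u)] }

/-- The sub-Laplacian `𝓛` as an unbounded operator on `L²(ℍ)`: the closure of `-P² - Q²/(4π²)`
on `C_c^∞(ℍ)`. -/
def subLaplacian : L2H →ₗ.[ℂ] L2H := subLaplacianCore.closure

/-! ### Spectral measures -/

section SpectralMeasure

variable {H : Type*} [NormedAddCommGroup H] [InnerProductSpace ℂ H] [CompleteSpace H]

variable (H) in
/-- A projection-valued measure on the Borel sets of `ℝ`. (Values at non-Borel sets carry no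
meaning.) -/
structure ProjectionValuedMeasure where
  /-- the projection assigned to a Borel set -/
  proj : Set ℝ → H →L[ℂ] H
  isStarProjection : ∀ B, MeasurableSet B → IsStarProjection (proj B)
  empty : proj ∅ = 0
  univ : proj Set.univ = 1
  inter : ∀ B C, MeasurableSet B → MeasurableSet C → proj (B ∩ C) = proj B * proj C
  iUnion : ∀ B : ℕ → Set ℝ, (∀ n, MeasurableSet (B n)) → Pairwise (Function.onFun Disjoint B) →
    ∀ u : H, HasSum (fun n => proj (B n) u) (proj (⋃ n, B n) u)

namespace ProjectionValuedMeasure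

theorem inner_proj (E : ProjectionValuedMeasure H) {B : Set ℝ} (hB : MeasurableSet B) (u : H) :
    inner ℂ u (E.proj B u) = ((‖E.proj B u‖ ^ 2 : ℝ) : ℂ) := by
  have h := E.isStarProjection B hB
  have h1 : E.proj B (E.proj B u) = E.proj B u :=
    congrArg (fun T : H →L[ℂ] H => T u) h.isIdempotentElem.eq
  have h2 : (E.proj B).adjoint = E.proj B := h.isSelfAdjoint.star_eq
  calc inner ℂ u (E.proj B u) = inner ℂ u ((E.proj B).adjoint (E.proj B u)) := by rw [h2, h1]
    _ = inner ℂ (E.proj B u) (E.proj B u) := ContinuousLinearMap.adjoint_inner_right _ _ _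
    _ = _ := by rw [inner_self_eq_norm_sq_to_K]; norm_cast

/-- The finite measure `B ↦ ⟨E(B)u, u⟩ = ‖E(B)u‖²`. -/
def scalarMeasure (E : ProjectionValuedMeasure H) (u : H) : Measure ℝ :=
  Measure.ofMeasurable (fun B _ => ENNReal.ofReal (‖E.proj B u‖ ^ 2)) (by simp [E.empty])
    (by
      intro B hB hd
      have h := (E.iUnion B hB hd u).mapL (innerSL ℂ u)
      simp only [innerSL_apply_apply, E.inner_proj (hB _), E.inner_proj (MeasurableSet.iUnion hB)] at h
      have h' : HasSum (fun n => ‖E.proj (B n) u‖ ^ 2) (‖E.proj (⋃ n, B n) u‖ ^ 2) := by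
        exact_mod_cast h
      rw [← h'.tsum_eq, ENNReal.ofReal_tsum_of_nonneg (fun n => sq_nonneg _) h'.summable])

end ProjectionValuedMeasure

/-- `E` is the spectral measure of the unbounded operator `A`, that is `A = ∫ t dE(t)`: the
domain of `A` consists of all `u` with `∫ t² d⟨E(t)u, u⟩ < ∞`, and
`⟨A u, u⟩ = ∫ t d⟨E(t)u, u⟩` for these `u`. -/
def IsSpectralMeasure (A : H →ₗ.[ℂ] H) (E : ProjectionValuedMeasure H) : Prop :=
  (∀ u : H, u ∈ A.domain ↔ ∫⁻ t, ENNReal.ofReal (t ^ 2) ∂(E.scalarMeasure u) < ⊤) ∧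
  ∀ u : A.domain, inner ℂ (u : H) (A u) = ((∫ t, t ∂(E.scalarMeasure (u : H)) : ℝ) : ℂ)

end SpectralMeasure

/-! ### Hermite functions -/

/-- The Hermite function
`h_n(x) = (-1)^n / √(2^n n! √π) · exp(x²/2) · (d/dx)^n exp(-x²)`. -/
def hermiteFun (n : ℕ) (x : ℝ) : ℝ :=
  (-1) ^ n / √(2 ^ n * n.factorial * √Real.pi) * Real.exp (x ^ 2 / 2)
    * iteratedDeriv n (fun y : ℝ => Real.exp (-y ^ 2)) x

/-- The dilated Hermite function `h_{n,a}(x) = |a|^{-1/4} h_n(|a|^{-1/2} x)`. -/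
def dilatedHermiteFun (n : ℕ) (a x : ℝ) : ℝ :=
  |a| ^ (-(1 / 4) : ℝ) * hermiteFun n (|a| ^ (-(1 / 2) : ℝ) * x)

theorem iteratedDeriv_gauss (n : ℕ) : ∃ r : Polynomial ℝ, ∀ x : ℝ,
    iteratedDeriv n (fun y : ℝ => Real.exp (-y ^ 2)) x = r.eval x * Real.exp (-x ^ 2) := by
  induction n with
  | zero => exact ⟨1, fun x => by simp⟩
  | succ n ih =>
    obtain ⟨r, hr⟩ := ih
    refine ⟨r.derivative - 2 * Polynomial.X * r, fun x => ?_⟩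
    rw [iteratedDeriv_succ, funext hr]
    have h1 : HasDerivAt (fun y : ℝ => Real.exp (-y ^ 2)) (Real.exp (-x ^ 2) * -(2 * x)) x := by
      have := ((hasDerivAt_pow 2 x).neg).exp
      simpa using this
    have h2 := ((r.hasDerivAt x).mul h1).deriv
    refine h2.trans ?_
    simp only [Polynomial.eval_sub, Polynomial.eval_mul, Polynomial.eval_X, Polynomial.eval_ofNat]
    ring

theorem hermiteFun_eq (n : ℕ) : ∃ r : Polynomial ℝ, ∀ x : ℝ,
    hermiteFun n x = r.eval x * Real.exp (-(x ^ 2 / 2)) := by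
  obtain ⟨r, hr⟩ := iteratedDeriv_gauss n
  refine ⟨Polynomial.C ((-1) ^ n / √(2 ^ n * n.factorial * √Real.pi)) * r, fun x => ?_⟩
  have h : Real.exp (-(x ^ 2 / 2)) = Real.exp (x ^ 2 / 2) * Real.exp (-x ^ 2) := by
    rw [← Real.exp_add]; congr 1; ring
  rw [hermiteFun, hr, h, Polynomial.eval_mul, Polynomial.eval_C]
  ring

theorem integrable_poly_mul_gauss (r : Polynomial ℝ) {b : ℝ} (hb : 0 < b) :
    Integrable (fun x : ℝ => r.eval x * Real.exp (-b * x ^ 2)) := by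
  have h : (fun x : ℝ => r.eval x * Real.exp (-b * x ^ 2))
      = fun x => ∑ i ∈ r.support, r.coeff i * (x ^ (i : ℝ) * Real.exp (-b * x ^ 2)) := by
    funext x
    rw [Polynomial.eval_eq_sum, Polynomial.sum, Finset.sum_mul]
    simp only [Real.rpow_natCast, mul_assoc]
  rw [h]
  exact integrable_finsetSum _ fun i _ => (integrable_rpow_mul_exp_neg_mul_sq hb
    (lt_of_lt_of_le (by norm_num) (Nat.cast_nonneg i))).const_mul _

theorem memLp_dilatedHermiteFun (n : ℕ) (a : ℝ) :
    MemLp (fun x => (dilatedHermiteFun n a x : ℂ)) 2 (volume : Measure ℝ) := by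
  suffices hs : MemLp (dilatedHermiteFun n a) 2 (volume : Measure ℝ) from hs.ofReal
  obtain ⟨r, hr⟩ := hermiteFun_eq n
  rcases eq_or_ne a 0 with rfl | ha
  · have h : dilatedHermiteFun n 0 = 0 := by
      funext x
      rw [dilatedHermiteFun, abs_zero, Real.zero_rpow (by norm_num), zero_mul]; rfl
    rw [h]; exact MemLp.zero
  set c : ℝ := |a| ^ (-(1 / 2) : ℝ) with hc
  have hc0 : 0 < c := Real.rpow_pos_of_pos (abs_pos.2 ha) _
  have he : dilatedHermiteFun n a = fun x =>
      |a| ^ (-(1 / 4) : ℝ) * (r.eval (c * x) * Real.exp (-((c * x) ^ 2 / 2))) := by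
    funext x
    rw [dilatedHermiteFun, hr]
  rw [he]
  refine MemLp.const_mul ?_ _
  rw [memLp_two_iff_integrable_sq (by
    exact (by fun_prop : Continuous _).aestronglyMeasurable)]
  have h := integrable_poly_mul_gauss ((r.comp (Polynomial.C c * Polynomial.X)) ^ 2)
    (b := c ^ 2) (by positivity)
  convert h using 2 with x
  rw [mul_pow, ← Real.exp_nat_mul, Polynomial.eval_pow, Polynomial.eval_comp]
  simp only [Polynomial.eval_mul, Polynomial.eval_C, Polynomial.eval_X]
  congr 2
  push_cast
  ring

/-- The dilated Hermite function `h_{n,a}` as an element of `L²(ℝ)`. -/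
def dilatedHermite (n : ℕ) (a : ℝ) : L2R := (memLp_dilatedHermiteFun n a).toLp _

/-- `d(λ) = ⌊1/(2|λ|) - 1/2⌋`. -/
def hermiteCutoff (lam : ℝ) : ℤ := ⌊1 / (2 * |lam|) - 1 / 2⌋

/-- `P̂_λ = ∑_{n = 0, …, d(λ)} h_{n,λ} ⊗ h_{n,λ}`, where `η ⊗ φ : z ↦ ⟨z, φ⟩ η`
(the sum has `d(λ) + 1` terms, and is empty if `d(λ) = -1`). -/
def paleyWienerFiber (lam : ℝ) : L2R →L[ℂ] L2R :=
  ∑ n ∈ Finset.range (hermiteCutoff lam + 1).toNat,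
    InnerProductSpace.rankOne ℂ (dilatedHermite n lam) (dilatedHermite n lam)

/-- The integrand `y ↦ f(y) g(y⁻¹ x)` of the group convolution. -/
def convolutionIntegrand (f g : Heisenberg → ℂ) (x y : Heisenberg) : ℂ := f y * g (y⁻¹ * x)

/-- Group convolution `(f ∗ g)(x) = ∫ f(y) g(y⁻¹ x) dy` on the Heisenberg group. -/
def heisenbergConvolution (f g : Heisenberg → ℂ) (x : Heisenberg) : ℂ :=
  ∫ y, convolutionIntegrand f g x y

end

/-!
The proof is a diagonalization of the sub-Laplacian by the matrix coefficients of the Schrödinger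
representations in the dilated Hermite bases `h_{n,λ}`.

For integrable `f` put `f^(λ, m, n) = √|λ| ⟨h_{m,λ}, ρ_λ(f) h_{n,λ}⟩`. In coordinates,
`⟨h_{m,λ}, ρ_λ(p, q, t) h_{n,λ}⟩` is a character of `t` times a Fourier-Wigner transform of two
Hermite functions, so Plancherel's theorem on the line, applied in `t`, `q` and `p`, shows that
`f ↦ f^` extends to an isometry of `L²(ℍ)` into `L²(ℝ × ℕ × ℕ)`. It is onto because it maps the
*wave packets* `x ↦ ∫ c(λ) √|λ| conj ⟨h_{m,λ}, ρ_λ(x) h_{n,λ}⟩ dλ` (`c` bounded and measurable with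
bounded support) to the functions supported on a single sheet `(m, n)` and equal to `c` there. The
resulting unitary `coeffEquiv` describes Plancherel transforms completely: a measurable field of
operators is the Plancherel transform of `f` if and only if its matrix coefficients are those of
`coeffEquiv f` (`isPlancherelTransform_iff`). Existence follows, since a square summable matrix is
the matrix of a bounded operator, and so does uniqueness.

The fields `P` and `Q` act on the matrix coefficients through the ladder relations of the Hermite
functions, which makes a wave packet an eigenfunction fibrewise: `-P² - Q²/(4π²)` multiplies `c(λ)`
by the symbol `|λ| (2n + 1)`. Wave packets are smooth but not compactly supported; a cutoff adapted
to the group dilations puts them into the domain of the closure, and since the operator is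
symmetric on test functions this identifies the closure with the maximal multiplication operator
by `|λ| (2n + 1)` (`isMultiplication_subLaplacian`). In particular it has a spectral measure.

For an arbitrary spectral measure `E` of a multiplication operator, the projection of an interval
`[b, c]` is the indicator of the preimage of `[b, c]` under the symbol
(`IsSpectralMeasure.proj_Icc_eq`). Here `|λ| (2n + 1) ≤ 1` says exactly `n ≤ d(λ)`, so on the
Fourier side `E([0, 1])` is composition with `P̂_λ`.

The field `P̂_λ` has square integrable coefficients, because its `n`-th diagonal coefficient lives
on `|λ| ≤ 1 / (2n + 1)`; so it is the Plancherel transform of some `p`. Then `(f * p)(x)` is the inner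
product with `f` of `y ↦ conj (p (y⁻¹ x))`, whose Plancherel transform is `ρ_λ(x) P̂_λ`, and for a
wave packet `f` this gives the wave packet with `c` cut off to `|λ| (2n + 1) ≤ 1`, that is
`E([0, 1]) f`. Wave packets span a dense subspace, and both sides are compatible with `L²` limits
along a subsequence.
-/


noncomputable section

/-! ### Square integrable functions -/

theorem lintegral_enorm_sq_eq {α : Type*} [MeasurableSpace α] {μ : Measure α} (f : Lp ℂ 2 μ) :
    ∫⁻ x, ‖f x‖ₑ ^ 2 ∂μ = ‖f‖ₑ ^ 2 := by
  rw [Lp.enorm_def, eLpNorm_eq_lintegral_rpow_enorm_toReal (by norm_num) (by norm_num)]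
  rw [← ENNReal.rpow_natCast, ← ENNReal.rpow_mul]
  norm_num

theorem memLp_two_of_lintegral_lt_top {α : Type*} [MeasurableSpace α] {μ : Measure α} {f : α → ℂ}
    (hf : AEStronglyMeasurable f μ) (h : ∫⁻ x, ‖f x‖ₑ ^ 2 ∂μ < ⊤) : MemLp f 2 μ := by
  refine ⟨hf, ?_⟩
  rw [eLpNorm_lt_top_iff_lintegral_rpow_enorm_lt_top (by norm_num) (by norm_num)]
  simpa using h

theorem lintegral_enorm_sq_lt_top {α : Type*} [MeasurableSpace α] {μ : Measure α} {f : α → ℂ}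
    (hf : MemLp f 2 μ) : ∫⁻ x, ‖f x‖ₑ ^ 2 ∂μ < ⊤ := by
  have := hf.2
  rw [eLpNorm_lt_top_iff_lintegral_rpow_enorm_lt_top (by norm_num) (by norm_num)] at this
  simpa using this

/-! ### Plancherel's theorem on the line for `L¹ ∩ L²` -/

open scoped FourierTransform SchwartzMap in
/-- The `L²` Fourier transform of a function in `L¹ ∩ L²` is given by the Fourier integral: both
have the same pairing with every test function. -/
theorem fourier_toLp_ae_eq {g : ℝ → ℂ} (h1 : Integrable g) (h2 : MemLp g 2) :
    (𝓕 (h2.toLp g) : Lp ℂ 2 (volume : Measure ℝ)) =ᵐ[volume] 𝓕 g := by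
  have hcont : Continuous (𝓕 g) := by
    exact VectorFourier.fourierIntegral_continuous Real.continuous_fourierChar
      (by exact continuous_inner) h1
  refine ae_eq_of_integral_contDiff_smul_eq ((Lp.memLp _).locallyIntegrable (by norm_num))
    hcont.locallyIntegrable ?_
  intro r hr1 hr2
  have hg₁ : HasCompactSupport (Complex.ofRealCLM ∘ r) := hr2.comp_left rfl
  have hg₂ : ContDiff ℝ ∞ (Complex.ofRealCLM ∘ r) := by fun_prop
  set φ : 𝓢(ℝ, ℂ) := hg₁.toSchwartzMap hg₂ with hφ
  have hφx : ∀ x, φ x = (r x : ℂ) := fun x => rfl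
  have h3 := congrArg (fun T => T φ) (Lp.fourier_toTemperedDistribution_eq (h2.toLp g))
  simp only [TemperedDistribution.fourier_apply, Lp.toTemperedDistribution_apply] at h3
  have h4 : ∫ x, (𝓕 φ) x • (h2.toLp g) x = ∫ x, (𝓕 φ) x • g x := by
    refine integral_congr_ae ?_
    filter_upwards [h2.coeFn_toLp] with x hx
    rw [hx]
  have h5 : ∫ x, (𝓕 φ) x • g x = ∫ x, φ x • 𝓕 g x := by
    have := VectorFourier.integral_fourierIntegral_smul_eq_flip (L := innerₗ ℝ)
      Real.continuous_fourierChar (by exact continuous_inner) (φ.integrable (μ := volume)) h1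
    simpa using! this
  rw [h4, h5] at h3
  simp only [hφx] at h3
  simpa using h3.symm

open scoped FourierTransform in
theorem integral_modulation_eq (g : ℝ → ℂ) (b : ℝ) :
    ∫ x, modulationFun b x * g x = 𝓕 g (-b) := by
  rw [Real.fourier_real_eq_integral_exp_smul]
  refine integral_congr_ae (Eventually.of_forall fun x => ?_)
  simp only [modulationFun, smul_eq_mul]
  congr 2
  push_cast; ring

/-- The Plancherel theorem on the line, in terms of `modulationFun`. -/
theorem lintegral_enorm_sq_integral_modulation {g : ℝ → ℂ} (h1 : Integrable g) (h2 : MemLp g 2) :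
    ∫⁻ b, ‖∫ x, modulationFun b x * g x‖ₑ ^ 2 = ∫⁻ x, ‖g x‖ₑ ^ 2 := by
  simp_rw [integral_modulation_eq]
  rw [(Measure.measurePreserving_neg (volume : Measure ℝ)).lintegral_comp_emb
    (MeasurableEquiv.neg ℝ).measurableEmbedding (fun b => ‖FourierTransform.fourier g b‖ₑ ^ 2)]
  rw [lintegral_congr_ae (g := fun x => ‖(FourierTransform.fourier (h2.toLp g) :
    Lp ℂ 2 (volume : Measure ℝ)) x‖ₑ ^ 2)
    (by filter_upwards [fourier_toLp_ae_eq h1 h2] with x hx; rw [hx])]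
  rw [lintegral_congr_ae (f := fun x => ‖g x‖ₑ ^ 2) (g := fun x => ‖h2.toLp g x‖ₑ ^ 2)
    (by filter_upwards [h2.coeFn_toLp] with x hx; rw [hx])]
  rw [lintegral_enorm_sq_eq, lintegral_enorm_sq_eq]
  congr 1
  rw [← ofReal_norm, ← ofReal_norm, Lp.norm_fourier_eq]

/-! ### Hermite functions: ladder relations -/

/-- The ladder coefficient `√(n/2)`. -/
def ladderCoeff (n : ℕ) : ℝ := √(n / 2)

theorem ladderCoeff_zero : ladderCoeff 0 = 0 := by simp [ladderCoeff]

theorem ladderCoeff_sq (n : ℕ) : ladderCoeff n * ladderCoeff n = n / 2 :=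
  Real.mul_self_sqrt (by positivity)

theorem ladderCoeff_succ_pos (n : ℕ) : 0 < ladderCoeff (n + 1) :=
  Real.sqrt_pos.2 (by positivity)

theorem differentiable_iteratedDeriv_gauss (n : ℕ) :
    Differentiable ℝ (iteratedDeriv n (fun y : ℝ => Real.exp (-y ^ 2))) :=
  (ContDiff.differentiable_iteratedDeriv (n := ⊤) n (by fun_prop)
    (by exact_mod_cast WithTop.coe_lt_top _))

theorem iteratedDeriv_gauss_succ_succ (n : ℕ) (x : ℝ) :
    iteratedDeriv (n + 2) (fun y : ℝ => Real.exp (-y ^ 2)) x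
      = -2 * x * iteratedDeriv (n + 1) (fun y : ℝ => Real.exp (-y ^ 2)) x
        - 2 * (n + 1) * iteratedDeriv n (fun y : ℝ => Real.exp (-y ^ 2)) x := by
  have h1 : ∀ x, iteratedDeriv 1 (fun y : ℝ => Real.exp (-y ^ 2)) x
      = -2 * x * iteratedDeriv 0 (fun y : ℝ => Real.exp (-y ^ 2)) x := by
    intro x
    rw [iteratedDeriv_one, iteratedDeriv_zero]
    have := ((hasDerivAt_pow 2 x).neg).exp.deriv
    refine this.trans ?_
    simp; ring
  have hd := fun k x => (differentiable_iteratedDeriv_gauss k x).hasDerivAt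
  simp_rw [← iteratedDeriv_succ] at hd
  have hl : ∀ x : ℝ, HasDerivAt (fun x : ℝ => -2 * x) (-2) x := fun x => by
    simpa using (hasDerivAt_id x).const_mul (-2)
  induction n generalizing x with
  | zero =>
    have h2 := (hl x).mul (hd 0 x)
    rw [iteratedDeriv_succ, funext h1]
    refine h2.deriv.trans ?_
    simp only [zero_add, h1]
    push_cast; ring
  | succ n ih =>
    have h2 := ((hl x).mul (hd (n + 1) x)).sub ((hd n x).const_mul (2 * ((n : ℝ) + 1)))
    rw [iteratedDeriv_succ, funext ih]
    refine h2.deriv.trans ?_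
    rw [show iteratedDeriv (n + 1 + 1) (fun y : ℝ => Real.exp (-y ^ 2)) x = _ from ih x]
    push_cast; ring

theorem hermiteNorm_succ (n : ℕ) :
    2 * ladderCoeff (n + 1) * (1 / √(2 ^ (n + 1) * (n + 1).factorial * √Real.pi))
      = 1 / √(2 ^ n * n.factorial * √Real.pi) := by
  have h : (2 : ℝ) ^ (n + 1) * ((n + 1).factorial : ℝ) * √Real.pi
      = (2 * (n + 1)) * (2 ^ n * (n.factorial : ℝ) * √Real.pi) := by
    rw [Nat.factorial_succ]; push_cast; ring
  have h2 : 2 * ladderCoeff (n + 1) = √(2 * ((n : ℝ) + 1)) := by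
    rw [ladderCoeff, ← Real.sqrt_sq (by norm_num : (0 : ℝ) ≤ 2), ← Real.sqrt_mul (by norm_num)]
    congr 1; push_cast; rw [Real.sqrt_sq (by norm_num)]; ring
  have h3 : 0 < √(2 * ((n : ℝ) + 1)) := Real.sqrt_pos.2 (by positivity)
  rw [h, h2, Real.sqrt_mul (show 0 ≤ 2 * ((n : ℝ) + 1) by positivity)
    (2 ^ n * (n.factorial : ℝ) * √Real.pi)]
  field_simp

theorem hasDerivAt_hermiteFun_aux (n : ℕ) (x : ℝ) :
    HasDerivAt (hermiteFun n) (x * hermiteFun n x - 2 * ladderCoeff (n + 1) * hermiteFun (n + 1) x)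
      x := by
  have h1 : HasDerivAt (fun x : ℝ => Real.exp (x ^ 2 / 2)) (x * Real.exp (x ^ 2 / 2)) x := by
    have := ((hasDerivAt_pow 2 x).div_const 2).exp
    convert! this using 1; simp; ring
  have h2 := (differentiable_iteratedDeriv_gauss n x).hasDerivAt
  rw [← iteratedDeriv_succ] at h2
  have h3 := (h1.const_mul ((-1) ^ n / √(2 ^ n * n.factorial * √Real.pi))).mul h2
  convert! h3 using 1
  simp only [hermiteFun]
  have h4 := hermiteNorm_succ n
  rw [pow_succ (-1 : ℝ) n]
  linear_combination (Real.exp (x ^ 2 / 2) * (-1) ^ n *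
    iteratedDeriv (n + 1) (fun y : ℝ => Real.exp (-y ^ 2)) x) * h4

/-- Multiplication by `x` on the Hermite functions. -/
theorem mul_hermiteFun (n : ℕ) (x : ℝ) :
    x * hermiteFun n x
      = ladderCoeff (n + 1) * hermiteFun (n + 1) x + ladderCoeff n * hermiteFun (n - 1) x := by
  cases n with
  | zero =>
    have h4 := hermiteNorm_succ 0
    have h1 : iteratedDeriv 1 (fun y : ℝ => Real.exp (-y ^ 2)) x
      = -2 * x * iteratedDeriv 0 (fun y : ℝ => Real.exp (-y ^ 2)) x := by
      rw [iteratedDeriv_one, iteratedDeriv_zero]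
      have := ((hasDerivAt_pow 2 x).neg).exp.deriv
      refine this.trans ?_
      simp; ring
    rw [ladderCoeff_zero]
    simp only [hermiteFun, zero_add, h1] at h4 ⊢
    linear_combination (-x * Real.exp (x ^ 2 / 2) *
      iteratedDeriv 0 (fun y : ℝ => Real.exp (-y ^ 2)) x) * h4
  | succ n =>
    have h4 := hermiteNorm_succ (n + 1)
    have h5 := hermiteNorm_succ n
    have h6 : ladderCoeff (n + 1) * ladderCoeff (n + 1) = ((n : ℝ) + 1) / 2 := by
      rw [ladderCoeff_sq]; push_cast; ring
    have h1 := iteratedDeriv_gauss_succ_succ n x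
    simp only [hermiteFun, Nat.add_sub_cancel]
    rw [h1, pow_succ (-1 : ℝ) (n + 1), pow_succ (-1 : ℝ) n]
    set c1 := 1 / √(2 ^ (n + 1) * (n + 1).factorial * √Real.pi)
    set c0 := 1 / √(2 ^ n * n.factorial * √Real.pi)
    set c2 := 1 / √(2 ^ (n + 1 + 1) * (n + 1 + 1).factorial * √Real.pi)
    set D1 := iteratedDeriv (n + 1) (fun y : ℝ => Real.exp (-y ^ 2)) x
    set D0 := iteratedDeriv n (fun y : ℝ => Real.exp (-y ^ 2)) x
    set e := Real.exp (x ^ 2 / 2)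
    have e1 : ∀ z w : ℝ, z / w = z * (1 / w) := fun z w => by ring
    rw [e1 _ √(2 ^ (n + 1) * (n + 1).factorial * √Real.pi), e1 _ √(2 ^ n * n.factorial * √Real.pi),
      e1 _ √(2 ^ (n + 1 + 1) * (n + 1 + 1).factorial * √Real.pi)]
    change x * ((-1) ^ n * -1 * c1 * e * D1) =
      ladderCoeff (n + 1 + 1) * ((-1) ^ n * -1 * -1 * c2 * e * (-2 * x * D1 - 2 * (n + 1) * D0)) +
        ladderCoeff (n + 1) * ((-1) ^ n * c0 * e * D0)
    rw [← h5]
    linear_combination ((-1) ^ n * e * (x * D1 + (n + 1) * D0)) * h4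
      - ((-1) ^ n * e * D0 * 2 * c1) * h6

/-- The derivative of a Hermite function. -/
theorem hasDerivAt_hermiteFun (n : ℕ) (x : ℝ) :
    HasDerivAt (hermiteFun n)
      (ladderCoeff n * hermiteFun (n - 1) x - ladderCoeff (n + 1) * hermiteFun (n + 1) x) x := by
  convert! hasDerivAt_hermiteFun_aux n x using 1
  rw [mul_hermiteFun]; ring

theorem continuous_hermiteFun (n : ℕ) : Continuous (hermiteFun n) :=
  continuous_iff_continuousAt.2 fun x => (hasDerivAt_hermiteFun n x).continuousAt

theorem exists_bound_hermiteFun_aux (n : ℕ) : ∃ C, ∀ x, |hermiteFun n x| ≤ C := by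
  obtain ⟨r, hr⟩ := hermiteFun_eq n
  have key : ∀ k : ℕ, ∃ C : ℝ, ∀ x : ℝ, |x ^ k * Real.exp (-(x ^ 2 / 2))| ≤ C := by
    intro k
    refine ⟨1 + 2 ^ k * k.factorial, fun x => ?_⟩
    have h1 := Real.pow_div_factorial_le_exp (x ^ 2 / 2) (by positivity) k
    have h2 : x ^ (2 * k) * Real.exp (-(x ^ 2 / 2)) ≤ 2 ^ k * k.factorial := by
      rw [Real.exp_neg, ← div_eq_mul_inv, div_le_iff₀ (Real.exp_pos _)]
      rw [div_le_iff₀ (by positivity), div_pow, div_le_iff₀ (by positivity), ← pow_mul] at h1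
      nlinarith [h1]
    have h3 : |x ^ k| ≤ 1 + x ^ (2 * k) := by
      have : x ^ (2 * k) = |x ^ k| ^ 2 := by rw [sq_abs, ← pow_mul, mul_comm]
      rw [this]; nlinarith [sq_nonneg (|x ^ k| - 1), abs_nonneg (x ^ k)]
    rw [abs_mul, abs_of_pos (Real.exp_pos _)]
    have h4 : Real.exp (-(x ^ 2 / 2)) ≤ 1 := Real.exp_le_one_iff.2 (by nlinarith [sq_nonneg x])
    nlinarith [mul_le_mul_of_nonneg_right h3 (Real.exp_pos (-(x ^ 2 / 2))).le]
  choose C hC using key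
  refine ⟨∑ k ∈ r.support, |r.coeff k| * C k, fun x => ?_⟩
  rw [hr, Polynomial.eval_eq_sum, Polynomial.sum, Finset.sum_mul]
  refine (Finset.abs_sum_le_sum_abs _ _).trans (Finset.sum_le_sum fun k _ => ?_)
  rw [mul_assoc, abs_mul]
  exact mul_le_mul_of_nonneg_left (hC k x) (abs_nonneg _)

theorem exists_bound_mul_hermiteFun (k n : ℕ) : ∃ C, ∀ x : ℝ, |x ^ k * hermiteFun n x| ≤ C := by
  induction k generalizing n with
  | zero => simpa using exists_bound_hermiteFun_aux n
  | succ k ih =>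
    obtain ⟨C, hC⟩ := ih (n + 1)
    obtain ⟨D, hD⟩ := ih (n - 1)
    refine ⟨|ladderCoeff (n + 1)| * C + |ladderCoeff n| * D, fun x => ?_⟩
    have : x ^ (k + 1) * hermiteFun n x = ladderCoeff (n + 1) * (x ^ k * hermiteFun (n + 1) x)
        + ladderCoeff n * (x ^ k * hermiteFun (n - 1) x) := by
      rw [pow_succ, mul_assoc, mul_hermiteFun]; ring
    rw [this]
    refine (abs_add_le _ _).trans ?_
    rw [abs_mul (ladderCoeff _), abs_mul (ladderCoeff _)]
    exact add_le_add (mul_le_mul_of_nonneg_left (hC x) (abs_nonneg _))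
      (mul_le_mul_of_nonneg_left (hD x) (abs_nonneg _))

theorem exists_decay_hermiteFun (n : ℕ) :
    ∃ C, 0 ≤ C ∧ ∀ x, |hermiteFun n x| ≤ C * (1 + x ^ 2)⁻¹ := by
  obtain ⟨C, hC⟩ := exists_bound_mul_hermiteFun 0 n
  obtain ⟨D, hD⟩ := exists_bound_mul_hermiteFun 2 n
  refine ⟨C + D, ?_, fun x => ?_⟩
  · have h1 := (abs_nonneg _).trans (hC 0)
    have h2 := (abs_nonneg _).trans (hD 0)
    positivity
  · rw [← div_eq_mul_inv, le_div_iff₀ (by positivity)]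
    have h1 := hC x
    have h2 := hD x
    rw [abs_mul, abs_of_nonneg (by positivity)] at h1 h2
    nlinarith

theorem exists_le_hermiteFun (n : ℕ) : ∃ C, 0 ≤ C ∧ ∀ x, |hermiteFun n x| ≤ C := by
  obtain ⟨C, hC⟩ := exists_bound_hermiteFun_aux n
  exact ⟨C, (abs_nonneg _).trans (hC 0), hC⟩

theorem integrable_hermiteFun (n : ℕ) : Integrable (hermiteFun n) := by
  obtain ⟨C, -, hC⟩ := exists_decay_hermiteFun n
  exact (integrable_inv_one_add_sq.const_mul C).mono'
    (continuous_hermiteFun n).aestronglyMeasurable (Eventually.of_forall hC)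

theorem integrable_hermiteFun_mul (m n : ℕ) :
    Integrable (fun x => hermiteFun m x * hermiteFun n x) := by
  obtain ⟨C, -, hC⟩ := exists_le_hermiteFun m
  exact (integrable_hermiteFun n).bdd_mul (continuous_hermiteFun m).aestronglyMeasurable
    (Eventually.of_forall hC)

/-! ### Orthonormality of the Hermite functions -/

/-- `x - d/dx` is the adjoint of `x + d/dx`: integrate the derivative of `h_m h_n` and use the
ladder relations. -/
theorem integral_hermiteFun_mul_succ (m n : ℕ) :
    ladderCoeff (m + 1) * ∫ x, hermiteFun (m + 1) x * hermiteFun n x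
      = ladderCoeff n * ∫ x, hermiteFun m x * hermiteFun (n - 1) x := by
  have hi := integrable_hermiteFun_mul
  have h1 := integral_mul_deriv_eq_deriv_mul_of_integrable (A := ℝ)
    (fun x _ => hasDerivAt_hermiteFun m x)
    (fun x _ => hasDerivAt_hermiteFun n x)
    (by
      convert! ((hi m (n - 1)).const_mul (ladderCoeff n)).sub
        ((hi m (n + 1)).const_mul (ladderCoeff (n + 1))) using 1
      funext x; simp only [Pi.mul_apply, Pi.sub_apply]; ring)
    (by
      convert! ((hi (m - 1) n).const_mul (ladderCoeff m)).sub
        ((hi (m + 1) n).const_mul (ladderCoeff (m + 1))) using 1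
      funext x; simp only [Pi.mul_apply, Pi.sub_apply]; ring)
    (hi m n)
  -- integration by parts
  have h2 : ∫ x, (ladderCoeff n * (hermiteFun m x * hermiteFun (n - 1) x) -
        ladderCoeff (n + 1) * (hermiteFun m x * hermiteFun (n + 1) x))
      = -∫ x, (ladderCoeff m * (hermiteFun (m - 1) x * hermiteFun n x)
        - ladderCoeff (m + 1) * (hermiteFun (m + 1) x * hermiteFun n x)) := by
    convert! h1 using 2
    · funext x; ring
    · congr 1; funext x; ring
  -- `∫ h_m (x h_n) = ∫ (x h_m) h_n`
  have h3 : ∫ x, (ladderCoeff n * (hermiteFun m x * hermiteFun (n - 1) x) +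
        ladderCoeff (n + 1) * (hermiteFun m x * hermiteFun (n + 1) x))
      = ∫ x, (ladderCoeff m * (hermiteFun (m - 1) x * hermiteFun n x)
        + ladderCoeff (m + 1) * (hermiteFun (m + 1) x * hermiteFun n x)) := by
    congr 1; funext x
    linear_combination hermiteFun n x * mul_hermiteFun m x - hermiteFun m x * mul_hermiteFun n x
  rw [integral_sub ((hi _ _).const_mul _) ((hi _ _).const_mul _),
    integral_sub ((hi _ _).const_mul _) ((hi _ _).const_mul _)] at h2
  rw [integral_add ((hi _ _).const_mul _) ((hi _ _).const_mul _),
    integral_add ((hi _ _).const_mul _) ((hi _ _).const_mul _)] at h3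
  simp only [integral_const_mul] at h2 h3
  linarith

theorem hermiteFun_zero (x : ℝ) : hermiteFun 0 x = (√(√Real.pi))⁻¹ * Real.exp (-(x ^ 2 / 2)) := by
  have : Real.exp (-(x ^ 2 / 2)) = Real.exp (x ^ 2 / 2) * Real.exp (-x ^ 2) := by
    rw [← Real.exp_add]; congr 1; ring
  rw [this]
  simp [hermiteFun]; ring

/-- The Hermite functions are orthonormal. -/
theorem integral_hermiteFun_mul (m n : ℕ) :
    ∫ x, hermiteFun m x * hermiteFun n x = if m = n then 1 else 0 := by
  have h0 : ∀ m, ∫ x, hermiteFun (m + 1) x * hermiteFun 0 x = 0 := by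
    intro m
    have := integral_hermiteFun_mul_succ m 0
    rw [ladderCoeff_zero, zero_mul] at this
    exact (mul_eq_zero.1 this).resolve_left (ladderCoeff_succ_pos m).ne'
  induction m generalizing n with
  | zero =>
    cases n with
    | zero =>
      have h1 : ∀ x : ℝ, hermiteFun 0 x * hermiteFun 0 x
          = (√Real.pi)⁻¹ * Real.exp (-1 * x ^ 2) := by
        intro x
        rw [hermiteFun_zero]
        have : Real.exp (-1 * x ^ 2) = Real.exp (-(x ^ 2 / 2)) * Real.exp (-(x ^ 2 / 2)) := by
          rw [← Real.exp_add]; congr 1; ring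
        rw [this, mul_mul_mul_comm, ← mul_inv, Real.mul_self_sqrt (Real.sqrt_nonneg _)]
      simp_rw [h1]
      rw [integral_const_mul, integral_gaussian]
      simp [Real.sqrt_ne_zero', Real.pi_pos]
    | succ n =>
      simp_rw [mul_comm (hermiteFun 0 _)]
      rw [h0]; simp
  | succ m ih =>
    cases n with
    | zero => rw [h0]; simp
    | succ n =>
      have := integral_hermiteFun_mul_succ m (n + 1)
      rw [Nat.add_sub_cancel, ih] at this
      have hp := ladderCoeff_succ_pos m
      rw [mul_comm, ← eq_div_iff hp.ne'] at this
      rw [this]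
      by_cases h : m = n
      · subst h; simp [hp.ne']
      · simp [h]

/-! ### Completeness of the Hermite functions -/

theorem memLp_gauss_mul_exp (c : ℝ) :
    MemLp (fun x : ℝ => Real.exp |c * x| * Real.exp (-(x ^ 2 / 2))) 2 := by
  have hc : Continuous (fun x : ℝ => Real.exp |c * x| * Real.exp (-(x ^ 2 / 2))) := by fun_prop
  rw [memLp_two_iff_integrable_sq hc.aestronglyMeasurable]
  refine ((integrable_exp_neg_mul_sq (b := 1 / 2) (by norm_num)).const_mul
    (Real.exp (2 * c ^ 2))).mono' (by fun_prop) (Eventually.of_forall fun x => ?_)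
  rw [Real.norm_of_nonneg (by positivity), ← Real.exp_add, ← Real.exp_add, ← Real.exp_nat_mul]
  refine Real.exp_le_exp.2 ?_
  have : |c * x| ≤ c ^ 2 + x ^ 2 / 4 := by
    rw [abs_mul]
    nlinarith [sq_nonneg (|c| - |x| / 2), sq_abs c, sq_abs x]
  push_cast
  linarith

/-- A square integrable function all of whose Hermite coefficients vanish is zero. -/
theorem ae_eq_zero_of_hermite_coeff {u : ℝ → ℂ} (hu : MemLp u 2)
    (h : ∀ n, ∫ x, (hermiteFun n x : ℂ) * u x = 0) : u =ᵐ[volume] 0 := by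
  -- for `c = 2πb` this dominates the power series of `exp(2πibx)` times `e^{-x²/2} u`
  have hgauss : ∀ c : ℝ, Integrable
      (fun x => ((Real.exp |c * x| * Real.exp (-(x ^ 2 / 2)) : ℝ) : ℂ) * u x) := fun c =>
    ((memLp_gauss_mul_exp c).ofReal (K := ℂ)).integrable_mul hu
  have hxk : ∀ (k n : ℕ), Integrable (fun x : ℝ => ((x ^ k * hermiteFun n x : ℝ) : ℂ) * u x) := by
    intro k n
    have hL : MemLp (fun x : ℝ => x ^ k * hermiteFun n x) 2 := by
      obtain ⟨C, hC⟩ := exists_bound_mul_hermiteFun k n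
      obtain ⟨D, hD⟩ := exists_bound_mul_hermiteFun (k + 2) n
      have hc : Continuous (fun x : ℝ => x ^ k * hermiteFun n x) :=
        (continuous_pow k).mul (continuous_hermiteFun n)
      have hi : Integrable (fun x : ℝ => x ^ k * hermiteFun n x) := by
        refine (integrable_inv_one_add_sq.const_mul (C + D)).mono' hc.aestronglyMeasurable
          (Eventually.of_forall fun x => ?_)
        rw [← div_eq_mul_inv, le_div_iff₀ (by positivity), Real.norm_eq_abs]
        have h1 := hC x
        have h2 := hD x
        rw [pow_add, mul_comm (x ^ k), mul_assoc, abs_mul, abs_of_nonneg (sq_nonneg x)] at h2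
        nlinarith
      rw [memLp_two_iff_integrable_sq hc.aestronglyMeasurable]
      simp_rw [sq]
      exact hi.bdd_mul hc.aestronglyMeasurable (Eventually.of_forall hC)
    exact (hL.ofReal (K := ℂ)).integrable_mul hu
  -- multiplying by `x` moves along the ladder, so all moments of `h_n u` vanish
  have hmom : ∀ (k n : ℕ), ∫ x : ℝ, ((x ^ k * hermiteFun n x : ℝ) : ℂ) * u x = 0 := by
    intro k
    induction k with
    | zero => simpa using h
    | succ k ih =>
      intro n
      have e : ∀ x : ℝ, ((x ^ (k + 1) * hermiteFun n x : ℝ) : ℂ) * u x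
          = (ladderCoeff (n + 1) : ℂ) * (((x ^ k * hermiteFun (n + 1) x : ℝ) : ℂ) * u x)
            + (ladderCoeff n : ℂ) * (((x ^ k * hermiteFun (n - 1) x : ℝ) : ℂ) * u x) := by
        intro x
        have : x ^ (k + 1) * hermiteFun n x = ladderCoeff (n + 1) * (x ^ k * hermiteFun (n + 1) x)
            + ladderCoeff n * (x ^ k * hermiteFun (n - 1) x) := by
          rw [pow_succ, mul_assoc, mul_hermiteFun]; ring
        rw [this]; push_cast; ring
      simp_rw [e]
      rw [integral_add ((hxk _ _).const_mul _) ((hxk _ _).const_mul _), integral_const_mul,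
        integral_const_mul, ih, ih]
      simp
  have hmom' : ∀ k : ℕ, ∫ x : ℝ, ((x ^ k * Real.exp (-(x ^ 2 / 2)) : ℝ) : ℂ) * u x = 0 := by
    intro k
    have hpi : √(√Real.pi) ≠ 0 :=
      (Real.sqrt_pos.2 (Real.sqrt_pos.2 Real.pi_pos)).ne'
    have e : ∀ x : ℝ, ((x ^ k * Real.exp (-(x ^ 2 / 2)) : ℝ) : ℂ) * u x
        = (√(√Real.pi) : ℂ) * (((x ^ k * hermiteFun 0 x : ℝ) : ℂ) * u x) := by
      intro x
      rw [hermiteFun_zero]; push_cast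
      field_simp [show ((√(√Real.pi) : ℝ) : ℂ) ≠ 0 by exact_mod_cast hpi]
    simp_rw [e]
    rw [integral_const_mul, hmom, mul_zero]
  set g : ℝ → ℂ := fun x => ((Real.exp (-(x ^ 2 / 2)) : ℝ) : ℂ) * u x with hg
  have hg1 : Integrable g := by simpa [hg] using hgauss 0
  have hg2 : MemLp g 2 := by
    refine hu.of_le hg1.aestronglyMeasurable (Eventually.of_forall fun x => ?_)
    rw [hg, norm_mul, Complex.norm_real, Real.norm_of_nonneg (Real.exp_pos _).le]
    exact mul_le_of_le_one_left (norm_nonneg _)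
      (Real.exp_le_one_iff.2 (by nlinarith [sq_nonneg x]))
  have hF : ∀ b : ℝ, ∫ x, modulationFun b x * g x = 0 := by
    intro b
    -- expand the exponential: every term is a vanishing moment
    have hs := hasSum_integral_of_dominated_convergence (μ := volume)
      (F := fun (k : ℕ) (x : ℝ) => (2 * Real.pi * Complex.I * b * x) ^ k / (k.factorial : ℂ) * g x)
      (f := fun x => modulationFun b x * g x)
      (fun k x => |(2 * Real.pi * b) * x| ^ k / k.factorial * ‖g x‖)
      (fun k => by
        refine AEStronglyMeasurable.mul ?_ hg1.aestronglyMeasurable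
        exact (by fun_prop : Continuous _).aestronglyMeasurable)
      (fun k => Eventually.of_forall fun x => by
        rw [norm_mul, norm_div, norm_pow]
        simp only [norm_mul, Complex.norm_I, Complex.norm_real, abs_mul, Complex.norm_natCast,
          Complex.norm_ofNat, mul_one, Real.norm_eq_abs, Nat.abs_ofNat]
        exact le_rfl)
      (Eventually.of_forall fun x =>
        (Real.summable_pow_div_factorial |(2 * Real.pi * b) * x|).mul_right _)
      (by
        refine (hgauss (2 * Real.pi * b)).norm.congr (Eventually.of_forall fun x => ?_)
        simp only [norm_mul, tsum_mul_right, hg, Complex.norm_real, Real.norm_eq_abs]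
        have hexp : ∑' k : ℕ, |2 * Real.pi * b * x| ^ k / (k.factorial : ℝ)
            = Real.exp |2 * Real.pi * b * x| := by
          rw [Real.exp_eq_exp_ℝ, NormedSpace.exp_eq_tsum_div]
        rw [hexp]
        simp only [Real.abs_exp]
        ring)
      (Eventually.of_forall fun x => by
        refine HasSum.mul_right _ ?_
        rw [modulationFun, Complex.exp_eq_exp_ℂ]
        exact NormedSpace.expSeries_div_hasSum_exp _)
    refine hs.unique ?_
    have hz : ∀ k : ℕ,
        ∫ x : ℝ, (2 * Real.pi * Complex.I * b * x) ^ k / (k.factorial : ℂ) * g x = 0 := by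
      intro k
      have e : ∀ x : ℝ, (2 * Real.pi * Complex.I * b * x) ^ k / (k.factorial : ℂ) * g x
          = ((2 * Real.pi * Complex.I * b) ^ k / (k.factorial : ℂ))
            * (((x ^ k * Real.exp (-(x ^ 2 / 2)) : ℝ) : ℂ) * u x) := by
        intro x
        rw [hg]; push_cast; ring
      simp_rw [e]
      rw [integral_const_mul, hmom', mul_zero]
    simp_rw [hz]
    exact hasSum_zero
  have hP := lintegral_enorm_sq_integral_modulation hg1 hg2
  simp_rw [hF] at hP
  simp only [enorm_zero, ne_eq, OfNat.ofNat_ne_zero, not_false_eq_true, zero_pow,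
    lintegral_zero] at hP
  rw [eq_comm, lintegral_eq_zero_iff' (by
    exact (hg1.aestronglyMeasurable.enorm.pow_const 2))] at hP
  filter_upwards [hP] with x hx
  simp only [Pi.zero_apply, pow_eq_zero_iff two_ne_zero, enorm_eq_zero, hg, mul_eq_zero,
    Complex.ofReal_eq_zero, (Real.exp_pos _).ne', false_or] at hx ⊢
  simpa using hx

/-! ### The dilated Hermite basis -/

theorem inner_L2_eq {α : Type*} [MeasurableSpace α] {μ : Measure α} (f g : Lp ℂ 2 μ) :
    inner ℂ f g = ∫ x, (starRingEnd ℂ) (f x) * g x ∂μ := by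
  rw [L2.inner_def]
  simp only [RCLike.inner_apply, mul_comm]

theorem dilatedHermiteFun_eq (n : ℕ) (a x : ℝ) :
    dilatedHermiteFun n a x = |a| ^ (-(1 / 4) : ℝ) * hermiteFun n ((√|a|)⁻¹ * x) := by
  rw [dilatedHermiteFun, Real.rpow_neg (abs_nonneg a) (1 / 2), ← Real.sqrt_eq_rpow]

theorem dilation_sq {a : ℝ} : |a| ^ (-(1 / 4) : ℝ) * |a| ^ (-(1 / 4) : ℝ) = (√|a|)⁻¹ := by
  rw [← Real.rpow_add' (abs_nonneg a) (by norm_num), Real.sqrt_eq_rpow,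
    ← Real.rpow_neg (abs_nonneg a)]
  norm_num

theorem coeFn_dilatedHermite (n : ℕ) (a : ℝ) :
    dilatedHermite n a =ᵐ[volume] fun x => (dilatedHermiteFun n a x : ℂ) :=
  (memLp_dilatedHermiteFun n a).coeFn_toLp

theorem inner_dilatedHermite_left (n : ℕ) (a : ℝ) (u : L2R) :
    inner ℂ (dilatedHermite n a) u = ∫ x, (dilatedHermiteFun n a x : ℂ) * u x := by
  rw [inner_L2_eq]
  refine integral_congr_ae ?_
  filter_upwards [coeFn_dilatedHermite n a] with x hx
  rw [hx, Complex.conj_ofReal]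

theorem orthonormal_dilatedHermite {a : ℝ} (ha : a ≠ 0) :
    Orthonormal ℂ (fun n => dilatedHermite n a) := by
  rw [orthonormal_iff_ite]
  intro m n
  rw [inner_dilatedHermite_left]
  have hr : 0 < √|a| := Real.sqrt_pos.2 (abs_pos.2 ha)
  have h1 : ∫ x, (dilatedHermiteFun m a x : ℂ) * dilatedHermite n a x
      = ∫ x, (((√|a|)⁻¹ *
        (hermiteFun m ((√|a|)⁻¹ * x) * hermiteFun n ((√|a|)⁻¹ * x)) : ℝ) : ℂ) := by
    refine integral_congr_ae ?_
    filter_upwards [coeFn_dilatedHermite n a] with x hx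
    rw [hx, dilatedHermiteFun_eq, dilatedHermiteFun_eq, ← Complex.ofReal_mul, mul_mul_mul_comm,
      dilation_sq]
  rw [h1, integral_complex_ofReal, integral_const_mul,
    Measure.integral_comp_mul_left (fun x => hermiteFun m x * hermiteFun n x),
    integral_hermiteFun_mul, inv_inv, abs_of_pos hr, smul_eq_mul, inv_mul_cancel_left₀ hr.ne']
  split_ifs <;> simp

theorem eq_zero_of_dilatedHermite_coeff {a : ℝ} (ha : a ≠ 0) (u : L2R)
    (h : ∀ n, inner ℂ (dilatedHermite n a) u = 0) : u = 0 := by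
  have hr : 0 < √|a| := Real.sqrt_pos.2 (abs_pos.2 ha)
  have hsm := Lp.stronglyMeasurable u
  have hint : Integrable (fun x => ‖u x‖ ^ 2) :=
    (memLp_two_iff_integrable_sq_norm hsm.aestronglyMeasurable).1 (Lp.memLp u)
  have hv : MemLp (fun x => u (√|a| * x)) 2 := by
    refine (memLp_two_iff_integrable_sq_norm (f := fun x => u (√|a| * x))
      (hsm.comp_measurable (measurable_const_mul _)).aestronglyMeasurable).2 ?_
    exact hint.comp_mul_left' hr.ne'
  have hz := ae_eq_zero_of_hermite_coeff hv (fun n => by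
    have h1 := h n
    rw [inner_dilatedHermite_left] at h1
    have h2 := Measure.integral_comp_mul_left
      (fun x => (dilatedHermiteFun n a x : ℂ) * u x) (√|a|)
    rw [h1, smul_zero] at h2
    have h3 : ∀ x : ℝ, (dilatedHermiteFun n a (√|a| * x) : ℂ) * u (√|a| * x)
        = ((|a| ^ (-(1 / 4) : ℝ) : ℝ) : ℂ) * ((hermiteFun n x : ℂ) * u (√|a| * x)) := by
      intro x
      rw [dilatedHermiteFun_eq, inv_mul_cancel_left₀ hr.ne']; push_cast; ring
    simp_rw [h3] at h2
    rw [integral_const_mul] at h2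
    refine (mul_eq_zero.1 h2).resolve_left ?_
    exact_mod_cast (Real.rpow_pos_of_pos (abs_pos.2 ha) _).ne')
  have h4 := Measure.integral_comp_mul_left (fun x => ‖u x‖ ^ 2) (√|a|)
  rw [integral_congr_ae (g := fun _ => (0 : ℝ)) (by
    filter_upwards [hz] with x hx
    rw [hx]; simp), integral_zero, eq_comm, smul_eq_zero] at h4
  have h5 := h4.resolve_left (by positivity)
  rw [integral_eq_zero_iff_of_nonneg (fun x => by positivity) hint] at h5
  rw [Lp.eq_zero_iff_ae_eq_zero]
  filter_upwards [h5] with x hx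
  simpa using hx

/-- The Hilbert basis of `L²(ℝ)` formed by the dilated Hermite functions. -/
def hermiteBasis {a : ℝ} (ha : a ≠ 0) : HilbertBasis ℕ ℂ L2R :=
  HilbertBasis.mkOfOrthogonalEqBot (orthonormal_dilatedHermite ha) (by
    rw [Submodule.eq_bot_iff]
    intro u hu
    refine eq_zero_of_dilatedHermite_coeff ha u fun n => ?_
    exact (Submodule.mem_orthogonal _ _).1 hu _ (Submodule.subset_span ⟨n, rfl⟩))

theorem hermiteBasis_apply {a : ℝ} (ha : a ≠ 0) (n : ℕ) :
    hermiteBasis ha n = dilatedHermite n a := by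
  rw [hermiteBasis, HilbertBasis.coe_mkOfOrthogonalEqBot]

/-! ### Coordinates and Haar measure of the Heisenberg group -/

namespace Heisenberg

theorem continuous_p : Continuous p := continuous_fst (X := ℝ) (Y := ℝ × ℝ)
theorem continuous_q : Continuous q :=
  continuous_fst.comp (continuous_snd (X := ℝ) (Y := ℝ × ℝ))
theorem continuous_t : Continuous t :=
  continuous_snd.comp (continuous_snd (X := ℝ) (Y := ℝ × ℝ))

@[fun_prop] theorem measurable_p : Measurable p := continuous_p.measurable
@[fun_prop] theorem measurable_q : Measurable q := continuous_q.measurable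
@[fun_prop] theorem measurable_t : Measurable t := continuous_t.measurable

theorem measurable_mk : Measurable (fun z : ℝ × ℝ × ℝ => mk z.1 z.2.1 z.2.2) := measurable_id

theorem measurePreserving_mk :
    MeasurePreserving (fun z : ℝ × ℝ × ℝ => mk z.1 z.2.1 z.2.2) volume volume :=
  MeasurePreserving.id (volume : Measure (ℝ × ℝ × ℝ))

theorem measurableEmbedding_mk :
    MeasurableEmbedding (fun z : ℝ × ℝ × ℝ => mk z.1 z.2.1 z.2.2) :=
  MeasurableEmbedding.id (α := ℝ × ℝ × ℝ)

@[simp] theorem mk_p (a b c : ℝ) : (mk a b c).p = a := rfl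
@[simp] theorem mk_q (a b c : ℝ) : (mk a b c).q = b := rfl
@[simp] theorem mk_t (a b c : ℝ) : (mk a b c).t = c := rfl
@[simp] theorem mul_p (x y : Heisenberg) : (x * y).p = x.p + y.p := rfl
@[simp] theorem mul_q (x y : Heisenberg) : (x * y).q = x.q + y.q := rfl
@[simp] theorem mul_t (x y : Heisenberg) :
    (x * y).t = x.t + y.t + (x.p * y.q - y.p * x.q) / 2 := rfl

theorem measurePreserving_inv :
    MeasurePreserving (fun x : Heisenberg => x⁻¹) volume volume := by
  have h := Measure.measurePreserving_neg (volume : Measure ℝ)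
  exact h.prod (h.prod h)

theorem measurableEmbedding_inv : MeasurableEmbedding (fun x : Heisenberg => x⁻¹) :=
  (MeasurableEquiv.neg (ℝ × ℝ × ℝ)).measurableEmbedding

/-- Left translations preserve Lebesgue measure. -/
theorem measurePreserving_mul_left (x : Heisenberg) :
    MeasurePreserving (fun y : Heisenberg => x * y) volume volume := by
  have h1 : MeasurePreserving (fun z : ℝ × ℝ × ℝ =>
      (x.p + z.1, (x.q + z.2.1, (x.t + (x.p * z.2.1 - z.1 * x.q) / 2) + z.2.2))) volume volume := by
    refine MeasurePreserving.skew_product (f := fun p : ℝ => x.p + p)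
      (g := fun (p : ℝ) (w : ℝ × ℝ) =>
        (x.q + w.1, (x.t + (x.p * w.1 - p * x.q) / 2) + w.2))
      (measurePreserving_add_left volume x.p) (by fun_prop) ?_
    refine Eventually.of_forall fun p => ?_
    exact (MeasurePreserving.skew_product (f := fun q : ℝ => x.q + q)
      (g := fun (q : ℝ) (t : ℝ) => (x.t + (x.p * q - p * x.q) / 2) + t)
      (measurePreserving_add_left volume x.q) (by fun_prop)
      (Eventually.of_forall fun q => (measurePreserving_add_left volume _).map_eq)).map_eq
  convert! h1 using 1
  funext y
  refine ext_coord rfl rfl ?_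
  change x.t + y.t + (x.p * y.q - y.p * x.q) / 2 = x.t + (x.p * y.q - y.p * x.q) / 2 + y.t
  ring

/-- Left translation as a measurable equivalence. -/
def mulLeftEquiv (x : Heisenberg) : Heisenberg ≃ᵐ Heisenberg where
  toFun y := x * y
  invFun y := x⁻¹ * y
  left_inv := inv_mul_cancel_left x
  right_inv := mul_inv_cancel_left x
  measurable_toFun := (measurePreserving_mul_left x).measurable
  measurable_invFun := (measurePreserving_mul_left x⁻¹).measurable

theorem measurableEmbedding_mul_left (x : Heisenberg) :
    MeasurableEmbedding (fun y : Heisenberg => x * y) := (mulLeftEquiv x).measurableEmbedding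

end Heisenberg

/-! ### Matrix coefficients of the Schrödinger representation -/

theorem continuous_modulationFun : Continuous (fun z : ℝ × ℝ => modulationFun z.1 z.2) := by
  unfold modulationFun; fun_prop

@[fun_prop]
theorem Measurable.modulationFun {α : Type*} [MeasurableSpace α] {f g : α → ℝ}
    (hf : Measurable f) (hg : Measurable g) : Measurable (fun a => modulationFun (f a) (g a)) :=
  continuous_modulationFun.measurable.comp (hf.prodMk hg)

theorem modulationFun_comm (b x : ℝ) : modulationFun b x = modulationFun x b := by
  simp only [modulationFun]; congr 1; ring

theorem conj_modulationFun (b x : ℝ) :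
    (starRingEnd ℂ) (modulationFun b x) = modulationFun (-b) x := by
  rw [modulationFun, modulationFun, ← Complex.exp_conj]
  congr 1; simp [Complex.conj_ofNat]

/-- The central character times phase factor `exp(-2πiλ(t - pq/2))` of `ρ_λ(p,q,t)`. -/
def schrodingerPhase (lam : ℝ) (x : Heisenberg) : ℂ :=
  modulationFun (-lam) (x.t - x.p * x.q / 2)

theorem norm_schrodingerPhase (lam : ℝ) (x : Heisenberg) : ‖schrodingerPhase lam x‖ = 1 :=
  norm_modulationFun _ _

theorem coeFn_translationL2 (a : ℝ) (g : L2R) :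
    translationL2 a g =ᵐ[volume] fun y => g (y - a) :=
  Lp.coeFn_compMeasurePreserving _ (measurePreserving_sub_right volume a)

theorem coeFn_modulationL2 (b : ℝ) (g : L2R) :
    modulationL2 b g =ᵐ[volume] fun y => modulationFun b y * g y :=
  (memLp_modulation b g).coeFn_toLp

theorem schrodinger_apply (lam : ℝ) (x : Heisenberg) (g : L2R) :
    schrodinger lam x g
      = schrodingerPhase lam x • translationL2 (lam * x.p) (modulationL2 x.q g) := by
  have : schrodingerPhase lam x
      = Complex.exp (-(2 * Real.pi * Complex.I * lam * (x.t - x.p * x.q / 2))) := by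
    rw [schrodingerPhase, modulationFun]; congr 1; push_cast; ring
  rw [this]; rfl

theorem coeFn_schrodinger (lam : ℝ) (x : Heisenberg) (g : L2R) :
    schrodinger lam x g =ᵐ[volume] fun y => schrodingerPhase lam x *
      (modulationFun x.q (y - lam * x.p) * g (y - lam * x.p)) := by
  rw [schrodinger_apply]
  have h1 := (measurePreserving_sub_right volume (lam * x.p)).quasiMeasurePreserving.ae
    (coeFn_modulationL2 x.q g)
  filter_upwards [Lp.coeFn_smul (schrodingerPhase lam x)
    (translationL2 (lam * x.p) (modulationL2 x.q g)),
    coeFn_translationL2 (lam * x.p) (modulationL2 x.q g), h1] with y hy1 hy2 hy3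
  rw [hy1, Pi.smul_apply, hy2, hy3, smul_eq_mul]

/-- The matrix coefficients of `ρ_λ(x)` as integrals over the line. -/
theorem inner_schrodinger (lam : ℝ) (x : Heisenberg) (g h : L2R) :
    inner ℂ h (schrodinger lam x g) = schrodingerPhase lam x *
      ∫ y, (starRingEnd ℂ) (h y) * (modulationFun x.q (y - lam * x.p) * g (y - lam * x.p)) := by
  rw [inner_L2_eq, ← integral_const_mul]
  refine integral_congr_ae ?_
  filter_upwards [coeFn_schrodinger lam x g] with y hy
  rw [hy]; ring

theorem norm_schrodinger (lam : ℝ) (x : Heisenberg) (g : L2R) : ‖schrodinger lam x g‖ = ‖g‖ := by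
  rw [schrodinger_apply, norm_smul, norm_schrodingerPhase, one_mul]
  have h1 : ‖translationL2 (lam * x.p) (modulationL2 x.q g)‖ = ‖modulationL2 x.q g‖ :=
    LinearIsometry.norm_map _ _
  rw [h1, Lp.norm_def, Lp.norm_def]
  congr 1
  refine eLpNorm_congr_norm_ae ?_
  filter_upwards [coeFn_modulationL2 x.q g] with y hy
  rw [hy, norm_mul, norm_modulationFun, one_mul]

theorem schrodinger_mul (lam : ℝ) (x y : Heisenberg) :
    schrodinger lam (x * y) = schrodinger lam x * schrodinger lam y := by
  ext1 g
  rw [mul_apply_eq_comp]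
  refine Lp.ext ?_
  have h1 := (measurePreserving_sub_right volume (lam * x.p)).quasiMeasurePreserving.ae
    (coeFn_schrodinger lam y g)
  filter_upwards [coeFn_schrodinger lam (x * y) g, coeFn_schrodinger lam x (schrodinger lam y g),
    h1] with z h2 h3 h4
  rw [h2, h3, h4]
  have e : z - lam * x.p - lam * y.p = z - lam * (x * y).p := by simp; ring
  rw [e]
  have e2 : schrodingerPhase lam (x * y) * modulationFun (x * y).q (z - lam * (x * y).p)
      = schrodingerPhase lam x * modulationFun x.q (z - lam * x.p) *
        (schrodingerPhase lam y * modulationFun y.q (z - lam * (x * y).p)) := by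
    simp only [schrodingerPhase, modulationFun, ← Complex.exp_add, Heisenberg.mul_p,
      Heisenberg.mul_q, Heisenberg.mul_t]
    congr 1; push_cast; ring
  linear_combination g (z - lam * (x * y).p) * e2

theorem schrodinger_one (lam : ℝ) : schrodinger lam 1 = 1 := by
  ext1 g
  refine Lp.ext ?_
  filter_upwards [coeFn_schrodinger lam 1 g] with z h2
  rw [h2]
  have h1 : (1 : Heisenberg).p = 0 := rfl
  have h2 : (1 : Heisenberg).q = 0 := rfl
  have h3 : (1 : Heisenberg).t = 0 := rfl
  simp [schrodingerPhase, h1, h2, h3, modulationFun]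

theorem inner_schrodinger_inv (lam : ℝ) (x : Heisenberg) (g h : L2R) :
    inner ℂ h (schrodinger lam x⁻¹ g) = inner ℂ (schrodinger lam x h) g := by
  have hi : ∀ u v : L2R, inner ℂ (schrodinger lam x u) (schrodinger lam x v) = inner ℂ u v := by
    intro u v
    exact (LinearMap.norm_map_iff_inner_map_map (𝕜 := ℂ) (schrodinger lam x)).1
      (norm_schrodinger lam x) u v
  rw [← hi, ← mul_apply_eq_comp, ← schrodinger_mul, mul_inv_cancel, schrodinger_one]
  rfl

theorem stronglyMeasurable_inner_schrodinger (g h : L2R) :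
    StronglyMeasurable
      (fun z : ℝ × Heisenberg => inner ℂ h (schrodinger z.1 z.2 g)) := by
  simp_rw [inner_schrodinger]
  have hg := (Lp.stronglyMeasurable g).measurable
  have hh := (Lp.stronglyMeasurable h).measurable
  refine StronglyMeasurable.mul ?_ ?_
  · exact Measurable.stronglyMeasurable (by unfold schrodingerPhase; fun_prop)
  · refine StronglyMeasurable.integral_prod_right (f := fun (z : ℝ × Heisenberg) (y : ℝ) =>
      (starRingEnd ℂ) (h y) *
        (modulationFun z.2.q (y - z.1 * z.2.p) * g (y - z.1 * z.2.p))) ?_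
    refine Measurable.stronglyMeasurable ?_
    simp only [Function.uncurry_def]
    have hc : Measurable (starRingEnd ℂ) := Complex.continuous_conj.measurable
    fun_prop

/-! ### The group Fourier transform of integrable functions -/

theorem norm_inner_schrodinger_le (lam : ℝ) (x : Heisenberg) (g h : L2R) :
    ‖(inner ℂ h (schrodinger lam x g) : ℂ)‖ ≤ ‖h‖ * ‖g‖ := by
  refine (norm_inner_le_norm _ _).trans ?_
  rw [norm_schrodinger]

theorem stronglyMeasurable_inner_schrodinger_right (lam : ℝ) (g h : L2R) :
    StronglyMeasurable (fun x : Heisenberg => inner ℂ h (schrodinger lam x g)) :=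
  StronglyMeasurable.comp_measurable (g := fun x : Heisenberg => (lam, x))
    (stronglyMeasurable_inner_schrodinger g h) (measurable_const.prodMk measurable_id)

theorem integrable_mul_inner_schrodinger {f : Heisenberg → ℂ} (hf : Integrable f) (lam : ℝ)
    (g h : L2R) : Integrable (fun x => f x * inner ℂ h (schrodinger lam x g)) :=
  hf.mul_bdd (stronglyMeasurable_inner_schrodinger_right lam g h).aestronglyMeasurable
    (Eventually.of_forall fun x => norm_inner_schrodinger_le lam x g h)

/-- The weak integral defining `ρ_λ(f)` is a bounded sesquilinear form. -/
theorem exists_isGroupFourier {f : Heisenberg → ℂ} (hf : Integrable f) (lam : ℝ) :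
    ∃ A, IsGroupFourier lam f A := by
  let B : L2R →L⋆[ℂ] L2R →L[ℂ] ℂ := LinearMap.mkContinuous₂
    (LinearMap.mk₂'ₛₗ (starRingEnd ℂ) (RingHom.id ℂ)
      (fun h g => ∫ x, f x * inner ℂ h (schrodinger lam x g))
      (fun h h' g => by
        simp_rw [inner_add_left, mul_add]
        exact integral_add (integrable_mul_inner_schrodinger hf _ _ _)
          (integrable_mul_inner_schrodinger hf _ _ _))
      (fun c h g => by
        simp_rw [inner_smul_left, mul_left_comm (f _), integral_const_mul, smul_eq_mul])
      (fun h g g' => by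
        simp_rw [map_add, inner_add_right, mul_add]
        exact integral_add (integrable_mul_inner_schrodinger hf _ _ _)
          (integrable_mul_inner_schrodinger hf _ _ _))
      (fun c h g => by
        simp_rw [map_smul, inner_smul_right, mul_left_comm (f _), integral_const_mul, smul_eq_mul,
          RingHom.id_apply]))
    (∫ x, ‖f x‖) (fun h g => by
      refine (norm_integral_le_integral_norm _).trans ?_
      rw [mul_assoc, ← integral_mul_const]
      refine integral_mono (integrable_mul_inner_schrodinger hf _ _ _).norm
        (hf.norm.mul_const _) fun x => ?_
      rw [norm_mul]
      exact mul_le_mul_of_nonneg_left (norm_inner_schrodinger_le lam x g h) (norm_nonneg _))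
  refine ⟨(InnerProductSpace.continuousLinearMapOfBilin B).adjoint, fun g h => ?_⟩
  rw [ContinuousLinearMap.adjoint_inner_right, InnerProductSpace.continuousLinearMapOfBilin_apply]
  rfl

/-! ### The Plancherel formula in two variables -/

/-- The Plancherel theorem in two variables, applied first in `t` and then in `q`. -/
theorem lintegral_enorm_sq_fourier_two {F : ℝ → ℝ → ℂ} (hF : Measurable (Function.uncurry F))
    (h1 : ∫⁻ q, ∫⁻ t, ‖F q t‖ₑ < ⊤) (h2 : ∫⁻ q, ∫⁻ t, ‖F q t‖ₑ ^ 2 < ⊤) :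
    ∫⁻ lam, ∫⁻ s, ‖∫ q, modulationFun s q * ∫ t, modulationFun (-lam) t * F q t‖ₑ ^ 2
      = ∫⁻ q, ∫⁻ t, ‖F q t‖ₑ ^ 2 := by
  have hFq : ∀ q, Measurable (F q) := fun q => hF.of_uncurry_left
  have hG : StronglyMeasurable (fun z : ℝ × ℝ => ∫ t, modulationFun (-z.2) t * F z.1 t) := by
    refine StronglyMeasurable.integral_prod_right (f := fun (z : ℝ × ℝ) (t : ℝ) =>
      modulationFun (-z.2) t * F z.1 t) (Measurable.stronglyMeasurable ?_)
    have : Measurable (fun w : (ℝ × ℝ) × ℝ => F w.1.1 w.2) :=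
      hF.comp ((measurable_fst.comp measurable_fst).prodMk measurable_snd)
    simp only [Function.uncurry_def]
    fun_prop
  set G : ℝ → ℝ → ℂ := fun q lam => ∫ t, modulationFun (-lam) t * F q t with hGdef
  have hGm : Measurable (fun z : ℝ × ℝ => G z.1 z.2) := hG.measurable
  -- one-dimensional Plancherel in the variable `t`
  have e1 : ∫⁻ q, ∫⁻ lam, ‖G q lam‖ₑ ^ 2 = ∫⁻ q, ∫⁻ t, ‖F q t‖ₑ ^ 2 := by
    have hm1 : Measurable (fun q => ∫⁻ t, ‖F q t‖ₑ) :=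
      Measurable.lintegral_prod_right' (f := fun z : ℝ × ℝ => ‖F z.1 z.2‖ₑ) hF.enorm
    have hm2 : Measurable (fun q => ∫⁻ t, ‖F q t‖ₑ ^ 2) :=
      Measurable.lintegral_prod_right' (f := fun z : ℝ × ℝ => ‖F z.1 z.2‖ₑ ^ 2)
        (hF.enorm.pow_const 2)
    refine lintegral_congr_ae ?_
    filter_upwards [ae_lt_top hm1 h1.ne, ae_lt_top hm2 h2.ne] with q hq1 hq2
    have := lintegral_enorm_sq_integral_modulation (g := F q)
      ⟨(hFq q).aestronglyMeasurable, hq1⟩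
      (memLp_two_of_lintegral_lt_top (hFq q).aestronglyMeasurable hq2)
    rw [← this]
    exact (Measure.measurePreserving_neg (volume : Measure ℝ)).lintegral_comp_emb
      (MeasurableEquiv.neg ℝ).measurableEmbedding
      (fun b => ‖∫ x, modulationFun b x * F q x‖ₑ ^ 2)
  have hsw : ∫⁻ q, ∫⁻ lam, ‖G q lam‖ₑ ^ 2 = ∫⁻ lam, ∫⁻ q, ‖G q lam‖ₑ ^ 2 :=
    lintegral_lintegral_swap (hGm.enorm.pow_const 2).aemeasurable
  have hm3 : Measurable (fun lam => ∫⁻ q, ‖G q lam‖ₑ ^ 2) :=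
    Measurable.lintegral_prod_left' (f := fun z : ℝ × ℝ => ‖G z.1 z.2‖ₑ ^ 2)
      (hGm.enorm.pow_const 2)
  have hfin : ∫⁻ lam, ∫⁻ q, ‖G q lam‖ₑ ^ 2 ≠ ⊤ := (hsw.symm.trans e1).trans_lt h2 |>.ne
  -- one-dimensional Plancherel in the variable `q`
  have key : ∀ lam, ∫⁻ q, ‖G q lam‖ₑ ^ 2 < ⊤ →
      ∫⁻ s, ‖∫ q, modulationFun s q * G q lam‖ₑ ^ 2 = ∫⁻ q, ‖G q lam‖ₑ ^ 2 := by
    intro lam hlam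
    have hgm : Measurable (fun q => G q lam) :=
      Measurable.comp (g := fun z : ℝ × ℝ => G z.1 z.2) (f := fun q => (q, lam)) hGm
        (measurable_id.prodMk measurable_const)
    refine lintegral_enorm_sq_integral_modulation (g := fun q => G q lam)
      ⟨hgm.aestronglyMeasurable, ?_⟩
      (memLp_two_of_lintegral_lt_top hgm.aestronglyMeasurable hlam)
    refine lt_of_le_of_lt (lintegral_mono fun q => ?_) h1
    refine (enorm_integral_le_lintegral_enorm _).trans (le_of_eq ?_)
    refine lintegral_congr fun t => ?_
    rw [enorm_mul, ← ofReal_norm (modulationFun _ _), norm_modulationFun, ENNReal.ofReal_one,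
      one_mul]
  refine Eq.trans ?_ (hsw.symm.trans e1)
  exact lintegral_congr_ae ((ae_lt_top hm3 hfin).mono key)

/-! ### The integral kernel of `ρ_λ(f)` -/

/-- The partial Fourier transform of `f` in the variables `(q, t)`:
`k_λ(p, s) = ∫∫ f(p,q,t) exp(2πi(sq - λt)) dt dq`. The operator `ρ_λ(f)` has the integral kernel
`|λ|⁻¹ k_λ((y - z)/λ, (y + z)/2)`. -/
def partialFourier (f : Heisenberg → ℂ) (lam p s : ℝ) : ℂ :=
  ∫ q, modulationFun s q * ∫ t, modulationFun (-lam) t * f (Heisenberg.mk p q t)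

theorem Heisenberg.measurable_mk_comp {α : Type*} [MeasurableSpace α] {a b c : α → ℝ}
    (ha : Measurable a) (hb : Measurable b) (hc : Measurable c) :
    Measurable (fun z => Heisenberg.mk (a z) (b z) (c z)) :=
  Heisenberg.measurable_mk.comp (ha.prodMk (hb.prodMk hc))

theorem measurable_partialFourier {f : Heisenberg → ℂ} (hf : Measurable f) :
    Measurable (fun z : ℝ × ℝ × ℝ => partialFourier f z.1 z.2.1 z.2.2) := by
  refine StronglyMeasurable.measurable ?_
  refine StronglyMeasurable.integral_prod_right (f := fun (z : ℝ × ℝ × ℝ) (q : ℝ) =>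
    modulationFun z.2.2 q * ∫ t, modulationFun (-z.1) t * f (Heisenberg.mk z.2.1 q t)) ?_
  refine StronglyMeasurable.mul ?_ ?_
  · exact Measurable.stronglyMeasurable (by fun_prop)
  · refine StronglyMeasurable.integral_prod_right (f := fun (w : (ℝ × ℝ × ℝ) × ℝ) (t : ℝ) =>
      modulationFun (-w.1.1) t * f (Heisenberg.mk w.1.2.1 w.2 t)) ?_
    refine Measurable.stronglyMeasurable ?_
    have : Measurable (fun v : ((ℝ × ℝ × ℝ) × ℝ) × ℝ =>
        f (Heisenberg.mk v.1.1.2.1 v.1.2 v.2)) :=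
      hf.comp (Heisenberg.measurable_mk_comp (by fun_prop) (by fun_prop) (by fun_prop))
    exact Measurable.mul (by fun_prop) this

theorem Heisenberg.lintegral_eq {g : Heisenberg → ℝ≥0∞} (hg : Measurable g) :
    ∫⁻ x, g x = ∫⁻ p, ∫⁻ q, ∫⁻ t, g (Heisenberg.mk p q t) := by
  rw [← Heisenberg.measurePreserving_mk.lintegral_comp_emb Heisenberg.measurableEmbedding_mk]
  have hm : Measurable (fun z : ℝ × ℝ × ℝ => g (Heisenberg.mk z.1 z.2.1 z.2.2)) :=
    hg.comp Heisenberg.measurable_mk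
  rw [Measure.volume_eq_prod, lintegral_prod _ hm.aemeasurable]
  refine lintegral_congr fun p => ?_
  rw [Measure.volume_eq_prod, lintegral_prod (fun z : ℝ × ℝ => g (Heisenberg.mk p z.1 z.2))
    (hg.comp (Heisenberg.measurable_mk_comp measurable_const measurable_fst
      measurable_snd)).aemeasurable]

/-- The partial Fourier transform in `(q, t)` preserves the `L²` norm. -/
theorem lintegral_partialFourier {f : Heisenberg → ℂ} (hm : Measurable f) (h1 : Integrable f)
    (h2 : MemLp f 2) :
    ∫⁻ lam, ∫⁻ p, ∫⁻ s, ‖partialFourier f lam p s‖ₑ ^ 2 = ∫⁻ x, ‖f x‖ₑ ^ 2 := by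
  have hk := measurable_partialFourier hm
  have h1' := h1.2
  have h2' := lintegral_enorm_sq_lt_top h2
  rw [hasFiniteIntegral_iff_enorm, Heisenberg.lintegral_eq hm.enorm] at h1'
  rw [Heisenberg.lintegral_eq (hm.enorm.pow_const 2)] at h2' ⊢
  have hmp : Measurable (fun z : ℝ × ℝ × ℝ => f (Heisenberg.mk z.1 z.2.1 z.2.2)) :=
    hm.comp Heisenberg.measurable_mk
  have hmp' : ∀ p, Measurable (fun z : ℝ × ℝ => f (Heisenberg.mk p z.1 z.2)) := fun p =>
    Measurable.comp (g := fun z : ℝ × ℝ × ℝ => f (Heisenberg.mk z.1 z.2.1 z.2.2))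
      (f := fun z : ℝ × ℝ => (p, z)) hmp measurable_prodMk_left
  have hp1 : Measurable (fun p => ∫⁻ q, ∫⁻ t, ‖f (Heisenberg.mk p q t)‖ₑ) := by
    refine Measurable.lintegral_prod_right' (f := fun w : ℝ × ℝ =>
      ∫⁻ t, ‖f (Heisenberg.mk w.1 w.2 t)‖ₑ) ?_
    refine Measurable.lintegral_prod_right' (f := fun v : (ℝ × ℝ) × ℝ =>
      ‖f (Heisenberg.mk v.1.1 v.1.2 v.2)‖ₑ) ?_
    exact (hmp.comp (g := fun z : ℝ × ℝ × ℝ => f (Heisenberg.mk z.1 z.2.1 z.2.2))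
      (f := fun v : (ℝ × ℝ) × ℝ => (v.1.1, v.1.2, v.2)) (by fun_prop)).enorm
  have hp2 : Measurable (fun p => ∫⁻ q, ∫⁻ t, ‖f (Heisenberg.mk p q t)‖ₑ ^ 2) := by
    refine Measurable.lintegral_prod_right' (f := fun w : ℝ × ℝ =>
      ∫⁻ t, ‖f (Heisenberg.mk w.1 w.2 t)‖ₑ ^ 2) ?_
    refine Measurable.lintegral_prod_right' (f := fun v : (ℝ × ℝ) × ℝ =>
      ‖f (Heisenberg.mk v.1.1 v.1.2 v.2)‖ₑ ^ 2) ?_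
    exact (hmp.comp (g := fun z : ℝ × ℝ × ℝ => f (Heisenberg.mk z.1 z.2.1 z.2.2))
      (f := fun v : (ℝ × ℝ) × ℝ => (v.1.1, v.1.2, v.2)) (by fun_prop)).enorm.pow_const 2
  rw [lintegral_lintegral_swap]
  · refine lintegral_congr_ae ?_
    filter_upwards [ae_lt_top hp1 h1'.ne, ae_lt_top hp2 h2'.ne] with p hq1 hq2
    exact lintegral_enorm_sq_fourier_two (F := fun q t => f (Heisenberg.mk p q t)) (hmp' p) hq1 hq2
  · refine (Measurable.lintegral_prod_right' (f := fun w : (ℝ × ℝ) × ℝ =>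
      ‖partialFourier f w.1.1 w.1.2 w.2‖ₑ ^ 2) ?_).aemeasurable
    exact (hk.comp (g := fun z : ℝ × ℝ × ℝ => partialFourier f z.1 z.2.1 z.2.2)
      (f := fun v : (ℝ × ℝ) × ℝ => (v.1.1, v.1.2, v.2)) (by fun_prop)).enorm.pow_const 2

/-- The kernel formula for the matrix coefficients of `ρ_λ(f)`. -/
theorem integral_mul_inner_schrodinger {f : Heisenberg → ℂ} (hm : Measurable f)
    (hf : Integrable f) {lam : ℝ} (hlam : lam ≠ 0) (g h : L2R) :
    ∫ x, f x * inner ℂ h (schrodinger lam x g)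
      = ∫ y, (starRingEnd ℂ) (h y) * ∫ z, ((|lam|⁻¹ : ℝ) : ℂ) *
          partialFourier f lam ((y - z) / lam) ((y + z) / 2) * g z := by
  have hgm := (Lp.stronglyMeasurable g).measurable
  have hhm := (Lp.stronglyMeasurable h).measurable
  have hcm : Measurable (starRingEnd ℂ) := Complex.continuous_conj.measurable
  set Φ : Heisenberg → ℝ → ℂ := fun x y => f x * (schrodingerPhase lam x *
    ((starRingEnd ℂ) (h y) * (modulationFun x.q (y - lam * x.p) * g (y - lam * x.p)))) with hΦ
  have hΦm : Measurable (Function.uncurry Φ) := by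
    simp only [hΦ, Function.uncurry_def]
    unfold schrodingerPhase
    fun_prop
  -- absolute convergence, by the Cauchy-Schwarz inequality in `y`
  have hΦi : Integrable (Function.uncurry Φ) (volume.prod volume) := by
    refine ⟨hΦm.aestronglyMeasurable, ?_⟩
    rw [hasFiniteIntegral_iff_enorm, lintegral_prod _ hΦm.enorm.aemeasurable]
    have hb : ∀ x : Heisenberg, ∫⁻ y, ‖Function.uncurry Φ (x, y)‖ₑ ≤ ‖f x‖ₑ * (‖h‖ₑ * ‖g‖ₑ) := by
      intro x
      have e : ∀ y, ‖Function.uncurry Φ (x, y)‖ₑ = ‖f x‖ₑ * (‖h y‖ₑ * ‖g (y - lam * x.p)‖ₑ) := by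
        intro y
        simp only [hΦ, Function.uncurry_def, enorm_mul, RCLike.enorm_conj]
        rw [← ofReal_norm (modulationFun _ _), norm_modulationFun,
          ← ofReal_norm (schrodingerPhase _ _), norm_schrodingerPhase, ENNReal.ofReal_one, one_mul,
          one_mul]
      simp_rw [e]
      rw [lintegral_const_mul _ (by fun_prop)]
      refine mul_le_mul_right ?_ _
      refine (ENNReal.lintegral_mul_le_Lp_mul_Lq volume Real.HolderConjugate.two_two
        (by fun_prop) (by fun_prop)).trans (le_of_eq ?_)
      have e2 : ∫⁻ y, ‖g (y - lam * x.p)‖ₑ ^ (2 : ℝ) = ∫⁻ y, ‖g y‖ₑ ^ (2 : ℝ) :=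
        lintegral_sub_right_eq_self (fun y => ‖g y‖ₑ ^ (2 : ℝ)) _
      rw [e2]
      have e3 : ∀ u : L2R, (∫⁻ y, ‖u y‖ₑ ^ (2 : ℝ)) ^ (1 / (2 : ℝ)) = ‖u‖ₑ := by
        intro u
        have := lintegral_enorm_sq_eq u
        simp only [← ENNReal.rpow_two] at this
        rw [this, ← ENNReal.rpow_mul]; norm_num
      rw [e3, e3]
    refine lt_of_le_of_lt (lintegral_mono hb) ?_
    rw [lintegral_mul_const _ hm.enorm]
    exact ENNReal.mul_lt_top hf.2 (ENNReal.mul_lt_top enorm_lt_top enorm_lt_top)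
  have s1 : ∫ x, f x * inner ℂ h (schrodinger lam x g) = ∫ x, ∫ y, Φ x y := by
    refine integral_congr_ae (Eventually.of_forall fun x => ?_)
    simp only [hΦ]
    rw [integral_const_mul, integral_const_mul, inner_schrodinger]
  rw [s1, integral_integral_swap hΦi]
  refine integral_congr_ae ?_
  filter_upwards [hΦi.prod_left_ae] with y hy
  have hy' : Integrable (fun z : ℝ × ℝ × ℝ => Φ (Heisenberg.mk z.1 z.2.1 z.2.2) y)
      (volume.prod (volume.prod volume)) :=
    Heisenberg.measurePreserving_mk.integrable_comp_of_integrable hy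
  have s2 : ∫ x, Φ x y = ∫ p, ∫ q, ∫ t, Φ (Heisenberg.mk p q t) y := by
    have e : ∫ x, Φ x y
        = ∫ z, Φ (Heisenberg.mk z.1 z.2.1 z.2.2) y ∂(volume.prod (volume.prod volume)) :=
      (Heisenberg.measurePreserving_mk.integral_comp Heisenberg.measurableEmbedding_mk
        (fun x => Φ x y)).symm
    rw [e, integral_prod _ hy']
    refine integral_congr_ae ?_
    filter_upwards [hy'.prod_right_ae] with p hp
    rw [integral_prod _ hp]
  have s3 : ∀ p, ∫ q, ∫ t, Φ (Heisenberg.mk p q t) y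
      = (starRingEnd ℂ) (h y) * (partialFourier f lam p (y - lam * p / 2) * g (y - lam * p)) := by
    intro p
    have e : ∀ q t, Φ (Heisenberg.mk p q t) y
        = ((starRingEnd ℂ) (h y) * g (y - lam * p)) * (modulationFun (y - lam * p / 2) q *
          (modulationFun (-lam) t * f (Heisenberg.mk p q t))) := by
      intro q t
      simp only [hΦ, Heisenberg.mk_q, Heisenberg.mk_p, schrodingerPhase, Heisenberg.mk_t]
      have e2 : modulationFun (-lam) (t - p * q / 2) * modulationFun q (y - lam * p)
          = modulationFun (y - lam * p / 2) q * modulationFun (-lam) t := by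
        simp only [modulationFun, ← Complex.exp_add]
        congr 1; push_cast; ring
      linear_combination (f (Heisenberg.mk p q t) * (starRingEnd ℂ) (h y) * g (y - lam * p)) * e2
    simp_rw [e, integral_const_mul]
    rw [partialFourier]; ring
  rw [s2]
  simp_rw [s3, integral_const_mul]
  congr 1
  -- substitute `p = (y - z) / λ`
  set Ψ : ℝ → ℂ := fun p => partialFourier f lam p (y - lam * p / 2) * g (y - lam * p) with hΨ
  have e1 : ∀ z, ((|lam|⁻¹ : ℝ) : ℂ) * partialFourier f lam ((y - z) / lam) ((y + z) / 2) * g z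
      = ((|lam|⁻¹ : ℝ) : ℂ) * Ψ (lam⁻¹ * (y - z)) := by
    intro z
    simp only [hΨ]
    have a1 : lam * (lam⁻¹ * (y - z)) = y - z := mul_inv_cancel_left₀ hlam _
    rw [a1, show y - (y - z) / 2 = (y + z) / 2 by ring, sub_sub_cancel, inv_mul_eq_div]
    ring
  simp_rw [e1]
  rw [integral_const_mul, integral_sub_left_eq_self (fun z => Ψ (lam⁻¹ * z)) volume y,
    Measure.integral_comp_mul_left, inv_inv, ← Complex.real_smul, smul_smul,
    inv_mul_cancel₀ (abs_ne_zero.2 hlam), one_smul]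

/-! ### The Hilbert-Schmidt norm of `ρ_λ(f)` -/

theorem HilbertBasis.tsum_enorm_inner_sq' {H : Type*} [NormedAddCommGroup H]
    [InnerProductSpace ℂ H] [CompleteSpace H] {ι : Type*} (b : HilbertBasis ι ℂ H) (x : H) :
    ∑' i, ‖(inner ℂ x (b i) : ℂ)‖ₑ ^ 2 = ‖x‖ₑ ^ 2 := by
  rw [← b.tsum_enorm_inner_sq x]
  refine tsum_congr fun i => ?_
  rw [← inner_conj_symm, RCLike.enorm_conj]

/-- Parseval's identity in both variables of a square integrable kernel. -/
theorem tsum_enorm_sq_kernel {ι κ : Type*} [Countable κ] (b : HilbertBasis ι ℂ L2R)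
    (c : HilbertBasis κ ℂ L2R) {K : ℝ → ℝ → ℂ} (hK : Measurable (Function.uncurry K))
    (hfin : ∫⁻ y, ∫⁻ z, ‖K y z‖ₑ ^ 2 < ⊤) :
    ∑' j, ∑' i, ‖∫ y, (starRingEnd ℂ) (b i y) * ∫ z, K y z * c j z‖ₑ ^ 2
      = ∫⁻ y, ∫⁻ z, ‖K y z‖ₑ ^ 2 := by
  have hKy : ∀ y, Measurable (K y) := fun y => hK.of_uncurry_left
  have hm : Measurable (fun y => ∫⁻ z, ‖K y z‖ₑ ^ 2) :=
    Measurable.lintegral_prod_right' (f := fun w : ℝ × ℝ => ‖K w.1 w.2‖ₑ ^ 2)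
      (hK.enorm.pow_const 2)
  have hGm : ∀ j, Measurable (fun y => ∫ z, K y z * c j z) := by
    intro j
    refine StronglyMeasurable.measurable ?_
    refine StronglyMeasurable.integral_prod_right (f := fun (y z : ℝ) => K y z * c j z)
      (Measurable.stronglyMeasurable ?_)
    exact hK.mul ((Lp.stronglyMeasurable (c j)).measurable.comp measurable_snd)
  -- Parseval in `z`, for fixed `y`
  have hrow : ∀ y, ∫⁻ z, ‖K y z‖ₑ ^ 2 < ⊤ →
      ∑' j, ‖∫ z, K y z * c j z‖ₑ ^ 2 = ∫⁻ z, ‖K y z‖ₑ ^ 2 := by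
    intro y hy
    have hL : MemLp (fun z => (starRingEnd ℂ) (K y z)) 2 := by
      refine memLp_two_of_lintegral_lt_top
        (Complex.continuous_conj.measurable.comp (hKy y)).aestronglyMeasurable ?_
      simpa using hy
    have e1 : ∀ j, ∫ z, K y z * c j z = inner ℂ (hL.toLp _) (c j) := by
      intro j
      rw [inner_L2_eq]
      refine integral_congr_ae ?_
      filter_upwards [hL.coeFn_toLp] with z hz
      rw [hz, Complex.conj_conj]
    simp_rw [e1]
    rw [c.tsum_enorm_inner_sq', ← lintegral_enorm_sq_eq]
    refine lintegral_congr_ae ?_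
    filter_upwards [hL.coeFn_toLp] with z hz
    rw [hz, RCLike.enorm_conj]
  have hrow_ae := (ae_lt_top hm hfin.ne).mono hrow
  have hsum : ∑' j, ∫⁻ y, ‖∫ z, K y z * c j z‖ₑ ^ 2 = ∫⁻ y, ∫⁻ z, ‖K y z‖ₑ ^ 2 := by
    rw [← lintegral_tsum fun j => ((hGm j).enorm.pow_const 2).aemeasurable]
    exact lintegral_congr_ae hrow_ae
  -- Parseval in `y`, for fixed `j`
  rw [← hsum]
  refine tsum_congr fun j => ?_
  have hL : MemLp (fun y => ∫ z, K y z * c j z) 2 := by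
    refine memLp_two_of_lintegral_lt_top (hGm j).aestronglyMeasurable ?_
    refine lt_of_le_of_lt ?_ hfin
    rw [← hsum]
    exact ENNReal.le_tsum j
  have e1 : ∀ i, ∫ y, (starRingEnd ℂ) (b i y) * ∫ z, K y z * c j z
      = inner ℂ (b i) (hL.toLp _) := by
    intro i
    rw [inner_L2_eq]
    refine integral_congr_ae ?_
    filter_upwards [hL.coeFn_toLp] with z hz
    rw [hz]
  simp_rw [e1]
  rw [b.tsum_enorm_inner_sq, ← lintegral_enorm_sq_eq]
  refine lintegral_congr_ae ?_
  filter_upwards [hL.coeFn_toLp] with z hz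
  rw [hz]

theorem lintegral_comp_mul_left {f : ℝ → ℝ≥0∞} (hf : Measurable f) {a : ℝ} (ha : a ≠ 0) :
    ENNReal.ofReal |a| * ∫⁻ x, f (a * x) = ∫⁻ x, f x := by
  conv_rhs => rw [← Real.smul_map_volume_mul_left ha]
  rw [lintegral_smul_measure, lintegral_map hf (measurable_const_mul a), smul_eq_mul]

/-- The substitution `p = (y - z) / λ`, `s = (y + z) / 2` has Jacobian `1 / |λ|`. -/
theorem lintegral_kernel_change {k : ℝ → ℝ → ℂ} (hk : Measurable (Function.uncurry k))
    {lam : ℝ} (hlam : lam ≠ 0) :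
    ∫⁻ y, ∫⁻ z, ‖k ((y - z) / lam) ((y + z) / 2)‖ₑ ^ 2
      = ENNReal.ofReal |lam| * ∫⁻ p, ∫⁻ s, ‖k p s‖ₑ ^ 2 := by
  have hm : Measurable (fun w : ℝ × ℝ => ‖k w.1 w.2‖ₑ ^ 2) := hk.enorm.pow_const 2
  have h1 : ∀ y, ∫⁻ z, ‖k ((y - z) / lam) ((y + z) / 2)‖ₑ ^ 2
      = ENNReal.ofReal |lam| * ∫⁻ p, ‖k p (y - lam * p / 2)‖ₑ ^ 2 := by
    intro y
    have hm1 : Measurable (fun z => ‖k ((y - (y - z)) / lam) ((y + (y - z)) / 2)‖ₑ ^ 2) :=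
      Measurable.comp (g := fun w : ℝ × ℝ => ‖k w.1 w.2‖ₑ ^ 2)
        (f := fun z => ((y - (y - z)) / lam, (y + (y - z)) / 2)) hm (by fun_prop)
    rw [← lintegral_sub_left_eq_self (μ := (volume : Measure ℝ))
      (fun z => ‖k ((y - z) / lam) ((y + z) / 2)‖ₑ ^ 2) y, ← lintegral_comp_mul_left hm1 hlam]
    congr 1
    refine lintegral_congr fun p => ?_
    congr 3
    · rw [sub_sub_cancel, mul_div_cancel_left₀ _ hlam]
    · ring
  simp_rw [h1]
  have hm2 : Measurable (fun w : ℝ × ℝ => ‖k w.2 (w.1 - lam * w.2 / 2)‖ₑ ^ 2) :=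
    Measurable.comp (g := fun w : ℝ × ℝ => ‖k w.1 w.2‖ₑ ^ 2)
      (f := fun w : ℝ × ℝ => (w.2, w.1 - lam * w.2 / 2)) hm (by fun_prop)
  rw [lintegral_const_mul _ (Measurable.lintegral_prod_right'
    (f := fun w : ℝ × ℝ => ‖k w.2 (w.1 - lam * w.2 / 2)‖ₑ ^ 2) hm2)]
  rw [lintegral_lintegral_swap hm2.aemeasurable]
  congr 1
  refine lintegral_congr fun p => ?_
  exact lintegral_sub_right_eq_self (μ := (volume : Measure ℝ)) (fun s => ‖k p s‖ₑ ^ 2)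
    (lam * p / 2)

/-- The operator `ρ_λ(f)` has an integral kernel obtained from the partial Fourier transform of `f`
in `(q, t)`, and its squared Hilbert-Schmidt norm, the `L²` norm of the kernel, is computed by a
linear substitution. -/
theorem tsum_enorm_sq_groupFourier {ι κ : Type*} [Countable κ] (b : HilbertBasis ι ℂ L2R)
    (c : HilbertBasis κ ℂ L2R) {f : Heisenberg → ℂ} (hm : Measurable f) (hf : Integrable f)
    {lam : ℝ} (hlam : lam ≠ 0)
    (hfin : ∫⁻ p, ∫⁻ s, ‖partialFourier f lam p s‖ₑ ^ 2 < ⊤) :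
    ‖lam‖ₑ * ∑' j, ∑' i, ‖∫ x, f x * inner ℂ (b i) (schrodinger lam x (c j))‖ₑ ^ 2
      = ∫⁻ p, ∫⁻ s, ‖partialFourier f lam p s‖ₑ ^ 2 := by
  have hk : Measurable (Function.uncurry (partialFourier f lam)) :=
    Measurable.comp (g := fun z : ℝ × ℝ × ℝ => partialFourier f z.1 z.2.1 z.2.2)
      (f := fun w : ℝ × ℝ => (lam, w)) (measurable_partialFourier hm) measurable_prodMk_left
  set K : ℝ → ℝ → ℂ := fun y z =>
    ((|lam|⁻¹ : ℝ) : ℂ) * partialFourier f lam ((y - z) / lam) ((y + z) / 2) with hKdef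
  have hK : Measurable (Function.uncurry K) := by
    refine Measurable.const_mul ?_ _
    exact Measurable.comp (g := Function.uncurry (partialFourier f lam))
      (f := fun w : ℝ × ℝ => ((w.1 - w.2) / lam, (w.1 + w.2) / 2)) hk (by fun_prop)
  have hl0 : ‖lam‖ₑ ≠ 0 := by simpa using hlam
  have hlt : ‖lam‖ₑ ≠ ⊤ := enorm_ne_top
  have hl : ENNReal.ofReal |lam| = ‖lam‖ₑ := by rw [← Real.norm_eq_abs, ofReal_norm]
  have hKn : ∫⁻ y, ∫⁻ z, ‖K y z‖ₑ ^ 2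
      = ‖lam‖ₑ⁻¹ * ∫⁻ p, ∫⁻ s, ‖partialFourier f lam p s‖ₑ ^ 2 := by
    have e : ∀ y z, ‖K y z‖ₑ ^ 2
        = (‖lam‖ₑ⁻¹) ^ 2 * ‖partialFourier f lam ((y - z) / lam) ((y + z) / 2)‖ₑ ^ 2 := by
      intro y z
      rw [hKdef]
      simp only [enorm_mul, mul_pow]
      congr 2
      rw [← ofReal_norm, Complex.norm_real, norm_inv, Real.norm_eq_abs, abs_abs,
        ENNReal.ofReal_inv_of_pos (abs_pos.2 hlam), hl]
    simp_rw [e]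
    simp_rw [lintegral_const_mul' _ _ (ENNReal.pow_ne_top (ENNReal.inv_ne_top.2 hl0))]
    rw [lintegral_kernel_change hk hlam, ← mul_assoc, hl]
    congr 1
    rw [sq, mul_assoc, ENNReal.inv_mul_cancel hl0 hlt, mul_one]
  have hKfin : ∫⁻ y, ∫⁻ z, ‖K y z‖ₑ ^ 2 < ⊤ := by
    rw [hKn]
    exact ENNReal.mul_lt_top (ENNReal.inv_lt_top.2 (pos_iff_ne_zero.2 hl0)) hfin
  have h1 := tsum_enorm_sq_kernel b c hK hKfin
  simp_rw [integral_mul_inner_schrodinger hm hf hlam]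
  rw [h1, hKn, ← mul_assoc, ENNReal.mul_inv_cancel hl0 hlt, one_mul]

/-! ### Fourier-Wigner transforms of Hermite functions -/

/-- The Fourier-Wigner transform `W_{mn}(a,b) = ∫ h_m(u + a/2) h_n(u - a/2) exp(2πibu) du`
of two Hermite functions. -/
def wignerFun (m n : ℕ) (a b : ℝ) : ℂ :=
  ∫ u, ((hermiteFun m (u + a / 2) * hermiteFun n (u - a / 2) : ℝ) : ℂ) * modulationFun b u

/-- The matrix coefficient `⟨h_{m,λ}, ρ_λ(x) h_{n,λ}⟩` (for `λ ≠ 0`). -/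
def matCoeff (m n : ℕ) (lam : ℝ) (x : Heisenberg) : ℂ :=
  modulationFun (-lam) x.t * wignerFun m n (lam / √|lam| * x.p) (√|lam| * x.q)

theorem measurable_wignerFun (m n : ℕ) :
    Measurable (fun z : ℝ × ℝ => wignerFun m n z.1 z.2) := by
  refine StronglyMeasurable.measurable ?_
  refine StronglyMeasurable.integral_prod_right (f := fun (z : ℝ × ℝ) (u : ℝ) =>
    ((hermiteFun m (u + z.1 / 2) * hermiteFun n (u - z.1 / 2) : ℝ) : ℂ) * modulationFun z.2 u)
    (Measurable.stronglyMeasurable ?_)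
  have h1 := fun n => (continuous_hermiteFun n).measurable
  have := h1 m
  have := h1 n
  simp only [Function.uncurry_def]
  fun_prop

theorem measurable_matCoeff (m n : ℕ) :
    Measurable (fun z : ℝ × Heisenberg => matCoeff m n z.1 z.2) := by
  unfold matCoeff
  refine Measurable.mul (by fun_prop) ?_
  exact Measurable.comp (g := fun z : ℝ × ℝ => wignerFun m n z.1 z.2)
    (f := fun z : ℝ × Heisenberg => (z.1 / √|z.1| * z.2.p, √|z.1| * z.2.q))
    (measurable_wignerFun m n) (by fun_prop)

theorem inner_schrodinger_dilatedHermite {lam : ℝ} (hlam : lam ≠ 0) (m n : ℕ) (x : Heisenberg) :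
    inner ℂ (dilatedHermite m lam) (schrodinger lam x (dilatedHermite n lam))
      = matCoeff m n lam x := by
  have hr : 0 < √|lam| := Real.sqrt_pos.2 (abs_pos.2 hlam)
  rw [inner_schrodinger]
  set Θ : ℝ → ℂ := fun y => ((dilatedHermiteFun m lam y *
    dilatedHermiteFun n lam (y - lam * x.p) : ℝ) : ℂ) * modulationFun x.q (y - lam * x.p) with hΘ
  have s1 : ∫ y, (starRingEnd ℂ) (dilatedHermite m lam y) *
      (modulationFun x.q (y - lam * x.p) * dilatedHermite n lam (y - lam * x.p))
      = ∫ y, Θ y := by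
    refine integral_congr_ae ?_
    filter_upwards [coeFn_dilatedHermite m lam,
      (measurePreserving_sub_right volume (lam * x.p)).quasiMeasurePreserving.ae
        (coeFn_dilatedHermite n lam)] with y h1 h2
    rw [h1, h2, Complex.conj_ofReal]
    simp only [hΘ]; push_cast; ring
  -- substitute `y = √|λ| u + λp / 2`, which makes the two Hermite functions symmetric
  have s2 : ∫ y, Θ y = ((√|lam| : ℝ) : ℂ) * ∫ u, Θ (√|lam| * u + lam * x.p / 2) := by
    rw [Measure.integral_comp_mul_left (fun y => Θ (y + lam * x.p / 2)),
      integral_add_right_eq_self Θ, abs_of_pos (inv_pos.2 hr), Complex.real_smul, ← mul_assoc,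
      ← Complex.ofReal_mul, mul_inv_cancel₀ hr.ne', Complex.ofReal_one, one_mul]
  have hsq : lam / √|lam| = (√|lam|)⁻¹ * lam := by rw [inv_mul_eq_div]
  have s3 : ∀ u, Θ (√|lam| * u + lam * x.p / 2)
      = (((√|lam|)⁻¹ : ℝ) : ℂ) * modulationFun x.q (-(lam * x.p / 2)) *
        (((hermiteFun m (u + lam / √|lam| * x.p / 2) * hermiteFun n (u - lam / √|lam| * x.p / 2) :
          ℝ) : ℂ) * modulationFun (√|lam| * x.q) u) := by
    intro u
    simp only [hΘ, dilatedHermiteFun_eq]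
    have e1 : (√|lam|)⁻¹ * (√|lam| * u + lam * x.p / 2) = u + lam / √|lam| * x.p / 2 := by
      field_simp
    have e2 : (√|lam|)⁻¹ * (√|lam| * u + lam * x.p / 2 - lam * x.p)
        = u - lam / √|lam| * x.p / 2 := by
      field_simp; ring
    have e3 : modulationFun x.q (√|lam| * u + lam * x.p / 2 - lam * x.p)
        = modulationFun x.q (-(lam * x.p / 2)) * modulationFun (√|lam| * x.q) u := by
      simp only [modulationFun, ← Complex.exp_add]
      congr 1; push_cast; ring
    rw [e1, e2, e3, ← dilation_sq]
    push_cast; ring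
  rw [s1, s2]
  simp_rw [s3]
  rw [integral_const_mul, matCoeff, wignerFun]
  have e4 : schrodingerPhase lam x * modulationFun x.q (-(lam * x.p / 2))
      = modulationFun (-lam) x.t := by
    simp only [schrodingerPhase, modulationFun, ← Complex.exp_add]
    congr 1; push_cast; ring
  rw [← e4]
  have e5 : ((√|lam| : ℝ) : ℂ) * (((√|lam|)⁻¹ : ℝ) : ℂ) = 1 := by
    rw [← Complex.ofReal_mul, mul_inv_cancel₀ hr.ne', Complex.ofReal_one]
  linear_combination (schrodingerPhase lam x * modulationFun x.q (-(lam * x.p / 2)) *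
    ∫ u, ((hermiteFun m (u + lam / √|lam| * x.p / 2) * hermiteFun n (u - lam / √|lam| * x.p / 2) :
          ℝ) : ℂ) * modulationFun (√|lam| * x.q) u) * e5

theorem norm_dilatedHermite {lam : ℝ} (hlam : lam ≠ 0) (n : ℕ) : ‖dilatedHermite n lam‖ = 1 :=
  (orthonormal_dilatedHermite hlam).1 n

theorem norm_wignerFun_le (m n : ℕ) (a b : ℝ) : ‖wignerFun m n a b‖ ≤ 1 := by
  have h1 := inner_schrodinger_dilatedHermite one_ne_zero m n (Heisenberg.mk a b 0)
  have h2 := norm_inner_schrodinger_le 1 (Heisenberg.mk a b 0) (dilatedHermite n 1)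
    (dilatedHermite m 1)
  rw [h1, norm_dilatedHermite one_ne_zero, norm_dilatedHermite one_ne_zero, matCoeff, norm_mul,
    norm_modulationFun] at h2
  simpa using h2

theorem norm_matCoeff_le (m n : ℕ) (lam : ℝ) (x : Heisenberg) : ‖matCoeff m n lam x‖ ≤ 1 := by
  rw [matCoeff, norm_mul, norm_modulationFun, one_mul]
  exact norm_wignerFun_le _ _ _ _

/-! ### Multiplication operators on `L²` -/

section Multiplication

variable {α : Type*} [MeasurableSpace α] {μ : Measure α}

theorem tendsto_L2_of_lintegral {ι : Type*} {l : Filter ι} {f : ι → Lp ℂ 2 μ} {g : Lp ℂ 2 μ}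
    (h : Tendsto (fun i => ∫⁻ x, ‖f i x - g x‖ₑ ^ 2 ∂μ) l (𝓝 0)) : Tendsto f l (𝓝 g) := by
  have h1 : ∀ i, ∫⁻ x, ‖f i x - g x‖ₑ ^ 2 ∂μ = ‖f i - g‖ₑ ^ 2 := by
    intro i
    rw [← lintegral_enorm_sq_eq]
    refine lintegral_congr_ae ?_
    filter_upwards [Lp.coeFn_sub (f i) g] with x hx
    rw [hx, Pi.sub_apply]
  simp_rw [h1] at h
  have h2 := (ENNReal.continuous_rpow_const (y := 1 / 2)).tendsto 0 |>.comp h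
  have h3 : ∀ x : ℝ≥0∞, (x ^ 2) ^ (1 / 2 : ℝ) = x := fun x => by
    rw [← ENNReal.rpow_natCast, ← ENNReal.rpow_mul]; norm_num
  simp only [Function.comp_def, h3] at h2
  rw [tendsto_iff_edist_tendsto_0]
  simpa [edist_eq_enorm_sub] using h2

/-- Multiplication by the indicator function of a measurable set, on `L²`. -/
def indicatorL2 {s : Set α} (hs : MeasurableSet s) : Lp ℂ 2 μ →L[ℂ] Lp ℂ 2 μ :=
  LinearMap.mkContinuous
    { toFun := fun g => ((Lp.memLp g).indicator hs).toLp _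
      map_add' := fun g g' => by
        rw [← MemLp.toLp_add, MemLp.toLp_eq_toLp_iff]
        filter_upwards [Lp.coeFn_add g g'] with x hx
        have hx' : (g + g' : Lp ℂ 2 μ) x = g x + g' x := hx
        by_cases h : x ∈ s
        · simp only [Set.indicator_of_mem h, Pi.add_apply, hx']
        · simp [h]
      map_smul' := fun c g => by
        rw [RingHom.id_apply, ← MemLp.toLp_const_smul, MemLp.toLp_eq_toLp_iff]
        filter_upwards [Lp.coeFn_smul c g] with x hx
        have hx' : (c • g : Lp ℂ 2 μ) x = c • g x := hx
        by_cases h : x ∈ s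
        · simp only [Set.indicator_of_mem h, Pi.smul_apply, hx']
        · simp [h] }
    1 (fun g => by
      rw [one_mul]
      refine Lp.norm_le_norm_of_ae_le ?_
      filter_upwards [((Lp.memLp g).indicator hs).coeFn_toLp] with x hx
      simp only [LinearMap.coe_mk, AddHom.coe_mk, hx]
      exact norm_indicator_le_norm_self _ _)

theorem coeFn_indicatorL2 {s : Set α} (hs : MeasurableSet s) (g : Lp ℂ 2 μ) :
    indicatorL2 hs g =ᵐ[μ] s.indicator g :=
  ((Lp.memLp g).indicator hs).coeFn_toLp

theorem indicatorL2_mul {s t : Set α} (hs : MeasurableSet s) (ht : MeasurableSet t) :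
    (indicatorL2 (hs.inter ht) : Lp ℂ 2 μ →L[ℂ] Lp ℂ 2 μ) = indicatorL2 hs * indicatorL2 ht := by
  ext1 g
  rw [mul_apply_eq_comp]
  refine Lp.ext ?_
  filter_upwards [coeFn_indicatorL2 (hs.inter ht) g, coeFn_indicatorL2 hs (indicatorL2 ht g),
    coeFn_indicatorL2 ht g] with x h1 h2 h3
  rw [h1, h2, ← Set.indicator_indicator]
  by_cases h : x ∈ s <;> simp [h, h3]

theorem isStarProjection_indicatorL2 {s : Set α} (hs : MeasurableSet s) :
    IsStarProjection (indicatorL2 hs : Lp ℂ 2 μ →L[ℂ] Lp ℂ 2 μ) := by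
  refine ⟨?_, ?_⟩
  · have := indicatorL2_mul (μ := μ) hs hs
    rw [IsIdempotentElem, ← this]
    congr 1
    exact Set.inter_self s
  · rw [ContinuousLinearMap.isSelfAdjoint_iff_isSymmetric]
    intro f g
    simp only [ContinuousLinearMap.coe_coe]
    rw [inner_L2_eq, inner_L2_eq]
    refine integral_congr_ae ?_
    filter_upwards [coeFn_indicatorL2 hs f, coeFn_indicatorL2 hs g] with x h1 h2
    rw [h1, h2]
    by_cases h : x ∈ s <;> simp [h]

theorem tendsto_indicatorL2 {ι : Type*} {l : Filter ι} [l.IsCountablyGenerated] {s : ι → Set α}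
    {t : Set α} (hs : ∀ i, MeasurableSet (s i)) (ht : MeasurableSet t)
    (h : ∀ x, ∀ᶠ i in l, (x ∈ s i ↔ x ∈ t)) (g : Lp ℂ 2 μ) :
    Tendsto (fun i => indicatorL2 (hs i) g) l (𝓝 (indicatorL2 ht g)) := by
  refine tendsto_L2_of_lintegral ?_
  have hgm := (Lp.stronglyMeasurable g).measurable
  have e : ∀ i, ∫⁻ x, ‖indicatorL2 (hs i) g x - indicatorL2 ht g x‖ₑ ^ 2 ∂μ
      = ∫⁻ x, ‖(s i).indicator g x - t.indicator g x‖ₑ ^ 2 ∂μ := fun i => by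
    refine lintegral_congr_ae ?_
    filter_upwards [coeFn_indicatorL2 (hs i) g, coeFn_indicatorL2 ht g] with x h1 h2
    rw [h1, h2]
  simp_rw [e]
  rw [← lintegral_zero (μ := μ)]
  refine tendsto_lintegral_filter_of_dominated_convergence (fun x => ‖g x‖ₑ ^ 2) ?_ ?_ ?_ ?_
  · exact Eventually.of_forall fun i =>
      ((hgm.indicator (hs i)).sub (hgm.indicator ht)).enorm.pow_const 2
  · refine Eventually.of_forall fun i => Eventually.of_forall fun x => ?_
    by_cases h1 : x ∈ s i <;> by_cases h2 : x ∈ t <;> simp [h1, h2]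
  · exact (lintegral_enorm_sq_lt_top (Lp.memLp g)).ne
  · refine Eventually.of_forall fun x => ?_
    refine Tendsto.congr' ?_ tendsto_const_nhds
    filter_upwards [h x] with i hi
    by_cases h1 : x ∈ s i
    · simp [h1, hi.1 h1]
    · simp [h1, mt hi.2 h1]

theorem indicatorL2_univ : (indicatorL2 MeasurableSet.univ : Lp ℂ 2 μ →L[ℂ] Lp ℂ 2 μ) = 1 := by
  ext1 g
  refine Lp.ext ?_
  filter_upwards [coeFn_indicatorL2 MeasurableSet.univ g] with x h1
  rw [h1, Set.indicator_univ]; rfl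

theorem indicatorL2_empty : (indicatorL2 MeasurableSet.empty : Lp ℂ 2 μ →L[ℂ] Lp ℂ 2 μ) = 0 := by
  ext1 g
  refine Lp.ext ?_
  filter_upwards [coeFn_indicatorL2 MeasurableSet.empty g, Lp.coeFn_zero ℂ 2 μ] with x h1 h2
  rw [h1, Set.indicator_empty, zero_apply, h2]; rfl

theorem hasSum_indicatorL2 {s : ℕ → Set α} (hs : ∀ n, MeasurableSet (s n))
    (hd : Pairwise (Function.onFun Disjoint s)) (g : Lp ℂ 2 μ) :
    HasSum (fun n => indicatorL2 (hs n) g) (indicatorL2 (MeasurableSet.iUnion hs) g) := by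
  have hF : ∀ F : Finset ℕ, MeasurableSet (⋃ i ∈ F, s i) := fun F =>
    F.measurableSet_biUnion fun i _ => hs i
  have e : ∀ F : Finset ℕ, ∑ n ∈ F, indicatorL2 (hs n) g = indicatorL2 (hF F) g := by
    intro F
    refine Lp.ext ?_
    have h1 : ∀ᵐ x ∂μ, ∀ n, indicatorL2 (hs n) g x = (s n).indicator g x :=
      ae_all_iff.2 fun n => coeFn_indicatorL2 (hs n) g
    filter_upwards [coeFn_indicatorL2 (hF F) g, h1,
      Lp.coeFn_finsetSum F (fun n => indicatorL2 (hs n) g)] with x h2 h3 h4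
    rw [h2, h4, Finset.sum_apply, Finset.sum_congr rfl fun n _ => h3 n, eq_comm]
    rw [Finset.indicator_biUnion]
    exact fun i _ j _ hij => hd hij
  rw [HasSum]
  simp_rw [e]
  refine tendsto_indicatorL2 _ _ (fun x => ?_) g
  by_cases hx : ∃ n, x ∈ s n
  · obtain ⟨n, hn⟩ := hx
    filter_upwards [eventually_ge_atTop {n}] with F hFn
    refine ⟨fun h => Set.mem_iUnion.2 ⟨n, hn⟩, fun h => ?_⟩
    exact Set.mem_biUnion (Finset.singleton_subset_iff.1 hFn) hn
  · refine Eventually.of_forall fun F => ⟨fun h => ?_, fun h => ?_⟩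
    · obtain ⟨n, -, hn⟩ := Set.mem_iUnion₂.1 h
      exact absurd ⟨n, hn⟩ hx
    · exact absurd (Set.mem_iUnion.1 h) hx

theorem norm_indicatorL2_sq {s : Set α} (hs : MeasurableSet s) (g : Lp ℂ 2 μ) :
    ENNReal.ofReal (‖indicatorL2 hs g‖ ^ 2) = ∫⁻ x in s, ‖g x‖ₑ ^ 2 ∂μ := by
  rw [ENNReal.ofReal_pow (norm_nonneg _), ofReal_norm, ← lintegral_enorm_sq_eq,
    ← lintegral_indicator hs]
  refine lintegral_congr_ae ?_
  filter_upwards [coeFn_indicatorL2 hs g] with x h1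
  rw [h1]
  by_cases h : x ∈ s <;> simp [h]

/-! ### The spectral measure of a multiplication operator -/

open Classical in
/-- The projection-valued measure `B ↦ U⁻¹ 1_{a ∈ B} U` of the operator unitarily equivalent, by
`U`, to the multiplication by the real function `a`. -/
def multiplicationPVM {H : Type*} [NormedAddCommGroup H] [InnerProductSpace ℂ H] [CompleteSpace H]
    (U : H ≃ₗᵢ[ℂ] Lp ℂ 2 μ) {a : α → ℝ} (ha : Measurable a) : ProjectionValuedMeasure H where
  proj B := if hB : MeasurableSet B then
    (U.symm : Lp ℂ 2 μ →L[ℂ] H) ∘L (indicatorL2 (ha hB)) ∘L (U : H →L[ℂ] Lp ℂ 2 μ) else 0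
  isStarProjection B hB := by
    have h := isStarProjection_indicatorL2 (μ := μ) (ha hB)
    rw [dif_pos hB]
    refine ⟨?_, ?_⟩
    · ext1 u
      have := congrArg (fun T : Lp ℂ 2 μ →L[ℂ] Lp ℂ 2 μ => T (U u)) h.isIdempotentElem.eq
      simp only [mul_apply_eq_comp] at this
      simp [this]
    · rw [ContinuousLinearMap.isSelfAdjoint_iff_isSymmetric]
      intro u v
      have := ContinuousLinearMap.isSelfAdjoint_iff_isSymmetric.1 h.isSelfAdjoint (U u) (U v)
      simp only [ContinuousLinearMap.coe_coe] at this
      simp only [ContinuousLinearMap.coe_coe, ContinuousLinearMap.comp_apply,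
        LinearIsometryEquiv.coe_coe'']
      rw [← U.inner_map_map, U.apply_symm_apply, this, ← U.inner_map_map u, U.apply_symm_apply]
  empty := by
    rw [dif_pos MeasurableSet.empty]
    have := indicatorL2_empty (μ := μ)
    ext1 u
    simp only [ContinuousLinearMap.comp_apply, Set.preimage_empty, this]
    simp
  univ := by
    rw [dif_pos MeasurableSet.univ]
    have := indicatorL2_univ (μ := μ)
    ext1 u
    simp only [ContinuousLinearMap.comp_apply, Set.preimage_univ, this]
    simp
  inter B C hB hC := by
    rw [dif_pos hB, dif_pos hC, dif_pos (hB.inter hC)]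
    have := indicatorL2_mul (μ := μ) (ha hB) (ha hC)
    ext1 u
    simp only [ContinuousLinearMap.comp_apply, Set.preimage_inter, this, mul_apply_eq_comp]
    simp
  iUnion B hB hd u := by
    have h := hasSum_indicatorL2 (μ := μ) (s := fun n => a ⁻¹' B n) (fun n => ha (hB n))
      (fun i j hij => (hd hij).preimage a) (U u)
    have h2 := h.mapL (U.symm : Lp ℂ 2 μ →L[ℂ] H)
    simp only [dif_pos (hB _), dif_pos (MeasurableSet.iUnion hB)]
    convert! h2 using 1
    simp only [ContinuousLinearMap.comp_apply, Set.preimage_iUnion]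
    rfl

variable {H : Type*} [NormedAddCommGroup H] [InnerProductSpace ℂ H]

/-- `A` is unitarily equivalent, by `U`, to the multiplication by `a` on its maximal domain. -/
def IsMultiplication (U : H ≃ₗᵢ[ℂ] Lp ℂ 2 μ) (a : α → ℝ) (A : H →ₗ.[ℂ] H) : Prop :=
  ∀ u v : H, (u, v) ∈ A.graph ↔ U v =ᵐ[μ] fun x => (a x : ℂ) * U u x

theorem IsMultiplication.mem_domain_iff {U : H ≃ₗᵢ[ℂ] Lp ℂ 2 μ} {a : α → ℝ} (ha : Measurable a)
    {A : H →ₗ.[ℂ] H} (hA : IsMultiplication U a A) (u : H) :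
    u ∈ A.domain ↔ ∫⁻ x, ‖(a x : ℂ) * U u x‖ₑ ^ 2 ∂μ < ⊤ := by
  have hm : AEStronglyMeasurable (fun x => (a x : ℂ) * U u x) μ :=
    (Complex.measurable_ofReal.comp ha).aestronglyMeasurable.mul (Lp.aestronglyMeasurable _)
  constructor
  · intro hu
    have h1 := (hA u (A ⟨u, hu⟩)).1 (A.mem_graph ⟨u, hu⟩)
    rw [← lintegral_congr_ae (f := fun x => ‖U (A ⟨u, hu⟩) x‖ₑ ^ 2)
      (by filter_upwards [h1] with x hx; rw [hx])]
    exact lintegral_enorm_sq_lt_top (Lp.memLp _)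
  · intro h
    have h1 := memLp_two_of_lintegral_lt_top hm h
    have h2 := (hA u (U.symm (h1.toLp _))).2 (by
      rw [U.apply_symm_apply]; exact h1.coeFn_toLp)
    exact LinearPMap.mem_domain_of_mem_graph h2

theorem IsMultiplication.apply_ae {U : H ≃ₗᵢ[ℂ] Lp ℂ 2 μ} {a : α → ℝ}
    {A : H →ₗ.[ℂ] H} (hA : IsMultiplication U a A) (u : A.domain) :
    U (A u) =ᵐ[μ] fun x => (a x : ℂ) * U u x :=
  (hA u (A u)).1 (A.mem_graph u)

variable [CompleteSpace H]

theorem map_multiplicationPVM (U : H ≃ₗᵢ[ℂ] Lp ℂ 2 μ) {a : α → ℝ} (ha : Measurable a)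
    {B : Set ℝ} (hB : MeasurableSet B) (u : H) :
    U ((multiplicationPVM U ha).proj B u) = indicatorL2 (ha hB) (U u) := by
  simp [multiplicationPVM, hB]

theorem ProjectionValuedMeasure.scalarMeasure_apply (E : ProjectionValuedMeasure H) (u : H)
    {B : Set ℝ} (hB : MeasurableSet B) :
    E.scalarMeasure u B = ENNReal.ofReal (‖E.proj B u‖ ^ 2) :=
  Measure.ofMeasurable_apply B hB

/-- The scalar spectral measure of a multiplication operator at `u` is the image under `a` of
`|Uu|² μ`. -/
theorem scalarMeasure_multiplicationPVM (U : H ≃ₗᵢ[ℂ] Lp ℂ 2 μ) {a : α → ℝ} (ha : Measurable a)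
    (u : H) : (multiplicationPVM U ha).scalarMeasure u
      = (μ.withDensity fun x => ‖U u x‖ₑ ^ 2).map a := by
  ext B hB
  rw [ProjectionValuedMeasure.scalarMeasure_apply _ _ hB, Measure.map_apply ha hB,
    withDensity_apply _ (ha hB), ← norm_indicatorL2_sq (ha hB), ← map_multiplicationPVM U ha hB,
    U.norm_map]

/-- The indicators of the preimages under `a` form a spectral measure of the multiplication by
`a`. -/
theorem IsMultiplication.isSpectralMeasure {U : H ≃ₗᵢ[ℂ] Lp ℂ 2 μ} {a : α → ℝ}
    (ha : Measurable a) {A : H →ₗ.[ℂ] H} (hA : IsMultiplication U a A) :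
    IsSpectralMeasure A (multiplicationPVM U ha) := by
  have hwm : ∀ u : H, AEMeasurable (fun x => ‖U u x‖ₑ ^ 2) μ := fun u =>
    (Lp.aestronglyMeasurable _).enorm.pow_const 2
  refine ⟨fun u => ?_, fun u => ?_⟩
  · rw [hA.mem_domain_iff ha, scalarMeasure_multiplicationPVM,
      lintegral_map (by fun_prop) ha, lintegral_withDensity_eq_lintegral_mul₀ (hwm u) (by fun_prop)]
    refine iff_of_eq (congrArg (· < ⊤) (lintegral_congr fun x => ?_))
    rw [Pi.mul_apply, enorm_mul, mul_pow, mul_comm]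
    congr 1
    rw [← ofReal_norm, Complex.norm_real, Real.norm_eq_abs, ← ENNReal.ofReal_pow (abs_nonneg _),
      sq_abs]
  · rw [scalarMeasure_multiplicationPVM, integral_map ha.aemeasurable (by fun_prop)]
    rw [← U.inner_map_map, inner_L2_eq]
    have e : ∀ᵐ x ∂μ, (starRingEnd ℂ) (U (u : H) x) * U (A u) x
        = ((‖U (u : H) x‖ ^ 2 * a x : ℝ) : ℂ) := by
      filter_upwards [hA.apply_ae u] with x hx
      rw [hx]
      have := Complex.conj_mul' (U (u : H) x)
      push_cast
      linear_combination (a x : ℂ) * this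
    rw [integral_congr_ae e, integral_complex_ofReal]
    congr 1
    have e2 : (fun x => ‖U (u : H) x‖ₑ ^ 2)
        = fun x => ((‖U (u : H) x‖₊ ^ 2 : NNReal) : ℝ≥0∞) := by
      funext x; rw [ENNReal.coe_pow]; rfl
    rw [e2, integral_withDensity_eq_integral_smul₀]
    · refine integral_congr_ae (Eventually.of_forall fun x => ?_)
      simp [NNReal.smul_def]
    · exact (Lp.aestronglyMeasurable _).aemeasurable.nnnorm.pow_const 2

end Multiplication

/-! ### Uniqueness of the spectral measure -/

namespace ProjectionValuedMeasure

variable {H : Type*} [NormedAddCommGroup H] [InnerProductSpace ℂ H] [CompleteSpace H]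
variable (E : ProjectionValuedMeasure H)

theorem proj_proj {B C : Set ℝ} (hB : MeasurableSet B) (hC : MeasurableSet C) (u : H) :
    E.proj B (E.proj C u) = E.proj (B ∩ C) u := by
  rw [E.inter B C hB hC, mul_apply_eq_comp]

theorem inner_proj_left {B : Set ℝ} (hB : MeasurableSet B) (u v : H) :
    inner ℂ (E.proj B u) v = inner ℂ u (E.proj B v) :=
  ContinuousLinearMap.isSelfAdjoint_iff_isSymmetric.1 (E.isStarProjection B hB).isSelfAdjoint u v

instance (u : H) : IsFiniteMeasure (E.scalarMeasure u) :=
  ⟨by rw [E.scalarMeasure_apply u MeasurableSet.univ]; exact ENNReal.ofReal_lt_top⟩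

theorem scalarMeasure_univ (u : H) : E.scalarMeasure u Set.univ = ENNReal.ofReal (‖u‖ ^ 2) := by
  rw [E.scalarMeasure_apply u MeasurableSet.univ, E.univ]; rfl

theorem scalarMeasure_proj {B : Set ℝ} (hB : MeasurableSet B) (u : H) :
    E.scalarMeasure (E.proj B u) = (E.scalarMeasure u).restrict B := by
  ext C hC
  rw [Measure.restrict_apply hC, E.scalarMeasure_apply _ hC, E.scalarMeasure_apply _ (hC.inter hB),
    E.proj_proj hC hB]

theorem scalarMeasure_add_smul {B : Set ℝ} (hB : MeasurableSet B) {u w : H} (hu : E.proj B u = u)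
    (hw : E.proj B w = 0) (c : ℂ) :
    E.scalarMeasure (u + c • w)
      = E.scalarMeasure u + ENNReal.ofReal (‖c‖ ^ 2) • E.scalarMeasure w := by
  ext C hC
  have horth : inner ℂ (E.proj C u) (E.proj C (c • w)) = 0 := by
    rw [E.inner_proj_left hC, E.proj_proj hC hC, Set.inter_self, ← hu, E.inner_proj_left hB,
      E.proj_proj hB hC, Set.inter_comm, ← E.proj_proj hC hB, map_smul, hw, smul_zero, map_zero,
      inner_zero_right]
  have hsq := norm_add_sq_eq_norm_sq_add_norm_sq_of_inner_eq_zero _ _ horth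
  rw [Measure.add_apply, Measure.smul_apply, E.scalarMeasure_apply _ hC, E.scalarMeasure_apply _ hC,
    E.scalarMeasure_apply _ hC, map_add, smul_eq_mul, ← ENNReal.ofReal_mul (by positivity),
    ← ENNReal.ofReal_add (by positivity) (by positivity)]
  congr 1
  rw [sq, hsq, map_smul, norm_smul]
  ring

theorem hasSum_proj_preimage {κ : ℝ → ℕ} (hκ : Measurable κ) (u : H) :
    HasSum (fun n => E.proj (κ ⁻¹' {n}) u) u := by
  have h := E.iUnion (fun n => κ ⁻¹' {n}) (fun n => hκ (measurableSet_singleton n))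
    (fun i j hij => Disjoint.preimage κ (by simpa using hij)) u
  have e : (⋃ n, κ ⁻¹' {n}) = Set.univ := by
    ext x; simp
  rw [e, E.univ] at h
  exact h

end ProjectionValuedMeasure

section Unique

theorem inner_self_eq_ofReal_norm_sq {V : Type*} [NormedAddCommGroup V] [InnerProductSpace ℂ V]
    (v : V) : inner ℂ v v = ((‖v‖ ^ 2 : ℝ) : ℂ) := by
  rw [inner_self_eq_norm_sq_to_K]; norm_cast

variable {α : Type*} [MeasurableSpace α] {μ : Measure α}
variable {H : Type*} [NormedAddCommGroup H] [InnerProductSpace ℂ H]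
variable {A : H →ₗ.[ℂ] H} {U : H ≃ₗᵢ[ℂ] Lp ℂ 2 μ} {a : α → ℝ}

theorem IsMultiplication.inner_symm (hA : IsMultiplication U a A) (u v : A.domain) :
    inner ℂ (A u) (v : H) = inner ℂ (u : H) (A v) := by
  rw [← U.inner_map_map, ← U.inner_map_map (u : H), inner_L2_eq, inner_L2_eq]
  refine integral_congr_ae ?_
  filter_upwards [hA.apply_ae u, hA.apply_ae v] with x h1 h2
  rw [h1, h2, map_mul, Complex.conj_ofReal]; ring

variable [CompleteSpace H] {E : ProjectionValuedMeasure H}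

theorem IsSpectralMeasure.integrable (hE : IsSpectralMeasure A E) {u : H} (hu : u ∈ A.domain) :
    Integrable (fun t : ℝ => t) (E.scalarMeasure u) := by
  have h := (hE.1 u).1 hu
  have h2 : MemLp (fun t : ℝ => t) 2 (E.scalarMeasure u) := by
    refine ⟨by fun_prop, ?_⟩
    rw [eLpNorm_lt_top_iff_lintegral_rpow_enorm_lt_top (by norm_num) (by norm_num)]
    refine lt_of_le_of_lt (lintegral_mono fun t => ?_) h
    rw [← ofReal_norm, ENNReal.toReal_ofNat, ENNReal.rpow_two, ← ENNReal.ofReal_pow (norm_nonneg _),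
      Real.norm_eq_abs, sq_abs]
  exact h2.integrable (by norm_num)

theorem IsSpectralMeasure.proj_mem_domain (hE : IsSpectralMeasure A E) {B : Set ℝ}
    (hB : MeasurableSet B) {b c : ℝ} (hBc : B ⊆ Set.Icc b c) (u : H) :
    E.proj B u ∈ A.domain := by
  rw [hE.1, E.scalarMeasure_proj hB]
  have h1 : ∫⁻ t in B, ENNReal.ofReal (t ^ 2) ∂(E.scalarMeasure u)
      ≤ ∫⁻ _ in B, ENNReal.ofReal (b ^ 2 + c ^ 2) ∂(E.scalarMeasure u) := by
    refine setLIntegral_mono measurable_const fun t ht => ENNReal.ofReal_le_ofReal ?_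
    obtain ⟨h1, h2⟩ := hBc ht
    rcases le_total 0 t with h | h <;> nlinarith [sq_nonneg b, sq_nonneg c]
  refine h1.trans_lt ?_
  rw [setLIntegral_const]
  exact ENNReal.mul_lt_top ENNReal.ofReal_lt_top (measure_lt_top _ _)

/-- The operator `A` maps the range of a spectral projection into the orthogonal complement of
the complementary spectral subspace: compare the quadratic forms at `u + w` and `u + iw`. -/
theorem IsSpectralMeasure.inner_eq_zero (hE : IsSpectralMeasure A E) {B : Set ℝ}
    (hB : MeasurableSet B) {u w : A.domain} (hu : E.proj B u = u) (hw : E.proj B w = 0) :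
    inner ℂ (w : H) (A u) = 0 := by
  have hq : ∀ c : ℂ, inner ℂ ((u : H) + c • w) (A (u + c • w))
      = inner ℂ (u : H) (A u) + ((‖c‖ ^ 2 : ℝ) : ℂ) * inner ℂ (w : H) (A w) := by
    intro c
    have h1 := hE.2 (u + c • w)
    have e : ((u + c • w : A.domain) : H) = (u : H) + c • (w : H) := rfl
    rw [e, E.scalarMeasure_add_smul hB hu hw, integral_add_measure (hE.integrable u.2)
      ((hE.integrable w.2).smul_measure ENNReal.ofReal_ne_top), integral_smul_measure,
      ENNReal.toReal_ofReal (by positivity), smul_eq_mul] at h1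
    rw [h1, hE.2 u, hE.2 w]
    push_cast; ring
  have hx : ∀ c : ℂ, c * inner ℂ (u : H) (A w) + (starRingEnd ℂ) c * inner ℂ (w : H) (A u) = 0 := by
    intro c
    have h1 := hq c
    rw [LinearPMap.map_add, LinearPMap.map_smul, inner_add_left, inner_add_right, inner_add_right,
      inner_smul_left, inner_smul_left, inner_smul_right, inner_smul_right] at h1
    have h2 := Complex.conj_mul' c
    push_cast at h1
    linear_combination h1 - inner ℂ (w : H) (A w) * h2
  have h1 := hx 1
  have h2 := hx Complex.I
  rw [map_one, one_mul, one_mul] at h1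
  rw [Complex.conj_I] at h2
  have h3 : (2 : ℂ) * inner ℂ (w : H) (A u) = 0 := by
    linear_combination h1 + Complex.I * h2
      + (inner ℂ (w : H) (A u) - inner ℂ (u : H) (A w)) * Complex.I_mul_I
  simpa using h3

/-- `A` maps the range of a spectral projection into itself. -/
theorem IsSpectralMeasure.proj_apply_eq (hE : IsSpectralMeasure A E) {B : Set ℝ}
    (hB : MeasurableSet B) {u : A.domain} (hu : E.proj B u = u) : E.proj B (A u) = A u := by
  set z := A u - E.proj B (A u) with hz
  have hBz : E.proj B z = 0 := by
    rw [hz, map_sub, E.proj_proj hB hB, Set.inter_self, sub_self]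
  -- approximate `z` by its components in bounded spectral subspaces, which lie in the domain
  set κ : ℝ → ℕ := fun t => ⌊|t|⌋₊ with hκ
  have hκm : Measurable κ := Nat.measurable_floor.comp measurable_id.abs
  have h0 : ∀ n, inner ℂ (E.proj (κ ⁻¹' {n}) z) (A u) = 0 := by
    intro n
    have hm : MeasurableSet (κ ⁻¹' {n}) := hκm (measurableSet_singleton n)
    have hsub : κ ⁻¹' {n} ⊆ Set.Icc (-((n : ℝ) + 1)) (n + 1) := by
      intro t ht
      have h1 : ⌊|t|⌋₊ = n := ht
      have h2 := Nat.lt_floor_add_one |t|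
      rw [h1] at h2
      exact abs_le.1 h2.le
    refine hE.inner_eq_zero hB (w := ⟨_, hE.proj_mem_domain hm hsub z⟩) hu ?_
    change E.proj B (E.proj (κ ⁻¹' {n}) z) = 0
    rw [E.proj_proj hB hm, Set.inter_comm, ← E.proj_proj hm hB, hBz, map_zero]
  have h1 : inner ℂ (A u) z = 0 := by
    have h := (E.hasSum_proj_preimage hκm z).mapL (innerSL ℂ (A u))
    simp only [innerSL_apply_apply] at h
    have h2 : ∀ n, inner ℂ (A u) (E.proj (κ ⁻¹' {n}) z) = 0 := fun n =>
      inner_eq_zero_symm.1 (h0 n)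
    simp_rw [h2] at h
    exact h.unique hasSum_zero
  have h2 : inner ℂ z z = 0 := by
    conv_lhs => rw [hz]
    rw [← hz, inner_sub_left, h1, E.inner_proj_left hB, hBz, inner_zero_right, sub_zero]
  exact (sub_eq_zero.1 (inner_self_eq_zero.1 h2)).symm

/-- The quadratic form of `A` on a spectral subspace of an interval. -/
theorem IsSpectralMeasure.abs_quadratic_le (hE : IsSpectralMeasure A E) {B : Set ℝ}
    (hB : MeasurableSet B) {m δ : ℝ} (hBm : B ⊆ Set.Icc (m - δ) (m + δ)) {u : A.domain}
    (hu : E.proj B u = u) :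
    |(inner ℂ (u : H) (A u - (m : ℂ) • (u : H))).re| ≤ δ * ‖(u : H)‖ ^ 2 := by
  have hi := hE.integrable u.2
  have hmass : (E.scalarMeasure (u : H)).real Set.univ = ‖(u : H)‖ ^ 2 := by
    rw [measureReal_def, E.scalarMeasure_univ, ENNReal.toReal_ofReal (by positivity)]
  have h1 : (inner ℂ (u : H) (A u - (m : ℂ) • (u : H))).re
      = ∫ t, (t - m) ∂(E.scalarMeasure (u : H)) := by
    rw [inner_sub_right, hE.2, inner_smul_right, inner_self_eq_ofReal_norm_sq,
      integral_sub hi (integrable_const _), integral_const, hmass]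
    rw [Complex.sub_re, Complex.ofReal_re, ← Complex.ofReal_mul, Complex.ofReal_re, smul_eq_mul,
      mul_comm]
  rw [h1, ← hmass, mul_comm, ← smul_eq_mul, ← integral_const]
  refine (abs_integral_le_integral_abs).trans (integral_mono_ae (hi.sub (integrable_const _)).abs
    (integrable_const _) ?_)
  have hae : ∀ᵐ t ∂(E.scalarMeasure (u : H)), t ∈ B := by
    rw [← hu, E.scalarMeasure_proj hB]
    exact ae_restrict_mem hB
  filter_upwards [hae] with t ht
  obtain ⟨h1, h2⟩ := hBm ht
  exact abs_le.2 ⟨by linarith, by linarith⟩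

/-- On the spectral subspace of an interval with centre `m` and half-length `δ`, the symmetric
operator `A - m` has norm at most `δ`, by polarization of its quadratic form. -/
theorem IsSpectralMeasure.norm_sub_le (hA : IsMultiplication U a A) (hE : IsSpectralMeasure A E)
    {B : Set ℝ} (hB : MeasurableSet B) {m δ : ℝ} (hBm : B ⊆ Set.Icc (m - δ) (m + δ))
    {u : A.domain} (hu : E.proj B u = u) :
    ‖A u - (m : ℂ) • (u : H)‖ ≤ δ * ‖(u : H)‖ := by
  set w : H := A u - (m : ℂ) • (u : H) with hw
  have hBw : E.proj B w = w := by
    rw [hw, map_sub, map_smul, hE.proj_apply_eq hB hu, hu]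
  have hwd : w ∈ A.domain := hBw ▸ hE.proj_mem_domain hB hBm w
  rcases eq_or_ne w 0 with h0 | h0
  · rw [h0, norm_zero]
    have h1 := (abs_nonneg _).trans (hE.abs_quadratic_le hB hBm hu)
    by_contra! hlt
    have hpos : 0 < ‖(u : H)‖ := by
      rw [norm_pos_iff]; intro h; rw [h, norm_zero, mul_zero] at hlt; exact lt_irrefl _ hlt
    nlinarith
  rcases eq_or_ne (u : H) 0 with hu0 | hu0
  · exfalso
    apply h0
    have : u = 0 := Subtype.ext hu0
    rw [hw, hu0, smul_zero, sub_zero, this, LinearPMap.map_zero]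
  have hwp : 0 < ‖w‖ := norm_pos_iff.2 h0
  have hup : 0 < ‖(u : H)‖ := norm_pos_iff.2 hu0
  -- polarize with `v` the multiple of `w` that has the norm of `u`
  set s : ℝ := ‖(u : H)‖ / ‖w‖ with hs
  set v : A.domain := (s : ℂ) • ⟨w, hwd⟩ with hv
  have hvc : (v : H) = (s : ℂ) • w := rfl
  have hBv : E.proj B v = v := by rw [hvc, map_smul, hBw]
  have q1 := hE.abs_quadratic_le hB hBm (u := u + v) (by
    change E.proj B ((u : H) + v) = u + v; rw [map_add, hu, hBv])
  have q2 := hE.abs_quadratic_le hB hBm (u := u - v) (by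
    change E.proj B ((u : H) - v) = u - v; rw [map_sub, hu, hBv])
  have e1 : ((u + v : A.domain) : H) = (u : H) + v := rfl
  have e2 : ((u - v : A.domain) : H) = (u : H) - v := rfl
  rw [e1] at q1
  rw [e2] at q2
  have hpar := parallelogram_law_with_norm ℂ (u : H) (v : H)
  have hnv : ‖(v : H)‖ = ‖(u : H)‖ := by
    rw [hvc, norm_smul, Complex.norm_real, Real.norm_of_nonneg (by positivity), hs,
      div_mul_cancel₀ _ hwp.ne']
  have hpol : (inner ℂ ((u : H) + v) (A (u + v) - (m : ℂ) • ((u : H) + v))).re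
      - (inner ℂ ((u : H) - v) (A (u - v) - (m : ℂ) • ((u : H) - v))).re
      = 4 * (inner ℂ (v : H) w).re := by
    have a1 : A (u + v) - (m : ℂ) • ((u : H) + v) = w + (A v - (m : ℂ) • (v : H)) := by
      rw [LinearPMap.map_add, hw, smul_add]; abel
    have a2 : A (u - v) - (m : ℂ) • ((u : H) - v) = w - (A v - (m : ℂ) • (v : H)) := by
      rw [LinearPMap.map_sub, hw, smul_sub]; abel
    have a3 : inner ℂ (u : H) (A v - (m : ℂ) • (v : H)) = inner ℂ w (v : H) := by
      rw [hw, inner_sub_right, inner_sub_left, hA.inner_symm, inner_smul_left, inner_smul_right,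
        Complex.conj_ofReal]
    have a4 : (inner ℂ w (v : H)).re = (inner ℂ (v : H) w).re := inner_re_symm (𝕜 := ℂ) _ _
    rw [a1, a2]
    simp only [inner_add_left, inner_add_right, inner_sub_left (𝕜 := ℂ) (E := H) (u : H),
      inner_sub_right (𝕜 := ℂ) (E := H) _ w, a3, Complex.add_re, Complex.sub_re, a4]
    ring
  have hvw : (inner ℂ (v : H) w).re = ‖(u : H)‖ * ‖w‖ := by
    rw [hvc, inner_smul_left, Complex.conj_ofReal, Complex.re_ofReal_mul,
      inner_self_eq_ofReal_norm_sq, Complex.ofReal_re, hs]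
    field_simp
  have f1 := abs_le.1 q1
  have f2 := abs_le.1 q2
  rw [hvw] at hpol
  rw [hnv] at hpar
  have : ‖(u : H)‖ * ‖w‖ ≤ ‖(u : H)‖ * (δ * ‖(u : H)‖) := by
    have h2 : δ * ‖(u : H) + v‖ ^ 2 + δ * ‖(u : H) - v‖ ^ 2
        = 4 * (‖(u : H)‖ * (δ * ‖(u : H)‖)) := by
      rw [← mul_add, hpar]; ring
    linarith [f1.2, f2.1]
  exact le_of_mul_le_mul_left this hup

/-- The spectral subspace of a bounded interval is contained in the one of the multiplication
operator: iterating `A - m` gives `‖(a - m)^k Uu‖ ≤ δ^k ‖u‖` for all `k`. -/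
theorem IsSpectralMeasure.ae_mem_of_proj_eq (ha : Measurable a) (hA : IsMultiplication U a A)
    (hE : IsSpectralMeasure A E) {B : Set ℝ} (hB : MeasurableSet B) {m δ : ℝ} (hδ : 0 < δ)
    (hBm : B ⊆ Set.Icc (m - δ) (m + δ)) {u : H} (hu : E.proj B u = u) :
    ∀ᵐ x ∂μ, δ < |a x - m| → U u x = 0 := by
  -- `v = (A - m)^k u`
  have hiter : ∀ k : ℕ, ∃ v : H, E.proj B v = v ∧ ‖v‖ ≤ δ ^ k * ‖u‖ ∧
      U v =ᵐ[μ] fun x => ((a x - m : ℝ) : ℂ) ^ k * U u x := by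
    intro k
    induction k with
    | zero => exact ⟨u, hu, by simp, by simp⟩
    | succ k ih =>
      obtain ⟨v, hv1, hv2, hv3⟩ := ih
      have hvd : v ∈ A.domain := hv1 ▸ hE.proj_mem_domain hB hBm v
      refine ⟨A ⟨v, hvd⟩ - (m : ℂ) • v, ?_, ?_, ?_⟩
      · rw [map_sub, map_smul, hE.proj_apply_eq hB (u := ⟨v, hvd⟩) hv1, hv1]
      · refine (IsSpectralMeasure.norm_sub_le hA hE hB hBm (u := ⟨v, hvd⟩) hv1).trans ?_
        rw [pow_succ']
        calc δ * ‖v‖ ≤ δ * (δ ^ k * ‖u‖) := mul_le_mul_of_nonneg_left hv2 hδ.le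
          _ = δ * δ ^ k * ‖u‖ := by ring
      · rw [map_sub, map_smul]
        filter_upwards [Lp.coeFn_sub (U (A ⟨v, hvd⟩)) ((m : ℂ) • U v),
          Lp.coeFn_smul (m : ℂ) (U v), hA.apply_ae ⟨v, hvd⟩, hv3] with x h1 h2 h3 h4
        rw [h1, Pi.sub_apply, h2, Pi.smul_apply, h3, smul_eq_mul, h4]
        push_cast; ring
  have hUm := (Lp.stronglyMeasurable (U u)).measurable
  -- where `|a - m| ≥ δ r` with `r > 1`, the bound `r^(2k) ∫ |Uu|² ≤ ‖u‖²` for all `k`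
  -- forces `Uu = 0`
  have hset : ∀ j : ℕ, ∀ᵐ x ∂μ, δ * (1 + 1 / ((j : ℝ) + 1)) ≤ |a x - m| → U u x = 0 := by
    intro j
    set r : ℝ := 1 + 1 / ((j : ℝ) + 1) with hr
    have hr1 : 1 < r := by rw [hr]; linarith [show 0 < 1 / ((j : ℝ) + 1) by positivity]
    set S : Set α := {x | δ * r ≤ |a x - m|} with hS
    have hSm : MeasurableSet S := measurableSet_le measurable_const (ha.sub_const m).abs
    have hb : ∀ k : ℕ, ENNReal.ofReal (r ^ 2) ^ k * ∫⁻ x in S, ‖U u x‖ₑ ^ 2 ∂μ ≤ ‖u‖ₑ ^ 2 := by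
      intro k
      obtain ⟨v, -, hv2, hv3⟩ := hiter k
      have h1 : ENNReal.ofReal (δ ^ (2 * k)) *
          (ENNReal.ofReal (r ^ 2) ^ k * ∫⁻ x in S, ‖U u x‖ₑ ^ 2 ∂μ) ≤ ‖v‖ₑ ^ 2 := by
        rw [← ofReal_norm v, ← U.norm_map v, ofReal_norm, ← lintegral_enorm_sq_eq]
        rw [← lintegral_const_mul _ (hUm.enorm.pow_const 2),
          ← lintegral_const_mul _ ((hUm.enorm.pow_const 2).const_mul _)]
        refine le_trans (lintegral_mono_ae ?_) (setLIntegral_le_lintegral S _)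
        filter_upwards [ae_restrict_mem hSm, ae_restrict_of_ae hv3] with x hx hx3
        rw [hx3, enorm_mul, mul_pow, ← mul_assoc]
        refine mul_le_mul_left ?_ _
        rw [← ENNReal.ofReal_pow (by positivity), ← ENNReal.ofReal_mul (by positivity),
          ← ofReal_norm, ← ENNReal.ofReal_pow (norm_nonneg _), norm_pow, Complex.norm_real,
          Real.norm_eq_abs]
        refine ENNReal.ofReal_le_ofReal ?_
        calc δ ^ (2 * k) * (r ^ 2) ^ k = ((δ * r) ^ k) ^ 2 := by ring_nf
          _ ≤ (|a x - m| ^ k) ^ 2 := by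
            gcongr
            exact hx
      have h2 : ‖v‖ₑ ^ 2 ≤ ENNReal.ofReal (δ ^ (2 * k)) * ‖u‖ₑ ^ 2 := by
        rw [← ofReal_norm, ← ofReal_norm, ← ENNReal.ofReal_pow (norm_nonneg _),
          ← ENNReal.ofReal_pow (norm_nonneg _), ← ENNReal.ofReal_mul (by positivity)]
        refine ENNReal.ofReal_le_ofReal ?_
        calc ‖v‖ ^ 2 ≤ (δ ^ k * ‖u‖) ^ 2 := by gcongr
          _ = _ := by ring
      exact (ENNReal.mul_le_mul_iff_right (by simpa using pow_pos hδ (2 * k))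
        ENNReal.ofReal_ne_top).1 (h1.trans h2)
    have hzero : ∫⁻ x in S, ‖U u x‖ₑ ^ 2 ∂μ = 0 := by
      by_contra hne
      have h1 : Tendsto (fun k => ENNReal.ofReal (r ^ 2) ^ k * ∫⁻ x in S, ‖U u x‖ₑ ^ 2 ∂μ)
          atTop (𝓝 ⊤) := by
        have h2 : (1 : ℝ≥0∞) < ENNReal.ofReal (r ^ 2) := by
          rw [← ENNReal.ofReal_one]
          exact (ENNReal.ofReal_lt_ofReal_iff (by positivity)).2 (by nlinarith)
        have h3 := ENNReal.Tendsto.mul_const (b := ∫⁻ x in S, ‖U u x‖ₑ ^ 2 ∂μ)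
          (ENNReal.tendsto_pow_atTop_nhds_top_iff.2 h2) (Or.inl ENNReal.top_ne_zero)
        rwa [ENNReal.top_mul hne] at h3
      have h4 := le_of_tendsto' h1 hb
      exact absurd h4 (not_le.2 (ENNReal.pow_lt_top enorm_lt_top))
    rw [lintegral_eq_zero_iff (hUm.enorm.pow_const 2), EventuallyEq, ae_restrict_iff' hSm] at hzero
    filter_upwards [hzero] with x hx hx2
    simpa using hx hx2
  filter_upwards [ae_all_iff.2 hset] with x hx hlt
  obtain ⟨j, hj⟩ := exists_nat_one_div_lt (show 0 < |a x - m| / δ - 1 by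
    rw [sub_pos, lt_div_iff₀ hδ, one_mul]; exact hlt)
  refine hx j ?_
  have : (1 + 1 / ((j : ℝ) + 1)) ≤ |a x - m| / δ := by linarith
  rw [le_div_iff₀ hδ] at this
  linarith

/-- Every spectral measure of an operator that is unitarily equivalent to a multiplication operator
assigns to a compact interval the projection given by the multiplication operator. -/
theorem IsSpectralMeasure.proj_Icc_eq (ha : Measurable a) (hA : IsMultiplication U a A)
    (hE : IsSpectralMeasure A E) {b c : ℝ} (hbc : b < c) (u : H) :
    U (E.proj (Set.Icc b c) u)
      = indicatorL2 (ha (measurableSet_Icc : MeasurableSet (Set.Icc b c))) (U u) := by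
  -- `κ` cuts the complement of `[b, c]` into pieces at positive distance from `[b, c]`
  set κ : ℝ → ℕ := fun t => if t ∈ Set.Icc b c then 0 else
    if c < t then 1 + 2 * ⌊t + 1 / (t - c)⌋₊ else 2 + 2 * ⌊-t + 1 / (b - t)⌋₊ with hκ
  have hκm : Measurable κ := by
    refine Measurable.ite measurableSet_Icc measurable_const
      (Measurable.ite measurableSet_Ioi ?_ ?_)
    · exact (measurable_from_nat (f := fun n => 1 + 2 * n)).comp
        (Nat.measurable_floor.comp (by fun_prop))
    · exact (measurable_from_nat (f := fun n => 2 + 2 * n)).comp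
        (Nat.measurable_floor.comp (by fun_prop))
  have h0 : κ ⁻¹' {0} = Set.Icc b c := by
    ext t
    simp only [hκ, Set.mem_preimage, Set.mem_singleton_iff]
    split_ifs with h1 h2 <;> simp [h1]
  -- `U` maps the range of `E [b, c]` into the functions supported where `a ∈ [b, c]`
  have hin : ∀ v : H, E.proj (Set.Icc b c) v = v →
      indicatorL2 (ha (measurableSet_Icc : MeasurableSet (Set.Icc b c))) (U v) = U v := by
    intro v hv
    have h1 := IsSpectralMeasure.ae_mem_of_proj_eq ha hA hE measurableSet_Icc
      (m := (b + c) / 2) (δ := (c - b) / 2) (by linarith)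
      (by intro t ht; exact ⟨by linarith [ht.1], by linarith [ht.2]⟩) hv
    refine Lp.ext ?_
    filter_upwards [h1,
      coeFn_indicatorL2 (ha (measurableSet_Icc : MeasurableSet (Set.Icc b c))) (U v)] with x h1 h2
    rw [h2]
    by_cases h3 : x ∈ a ⁻¹' Set.Icc b c
    · rw [Set.indicator_of_mem h3]
    · rw [Set.indicator_of_notMem h3, h1]
      rw [lt_abs]
      by_contra! h4
      exact h3 ⟨by linarith [h4.1, h4.2], by linarith [h4.1, h4.2]⟩
  -- the other pieces lie in compact intervals disjoint from `[b, c]`, where the same applies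
  have hout : ∀ n, n ≠ 0 →
      indicatorL2 (ha (measurableSet_Icc : MeasurableSet (Set.Icc b c)))
        (U (E.proj (κ ⁻¹' {n}) u)) = 0 := by
    intro n hn
    have hm : MeasurableSet (κ ⁻¹' {n}) := hκm (measurableSet_singleton n)
    obtain ⟨b', c', hbc', hsub, hdisj⟩ : ∃ b' c' : ℝ, b' < c' ∧ κ ⁻¹' {n} ⊆ Set.Icc b' c' ∧
        Disjoint (Set.Icc b' c') (Set.Icc b c) := by
      rcases Nat.even_or_odd' n with ⟨k, hk | hk⟩
      · -- pieces to the left of `b`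
        refine ⟨b - ((k : ℝ) + 1 + |b|) - 1, b - 1 / ((k : ℝ) + 1 + |b|), ?_, ?_, ?_⟩
        · have h1 : 1 / ((k : ℝ) + 1 + |b|) ≤ 1 := by
            rw [div_le_one (by positivity)]; linarith [abs_nonneg b, (k.cast_nonneg : (0 : ℝ) ≤ k)]
          linarith [abs_nonneg b, (k.cast_nonneg : (0 : ℝ) ≤ k)]
        · intro t ht
          simp only [hκ, Set.mem_preimage, Set.mem_singleton_iff] at ht
          split_ifs at ht with h1 h2
          · omega
          · omega
          · have htb : t < b := by
              by_contra! h3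
              exact h1 ⟨h3, not_lt.1 h2⟩
            have h4 : (⌊-t + 1 / (b - t)⌋₊ : ℝ) + 1 ≤ k := by
              have : ⌊-t + 1 / (b - t)⌋₊ + 1 = k := by omega
              exact_mod_cast this.le
            have h5 := Nat.lt_floor_add_one (-t + 1 / (b - t))
            have h6 : 0 < 1 / (b - t) := by
              have : 0 < b - t := by linarith
              positivity
            have h7 : 1 / (b - t) < (k : ℝ) + 1 + |b| := by linarith [le_abs_self b]
            refine ⟨by linarith [neg_abs_le b, le_abs_self b], ?_⟩
            rw [one_div_lt (by linarith) (by positivity)] at h7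
            linarith
        · rw [Set.disjoint_left]
          intro t h1 h2
          have : 0 < 1 / ((k : ℝ) + 1 + |b|) := by positivity
          linarith [h1.2, h2.1]
      · -- pieces to the right of `c`
        refine ⟨c + 1 / ((k : ℝ) + 1 + |c|), c + ((k : ℝ) + 1 + |c|) + 1, ?_, ?_, ?_⟩
        · have h1 : 1 / ((k : ℝ) + 1 + |c|) ≤ 1 := by
            rw [div_le_one (by positivity)]; linarith [abs_nonneg c, (k.cast_nonneg : (0 : ℝ) ≤ k)]
          linarith [abs_nonneg c, (k.cast_nonneg : (0 : ℝ) ≤ k)]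
        · intro t ht
          simp only [hκ, Set.mem_preimage, Set.mem_singleton_iff] at ht
          split_ifs at ht with h1 h2
          · omega
          · have h4 : ⌊t + 1 / (t - c)⌋₊ = k := by omega
            have h5 := Nat.lt_floor_add_one (t + 1 / (t - c))
            rw [h4] at h5
            have h6 : 0 < 1 / (t - c) := by
              have : 0 < t - c := by linarith
              positivity
            have h7 : 1 / (t - c) < (k : ℝ) + 1 + |c| := by linarith [neg_abs_le c]
            refine ⟨?_, by linarith [neg_abs_le c]⟩
            rw [one_div_lt (by linarith) (by positivity)] at h7
            linarith
          · omega
        · rw [Set.disjoint_left]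
          intro t h1 h2
          have : 0 < 1 / ((k : ℝ) + 1 + |c|) := by positivity
          linarith [h1.1, h2.2]
    have h1 := IsSpectralMeasure.ae_mem_of_proj_eq ha hA hE hm
      (m := (b' + c') / 2) (δ := (c' - b') / 2) (by linarith)
      (by intro t ht; have := hsub ht; exact ⟨by linarith [this.1], by linarith [this.2]⟩)
      (u := E.proj (κ ⁻¹' {n}) u) (by rw [E.proj_proj hm hm, Set.inter_self])
    refine Lp.ext ?_
    filter_upwards [h1,
      coeFn_indicatorL2 (ha (measurableSet_Icc : MeasurableSet (Set.Icc b c)))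
        (U (E.proj (κ ⁻¹' {n}) u)),
      Lp.coeFn_zero ℂ 2 μ] with x h1 h2 h5
    rw [h2, h5]
    by_cases h3 : x ∈ a ⁻¹' Set.Icc b c
    · rw [Set.indicator_of_mem h3, Pi.zero_apply, h1]
      rw [lt_abs]
      by_contra! h4
      exact Set.disjoint_left.1 hdisj (show a x ∈ Set.Icc b' c' from
        ⟨by linarith [h4.1, h4.2], by linarith [h4.1, h4.2]⟩) h3
    · rw [Set.indicator_of_notMem h3]; rfl
  have hs := ((E.hasSum_proj_preimage hκm u).mapL (U : H →L[ℂ] Lp ℂ 2 μ)).mapL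
    (indicatorL2 (ha (measurableSet_Icc : MeasurableSet (Set.Icc b c))) : Lp ℂ 2 μ →L[ℂ] Lp ℂ 2 μ)
  have hs2 := hs.unique (hasSum_single 0 hout)
  rw [h0] at hs2
  have hs3 := hin (E.proj (Set.Icc b c) u) (by
    rw [E.proj_proj measurableSet_Icc measurableSet_Icc, Set.inter_self])
  exact (hs2.trans hs3).symm

end Unique

/-! ### The coefficient transform -/

/-- The measure `dλ × # × #` on the space `ℝ × ℕ × ℕ` of triples `(λ, m, n)`. -/
def coeffMeasure : Measure (ℝ × ℕ × ℕ) := (volume : Measure ℝ).prod Measure.count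

/-- The Hilbert space in which the matrix coefficients of Plancherel transforms live. -/
abbrev L2X : Type := Lp ℂ 2 coeffMeasure

theorem lintegral_coeffMeasure {g : ℝ × ℕ × ℕ → ℝ≥0∞} (hg : Measurable g) :
    ∫⁻ z, g z ∂coeffMeasure = ∑' k, ∫⁻ lam, g (lam, k) := by
  rw [coeffMeasure, lintegral_prod_symm _ hg.aemeasurable, lintegral_count]

theorem ae_coeffMeasure_iff {P : ℝ × ℕ × ℕ → Prop} :
    (∀ᵐ z ∂coeffMeasure, P z) ↔ ∀ᵐ lam : ℝ, ∀ k, P (lam, k) := by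
  constructor
  · intro h
    filter_upwards [Measure.ae_ae_of_ae_prod h] with lam hlam
    exact Measure.ae_count_iff.1 hlam
  · intro h
    choose s hs hm h0 using fun k =>
      exists_measurable_superset_of_null (mem_ae_iff.1 (ae_all_iff.1 h k))
    have hS : MeasurableSet (⋃ k, s k ×ˢ ({k} : Set (ℕ × ℕ))) :=
      MeasurableSet.iUnion fun k => (hm k).prod (measurableSet_singleton k)
    refine measure_mono_null (t := ⋃ k, s k ×ˢ ({k} : Set (ℕ × ℕ))) ?_ ?_
    · rintro ⟨lam, k⟩ hz
      exact Set.mem_iUnion.2 ⟨k, hs k hz, rfl⟩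
    · rw [measure_iUnion_null_iff]
      intro k
      rw [coeffMeasure, Measure.prod_prod, h0, zero_mul]

/-- The coefficients `√|λ| ⟨h_{m,λ}, ρ_λ(f) h_{n,λ}⟩` of an integrable function. -/
def coeffFun (f : Heisenberg → ℂ) (z : ℝ × ℕ × ℕ) : ℂ :=
  ((√|z.1| : ℝ) : ℂ) * ∫ x, f x * matCoeff z.2.1 z.2.2 z.1 x

theorem measurable_coeffFun {f : Heisenberg → ℂ} (hf : Measurable f) : Measurable (coeffFun f) := by
  refine measurable_from_prod_countable_left fun k => ?_
  refine Measurable.mul (by fun_prop) (StronglyMeasurable.measurable ?_)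
  refine StronglyMeasurable.integral_prod_right (f := fun (lam : ℝ) (x : Heisenberg) =>
    f x * matCoeff k.1 k.2 lam x) (Measurable.stronglyMeasurable ?_)
  exact (hf.comp measurable_snd).mul (measurable_matCoeff k.1 k.2)

theorem enorm_sqrt_abs_sq (lam : ℝ) : ‖((√|lam| : ℝ) : ℂ)‖ₑ ^ 2 = ‖lam‖ₑ := by
  rw [← ofReal_norm, ← ENNReal.ofReal_pow (norm_nonneg _), Complex.norm_real, Real.norm_eq_abs,
    sq_abs, Real.sq_sqrt (abs_nonneg _), ← Real.norm_eq_abs, ofReal_norm]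

theorem lintegral_enorm_sq_coeffFun {f : Heisenberg → ℂ} (hm : Measurable f) (h1 : Integrable f)
    (h2 : MemLp f 2) : ∫⁻ z, ‖coeffFun f z‖ₑ ^ 2 ∂coeffMeasure = ∫⁻ x, ‖f x‖ₑ ^ 2 := by
  have hk := (measurable_coeffFun hm).enorm.pow_const 2
  rw [lintegral_coeffMeasure hk, ← lintegral_tsum (f := fun k lam => ‖coeffFun f (lam, k)‖ₑ ^ 2)
    fun k => (hk.comp measurable_prodMk_right).aemeasurable, ← lintegral_partialFourier hm h1 h2]
  refine lintegral_congr_ae ?_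
  have hpm : Measurable (fun lam => ∫⁻ p, ∫⁻ s, ‖partialFourier f lam p s‖ₑ ^ 2) := by
    have h0 := (measurable_partialFourier hm).enorm.pow_const 2
    refine Measurable.lintegral_prod_right'
      (f := fun w : ℝ × ℝ => ∫⁻ s, ‖partialFourier f w.1 w.2 s‖ₑ ^ 2) ?_
    refine Measurable.lintegral_prod_right'
      (f := fun w : (ℝ × ℝ) × ℝ => ‖partialFourier f w.1.1 w.1.2 w.2‖ₑ ^ 2) ?_
    exact Measurable.comp (g := fun z : ℝ × ℝ × ℝ => ‖partialFourier f z.1 z.2.1 z.2.2‖ₑ ^ 2)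
      (f := fun w : (ℝ × ℝ) × ℝ => (w.1.1, w.1.2, w.2)) h0 (by fun_prop)
  have hfin := ae_lt_top hpm (by
    rw [lintegral_partialFourier hm h1 h2]; exact (lintegral_enorm_sq_lt_top h2).ne)
  have hne : ∀ᵐ lam : ℝ, lam ≠ 0 := by simp [ae_iff, measure_singleton]
  filter_upwards [hfin, hne] with lam hl h0
  rw [← tsum_enorm_sq_groupFourier (hermiteBasis h0) (hermiteBasis h0) hm h1 h0 hl]
  simp_rw [hermiteBasis_apply, inner_schrodinger_dilatedHermite h0]
  simp only [coeffFun, enorm_mul, mul_pow, enorm_sqrt_abs_sq]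
  rw [ENNReal.tsum_mul_left, ENNReal.tsum_prod', ENNReal.tsum_comm]

theorem integrable_mul_matCoeff {f : Heisenberg → ℂ} (hf : Integrable f) (m n : ℕ) (lam : ℝ) :
    Integrable (fun x => f x * matCoeff m n lam x) :=
  hf.mul_bdd (Measurable.comp (g := fun z : ℝ × Heisenberg => matCoeff m n z.1 z.2)
    (measurable_matCoeff m n) measurable_prodMk_left).aestronglyMeasurable
    (Eventually.of_forall fun x => norm_matCoeff_le m n lam x)

theorem memLp_coeffFun {f : Heisenberg → ℂ} (hm : Measurable f) (h1 : Integrable f)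
    (h2 : MemLp f 2) : MemLp (coeffFun f) 2 coeffMeasure :=
  memLp_two_of_lintegral_lt_top (measurable_coeffFun hm).aestronglyMeasurable (by
    rw [lintegral_enorm_sq_coeffFun hm h1 h2]; exact lintegral_enorm_sq_lt_top h2)

/-- The subspace `L¹ ∩ L²` of `L²(ℍ)`. -/
def integrableSubmodule : Submodule ℂ L2H where
  carrier := {u | Integrable u}
  add_mem' := by
    intro u v hu hv
    exact (Integrable.add hu hv).congr (Lp.coeFn_add u v).symm
  zero_mem' := (integrable_zero _ _ _).congr (Lp.coeFn_zero ℂ 2 volume).symm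
  smul_mem' := by
    intro c u hu
    exact (Integrable.smul c hu).congr (Lp.coeFn_smul c u).symm

theorem denseRange_integrableSubmodule :
    DenseRange (integrableSubmodule.subtype : integrableSubmodule →ₗ[ℂ] L2H) := by
  refine (Lp.simpleFunc.denseRange (E := ℂ) (μ := (volume : Measure Heisenberg)) (p := 2)
    (by norm_num)).mono ?_
  rintro _ ⟨u, rfl⟩
  refine ⟨⟨u, ?_⟩, rfl⟩
  have h1 := Lp.simpleFunc.memLp u
  rw [SimpleFunc.memLp_iff_integrable (by norm_num) (by norm_num)] at h1
  exact h1.congr (Lp.simpleFunc.toSimpleFunc_eq_toFun u)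

/-- The coefficient transform on `L¹ ∩ L²`. -/
def coeffLinear : integrableSubmodule →ₗ[ℂ] L2X where
  toFun u := (memLp_coeffFun (Lp.stronglyMeasurable (u : L2H)).measurable u.2
    (Lp.memLp (u : L2H))).toLp _
  map_add' u v := by
    rw [← MemLp.toLp_add, MemLp.toLp_eq_toLp_iff]
    refine Eventually.of_forall fun z => ?_
    have hu : Integrable (u : L2H) := u.2
    have hv : Integrable (v : L2H) := v.2
    simp only [coeffFun, Pi.add_apply]
    rw [← mul_add, ← integral_add (integrable_mul_matCoeff hu _ _ _)
      (integrable_mul_matCoeff hv _ _ _)]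
    congr 1
    refine integral_congr_ae ?_
    filter_upwards [Lp.coeFn_add (u : L2H) (v : L2H)] with x hx
    rw [← add_mul]
    exact congrArg (· * _) hx
  map_smul' c u := by
    rw [RingHom.id_apply, ← MemLp.toLp_const_smul, MemLp.toLp_eq_toLp_iff]
    refine Eventually.of_forall fun z => ?_
    simp only [coeffFun, Pi.smul_apply, smul_eq_mul]
    rw [mul_left_comm]
    congr 1
    rw [← integral_const_mul]
    refine integral_congr_ae ?_
    filter_upwards [Lp.coeFn_smul c (u : L2H)] with x hx
    rw [← mul_assoc]
    exact congrArg (· * _) hx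

theorem norm_coeffLinear (u : integrableSubmodule) : ‖coeffLinear u‖ = ‖(u : L2H)‖ := by
  have hm := (Lp.stronglyMeasurable (u : L2H)).measurable
  have h := memLp_coeffFun hm u.2 (Lp.memLp (u : L2H))
  have h1 : ‖coeffLinear u‖ₑ ^ 2 = ‖(u : L2H)‖ₑ ^ 2 := by
    rw [← lintegral_enorm_sq_eq, ← lintegral_enorm_sq_eq,
      ← lintegral_enorm_sq_coeffFun hm u.2 (Lp.memLp (u : L2H))]
    refine lintegral_congr_ae ?_
    filter_upwards [h.coeFn_toLp] with z hz
    rw [← hz]; rfl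
  rw [← ofReal_norm, ← ofReal_norm, ← ENNReal.ofReal_pow (norm_nonneg _),
    ← ENNReal.ofReal_pow (norm_nonneg _),
    ENNReal.ofReal_eq_ofReal_iff (by positivity) (by positivity)] at h1
  exact (sq_eq_sq₀ (norm_nonneg _) (norm_nonneg _)).1 h1

/-- The coefficient transform `L²(ℍ) → L²(ℝ × ℕ × ℕ)`, the continuous extension of `coeffFun`. -/
def coeffTransform : L2H →ₗᵢ[ℂ] L2X where
  toLinearMap := (coeffLinear.extendOfNorm integrableSubmodule.subtype).toLinearMap
  norm_map' u := by
    refine denseRange_integrableSubmodule.induction_on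
      (p := fun u => ‖coeffLinear.extendOfNorm integrableSubmodule.subtype u‖ = ‖u‖) u
      (isClosed_eq (by fun_prop) (by fun_prop)) fun v => ?_
    rw [LinearMap.extendOfNorm_eq denseRange_integrableSubmodule
      ⟨1, fun v => by rw [one_mul, norm_coeffLinear]; rfl⟩, norm_coeffLinear]
    rfl

theorem coeffTransform_ae_eq {u : L2H} (hu : Integrable u) :
    coeffTransform u =ᵐ[coeffMeasure] coeffFun u := by
  have h1 : coeffTransform u = coeffLinear ⟨u, hu⟩ :=
    LinearMap.extendOfNorm_eq denseRange_integrableSubmodule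
      ⟨1, fun v => by rw [one_mul, norm_coeffLinear]; rfl⟩ (⟨u, hu⟩ : integrableSubmodule)
  rw [h1]
  exact (memLp_coeffFun (Lp.stronglyMeasurable u).measurable hu (Lp.memLp u)).coeFn_toLp

/-! ### Elementary functions and surjectivity of the coefficient transform -/

theorem MeasureTheory.Integrable.memLp_two_of_bounded {c : ℝ → ℂ} (hc : Integrable c) {C : ℝ}
    (hC : ∀ x, ‖c x‖ ≤ C) : MemLp c 2 (volume : Measure ℝ) := by
  refine memLp_two_of_lintegral_lt_top hc.1 ?_
  have h1 := hc.2
  rw [hasFiniteIntegral_iff_enorm] at h1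
  have h2 : ∀ x, ‖c x‖ₑ ^ 2 ≤ ENNReal.ofReal C * ‖c x‖ₑ := by
    intro x
    rw [sq]
    gcongr
    rw [← ofReal_norm]
    exact ENNReal.ofReal_le_ofReal (hC x)
  refine (lintegral_mono h2).trans_lt ?_
  rw [lintegral_const_mul' _ _ ENNReal.ofReal_ne_top]
  exact ENNReal.mul_lt_top ENNReal.ofReal_lt_top h1

/-- Bounded measurable functions of bounded support on the line. -/
structure IsCutoffFun (c : ℝ → ℂ) : Prop where
  measurable : Measurable c
  bound : ∃ C, ∀ lam, ‖c lam‖ ≤ C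
  support : ∃ R, ∀ lam, R < |lam| → c lam = 0

namespace IsCutoffFun

theorem mul {c w : ℝ → ℂ} (hc : IsCutoffFun c) (hw : Measurable w)
    (hb : ∀ R, ∃ C, ∀ lam, |lam| ≤ R → ‖w lam‖ ≤ C) : IsCutoffFun (fun lam => w lam * c lam) := by
  obtain ⟨C, hC⟩ := hc.bound
  obtain ⟨R, hR⟩ := hc.support
  obtain ⟨D, hD⟩ := hb R
  refine ⟨hw.mul hc.measurable, ⟨max (D * C) 0, fun lam => ?_⟩, R, fun lam h => by simp [hR lam h]⟩
  rcases le_or_gt |lam| R with h | h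
  · rw [norm_mul]
    exact (mul_le_mul (hD lam h) (hC lam) (norm_nonneg _)
      ((norm_nonneg _).trans (hD lam h))).trans (le_max_left _ _)
  · simp [hR lam h]

theorem mul_continuous {c w : ℝ → ℂ} (hc : IsCutoffFun c) (hw : Continuous w) :
    IsCutoffFun (fun lam => w lam * c lam) := by
  refine hc.mul hw.measurable fun R => ?_
  obtain ⟨C, hC⟩ := (isCompact_closedBall (0 : ℝ) R).exists_bound_of_continuousOn hw.continuousOn
  exact ⟨C, fun lam h => hC lam (by simpa using h)⟩

theorem integrable {c : ℝ → ℂ} (hc : IsCutoffFun c) : Integrable c := by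
  obtain ⟨C, hC⟩ := hc.bound
  obtain ⟨R, hR⟩ := hc.support
  have h1 : IntegrableOn c (Set.Icc (-R) R) :=
    Measure.integrableOn_of_bounded (by simp) hc.measurable.aestronglyMeasurable
      (Eventually.of_forall hC)
  refine (integrableOn_iff_integrable_of_support_subset ?_).1 h1
  intro lam hlam
  by_contra h2
  refine hlam (hR lam ?_)
  rw [lt_abs]
  by_contra! h3
  exact h2 ⟨by linarith [h3.2], h3.1⟩

theorem memLp {c : ℝ → ℂ} (hc : IsCutoffFun c) : MemLp c 2 (volume : Measure ℝ) := by
  obtain ⟨C, hC⟩ := hc.bound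
  exact hc.integrable.memLp_two_of_bounded hC

theorem conj {c : ℝ → ℂ} (hc : IsCutoffFun c) :
    IsCutoffFun (fun lam => (starRingEnd ℂ) (c lam)) := by
  obtain ⟨C, hC⟩ := hc.bound
  obtain ⟨R, hR⟩ := hc.support
  exact ⟨Complex.continuous_conj.measurable.comp hc.measurable, ⟨C, by simpa using hC⟩, R,
    fun lam h => by simp [hR lam h]⟩

theorem sqrt_mul {c : ℝ → ℂ} (hc : IsCutoffFun c) :
    IsCutoffFun (fun lam => ((√|lam| : ℝ) : ℂ) * c lam) := hc.mul_continuous (by fun_prop)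

end IsCutoffFun

/-- The function on `ℝ × ℕ × ℕ` equal to `c` on the sheet `(m, n)` and to zero elsewhere. -/
def sheetFun (m n : ℕ) (c : ℝ → ℂ) (z : ℝ × ℕ × ℕ) : ℂ := if z.2 = (m, n) then c z.1 else 0

/-- The inverse coefficient transform `x ↦ ∫ c(λ) √|λ| conj ⟨h_{m,λ}, ρ_λ(x) h_{n,λ}⟩ dλ`
of `sheetFun m n c`. -/
def wavePacket (m n : ℕ) (c : ℝ → ℂ) (x : Heisenberg) : ℂ :=
  ∫ lam, ((√|lam| : ℝ) : ℂ) * c lam * (starRingEnd ℂ) (matCoeff m n lam x)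

theorem integral_coeffMeasure_sheet (k : ℕ × ℕ) {F : ℝ × ℕ × ℕ → ℂ}
    (hF : ∀ z, z.2 ≠ k → F z = 0) : ∫ z, F z ∂coeffMeasure = ∫ lam, F (lam, k) := by
  have h1 : ∫ z, F z ∂coeffMeasure = ∫ z in Set.univ ×ˢ {k}, F z ∂coeffMeasure := by
    refine (setIntegral_eq_integral_of_forall_compl_eq_zero fun z hz => hF z ?_).symm
    simpa using hz
  rw [h1, coeffMeasure, ← Measure.prod_restrict, Measure.restrict_univ,
    Measure.restrict_singleton, Measure.count_singleton, one_smul, Measure.prod_dirac,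
    (measurableEmbedding_prod_mk_right k).integral_map]

theorem lintegral_coeffMeasure_sheet (k : ℕ × ℕ) {F : ℝ × ℕ × ℕ → ℝ≥0∞} (hm : Measurable F)
    (hF : ∀ z, z.2 ≠ k → F z = 0) : ∫⁻ z, F z ∂coeffMeasure = ∫⁻ lam, F (lam, k) := by
  rw [lintegral_coeffMeasure hm]
  exact tsum_eq_single k fun k' hk' => by simp [hF (_, k') hk']

theorem measurable_sheetFun (m n : ℕ) {c : ℝ → ℂ} (hc : Measurable c) :
    Measurable (sheetFun m n c) := by
  refine measurable_from_prod_countable_left fun k => ?_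
  by_cases h : k = (m, n)
  · simpa [sheetFun, h] using hc
  · simp [sheetFun, h]

theorem lintegral_sheetFun (m n : ℕ) {c : ℝ → ℂ} (hc : Measurable c) :
    ∫⁻ z, ‖sheetFun m n c z‖ₑ ^ 2 ∂coeffMeasure = ∫⁻ lam, ‖c lam‖ₑ ^ 2 := by
  rw [lintegral_coeffMeasure_sheet (m, n) ((measurable_sheetFun m n hc).enorm.pow_const 2)
    fun z hz => by simp [sheetFun, hz]]
  simp [sheetFun]

theorem memLp_sheetFun (m n : ℕ) {c : ℝ → ℂ} (hc : IsCutoffFun c) :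
    MemLp (sheetFun m n c) 2 coeffMeasure :=
  memLp_two_of_lintegral_lt_top (measurable_sheetFun m n hc.measurable).aestronglyMeasurable (by
    rw [lintegral_sheetFun m n hc.measurable]; exact lintegral_enorm_sq_lt_top hc.memLp)

/-- `sheetFun` as an element of `L²`. -/
def sheet (m n : ℕ) {c : ℝ → ℂ} (hc : IsCutoffFun c) : L2X := (memLp_sheetFun m n hc).toLp _

theorem inner_sheet (m n : ℕ) {c : ℝ → ℂ} (hc : IsCutoffFun c) {u : L2X} {g : ℝ × ℕ × ℕ → ℂ}
    (hu : u =ᵐ[coeffMeasure] g) :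
    inner ℂ (sheet m n hc) u = ∫ lam, (starRingEnd ℂ) (c lam) * g (lam, (m, n)) := by
  rw [inner_L2_eq, integral_congr_ae (g := fun z => (starRingEnd ℂ) (sheetFun m n c z) * g z),
    integral_coeffMeasure_sheet (m, n) fun z hz => by simp [sheetFun, hz]]
  · simp [sheetFun]
  · filter_upwards [(memLp_sheetFun m n hc).coeFn_toLp, hu] with z h1 h2
    rw [sheet, h1, h2]

/-- A function orthogonal to all cutoff functions on all sheets vanishes. -/
theorem ae_eq_zero_of_sheets {g : ℝ × ℕ × ℕ → ℂ} (hg : Measurable g)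
    (h : ∀ m n c, IsCutoffFun c → ∫ lam, (starRingEnd ℂ) (c lam) * g (lam, (m, n)) = 0) :
    g =ᵐ[coeffMeasure] 0 := by
  refine ae_coeffMeasure_iff.2 ?_
  rw [ae_all_iff]
  rintro ⟨m, n⟩
  have hgk : Measurable (fun lam => g (lam, (m, n))) := hg.comp measurable_prodMk_right
  have key : ∀ R : ℕ, ∀ᵐ lam : ℝ, |lam| ≤ R → ‖g (lam, (m, n))‖ ≤ R → g (lam, (m, n)) = 0 := by
    intro R
    set S : Set ℝ := {lam | |lam| ≤ R ∧ ‖g (lam, (m, n))‖ ≤ R} with hS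
    have hSm : MeasurableSet S :=
      (measurableSet_le (f := fun lam : ℝ => |lam|) (by fun_prop) measurable_const).inter
        (measurableSet_le hgk.norm measurable_const)
    -- test against `g` itself, truncated to `|λ| ≤ R` and `|g| ≤ R`
    have hc : IsCutoffFun (S.indicator fun lam => g (lam, (m, n))) := by
      refine ⟨hgk.indicator hSm, ⟨R, fun lam => ?_⟩, R, fun lam hl => ?_⟩
      · by_cases hl : lam ∈ S
        · rw [Set.indicator_of_mem hl]; exact hl.2
        · rw [Set.indicator_of_notMem hl, norm_zero]; positivity
      · exact Set.indicator_of_notMem (fun h => absurd h.1 (not_le.2 hl)) _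
    have h1 := h m n _ hc
    have h2 : ∀ lam, (starRingEnd ℂ) (S.indicator (fun lam => g (lam, (m, n))) lam) *
        g (lam, (m, n)) = ((‖S.indicator (fun lam => g (lam, (m, n))) lam‖ ^ 2 : ℝ) : ℂ) := by
      intro lam
      by_cases hl : lam ∈ S
      · rw [Set.indicator_of_mem hl, ← Complex.normSq_eq_conj_mul_self, Complex.normSq_eq_norm_sq]
      · simp [Set.indicator_of_notMem hl]
    simp_rw [h2] at h1
    rw [integral_complex_ofReal, Complex.ofReal_eq_zero, integral_eq_zero_iff_of_nonneg
      (fun _ => by positivity) ((memLp_two_iff_integrable_sq_norm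
        hc.measurable.aestronglyMeasurable).1 hc.memLp)] at h1
    filter_upwards [h1] with lam hl h3 h4
    have h5 : lam ∈ S := ⟨h3, h4⟩
    simpa [Set.indicator_of_mem h5] using hl
  filter_upwards [ae_all_iff.2 key] with lam hl
  obtain ⟨R, hR⟩ := exists_nat_ge (max |lam| ‖g (lam, (m, n))‖)
  exact hl R ((le_max_left _ _).trans hR) ((le_max_right _ _).trans hR)

theorem measurable_wavePacket (m n : ℕ) {c : ℝ → ℂ} (hc : Measurable c) :
    Measurable (wavePacket m n c) := by
  refine StronglyMeasurable.measurable ?_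
  refine StronglyMeasurable.integral_prod_right (f := fun (x : Heisenberg) (lam : ℝ) =>
    ((√|lam| : ℝ) : ℂ) * c lam * (starRingEnd ℂ) (matCoeff m n lam x))
    (Measurable.stronglyMeasurable ?_)
  refine Measurable.mul (Measurable.mul (by fun_prop) (hc.comp measurable_snd)) ?_
  exact Complex.continuous_conj.measurable.comp (Measurable.comp
    (g := fun z : ℝ × Heisenberg => matCoeff m n z.1 z.2)
    (f := fun w : Heisenberg × ℝ => (w.2, w.1))
    (measurable_matCoeff m n) measurable_swap)

theorem lintegral_hermiteFun_sq (n : ℕ) : ∫⁻ x, ‖hermiteFun n x‖ₑ ^ 2 = 1 := by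
  have h1 := lintegral_enorm_sq_eq (dilatedHermite n 1)
  rw [← ofReal_norm, norm_dilatedHermite one_ne_zero, ENNReal.ofReal_one, one_pow] at h1
  rw [← h1]
  refine lintegral_congr_ae ?_
  filter_upwards [coeFn_dilatedHermite n 1] with x hx
  rw [hx, dilatedHermiteFun_eq]
  simp [← ofReal_norm]

/-- The Fourier-Wigner transform of two unit vectors has norm one: apply the Plancherel theorem in
`b`, then integrate over `a`. -/
theorem lintegral_wignerFun (m n : ℕ) : ∫⁻ a, ∫⁻ b, ‖wignerFun m n a b‖ₑ ^ 2 = 1 := by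
  have hcont := continuous_hermiteFun
  have e1 : ∀ a, ∫⁻ b, ‖wignerFun m n a b‖ₑ ^ 2
      = ∫⁻ u, ‖hermiteFun m (u + a)‖ₑ ^ 2 * ‖hermiteFun n u‖ₑ ^ 2 := by
    intro a
    have hI : Integrable
        (fun u => ((hermiteFun m (u + a / 2) * hermiteFun n (u - a / 2) : ℝ) : ℂ)) := by
      refine Integrable.ofReal ?_
      obtain ⟨C, -, hC⟩ := exists_le_hermiteFun n
      refine ((integrable_hermiteFun m).comp_add_right (a / 2)).mul_bdd (c := C)
        (by have := hcont n; fun_prop) (Eventually.of_forall fun u => ?_)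
      exact hC _
    have hL : MemLp
        (fun u => ((hermiteFun m (u + a / 2) * hermiteFun n (u - a / 2) : ℝ) : ℂ)) 2 := by
      obtain ⟨C, hC0, hC⟩ := exists_le_hermiteFun m
      obtain ⟨D, -, hD⟩ := exists_le_hermiteFun n
      refine hI.memLp_two_of_bounded (C := C * D) fun u => ?_
      rw [Complex.norm_real, Real.norm_eq_abs, abs_mul]
      exact mul_le_mul (hC _) (hD _) (abs_nonneg _) hC0
    have h1 := lintegral_enorm_sq_integral_modulation hI hL
    simp only [wignerFun, mul_comm _ (modulationFun _ _)]
    rw [h1, ← lintegral_add_right_eq_self (μ := (volume : Measure ℝ)) _ (a / 2)]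
    refine lintegral_congr fun u => ?_
    rw [add_sub_cancel_right, add_assoc, add_halves, ← mul_pow, ← enorm_mul]
    simp [← ofReal_norm]
  simp_rw [e1]
  have hm : Measurable
      (fun w : ℝ × ℝ => ‖hermiteFun m (w.2 + w.1)‖ₑ ^ 2 * ‖hermiteFun n w.2‖ₑ ^ 2) := by
    have := (hcont m).measurable
    have := (hcont n).measurable
    fun_prop
  rw [lintegral_lintegral_swap hm.aemeasurable]
  have e2 : ∀ u, ∫⁻ a, ‖hermiteFun m (u + a)‖ₑ ^ 2 * ‖hermiteFun n u‖ₑ ^ 2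
      = ‖hermiteFun n u‖ₑ ^ 2 := by
    intro u
    rw [lintegral_mul_const' _ _ (ENNReal.pow_ne_top enorm_ne_top),
      lintegral_add_left_eq_self (μ := (volume : Measure ℝ)) (fun y => ‖hermiteFun m y‖ₑ ^ 2) u,
      lintegral_hermiteFun_sq, one_mul]
  simp_rw [e2]
  exact lintegral_hermiteFun_sq n

theorem lintegral_wignerFun_scaled (m n : ℕ) {lam : ℝ} (hlam : lam ≠ 0) :
    ‖lam‖ₑ * ∫⁻ p, ∫⁻ q, ‖wignerFun m n (lam / √|lam| * p) (√|lam| * q)‖ₑ ^ 2 = 1 := by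
  have hr : 0 < √|lam| := Real.sqrt_pos.2 (abs_pos.2 hlam)
  have hs : lam / √|lam| ≠ 0 := div_ne_zero hlam hr.ne'
  have h1 : |(lam / √|lam| : ℝ)| = √|lam| := by
    rw [abs_div, abs_of_pos hr, Real.div_sqrt]
  have h2 : ‖lam‖ₑ = ENNReal.ofReal |(lam / √|lam| : ℝ)| * ENNReal.ofReal |(√|lam| : ℝ)| := by
    rw [h1, abs_of_pos hr, ← ENNReal.ofReal_mul hr.le, Real.mul_self_sqrt (abs_nonneg _),
      ← Real.norm_eq_abs, ofReal_norm]
  have hm := (measurable_wignerFun m n).enorm.pow_const 2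
  have h3 : ∀ p, ENNReal.ofReal |(√|lam| : ℝ)| *
      ∫⁻ q, ‖wignerFun m n (lam / √|lam| * p) (√|lam| * q)‖ₑ ^ 2
      = ∫⁻ b, ‖wignerFun m n (lam / √|lam| * p) b‖ₑ ^ 2 := fun p =>
    lintegral_comp_mul_left (f := fun b => ‖wignerFun m n (lam / √|lam| * p) b‖ₑ ^ 2)
      (Measurable.comp (g := fun z : ℝ × ℝ => ‖wignerFun m n z.1 z.2‖ₑ ^ 2)
        (f := fun b => (lam / √|lam| * p, b)) hm measurable_prodMk_left) hr.ne'
  rw [h2, mul_assoc, ← lintegral_const_mul' _ _ ENNReal.ofReal_ne_top]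
  simp_rw [h3]
  have h4 : Measurable (fun a => ∫⁻ b, ‖wignerFun m n a b‖ₑ ^ 2) :=
    Measurable.lintegral_prod_right' (f := fun w : ℝ × ℝ => ‖wignerFun m n w.1 w.2‖ₑ ^ 2) hm
  rw [← lintegral_wignerFun m n]
  exact lintegral_comp_mul_left (f := fun a => ∫⁻ b, ‖wignerFun m n a b‖ₑ ^ 2) h4 hs

theorem wavePacket_eq (m n : ℕ) (c : ℝ → ℂ) (p q t : ℝ) :
    wavePacket m n c (Heisenberg.mk p q t) = ∫ lam, modulationFun t lam *
      (((√|lam| : ℝ) : ℂ) * c lam *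
        (starRingEnd ℂ) (wignerFun m n (lam / √|lam| * p) (√|lam| * q))) := by
  refine integral_congr_ae (Eventually.of_forall fun lam => ?_)
  simp only [matCoeff, map_mul, conj_modulationFun, neg_neg, Heisenberg.mk_p, Heisenberg.mk_q,
    Heisenberg.mk_t]
  rw [modulationFun_comm]; ring

/-- The norm of a wave packet: the Plancherel theorem in `t` leaves, for each `λ`, the scaled
Fourier-Wigner transform, whose norm is computed by `lintegral_wignerFun_scaled`. -/
theorem lintegral_wavePacket (m n : ℕ) {c : ℝ → ℂ} (hc : IsCutoffFun c) :
    ∫⁻ x, ‖wavePacket m n c x‖ₑ ^ 2 = ∫⁻ lam, ‖c lam‖ₑ ^ 2 := by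
  rw [Heisenberg.lintegral_eq ((measurable_wavePacket m n hc.measurable).enorm.pow_const 2)]
  have hWm : Measurable (fun w : (ℝ × ℝ) × ℝ =>
      wignerFun m n (w.2 / √|w.2| * w.1.1) (√|w.2| * w.1.2)) :=
    Measurable.comp (g := fun z : ℝ × ℝ => wignerFun m n z.1 z.2)
      (f := fun w : (ℝ × ℝ) × ℝ => (w.2 / √|w.2| * w.1.1, √|w.2| * w.1.2))
      (measurable_wignerFun m n) (by fun_prop)
  have e1 : ∀ p q, ∫⁻ t, ‖wavePacket m n c (Heisenberg.mk p q t)‖ₑ ^ 2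
      = ∫⁻ lam, ‖lam‖ₑ * ‖c lam‖ₑ ^ 2 *
          ‖wignerFun m n (lam / √|lam| * p) (√|lam| * q)‖ₑ ^ 2 := by
    intro p q
    have hW1 : Measurable (fun lam : ℝ => (starRingEnd ℂ)
        (wignerFun m n (lam / √|lam| * p) (√|lam| * q))) :=
      Complex.continuous_conj.measurable.comp (Measurable.comp (g := fun w : (ℝ × ℝ) × ℝ =>
        wignerFun m n (w.2 / √|w.2| * w.1.1) (√|w.2| * w.1.2)) (f := fun lam => ((p, q), lam))
        hWm measurable_prodMk_left)
    have hcut := hc.sqrt_mul.mul hW1 fun R => ⟨1, fun lam _ => by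
      rw [RCLike.norm_conj]; exact norm_wignerFun_le _ _ _ _⟩
    simp_rw [wavePacket_eq, mul_comm _ ((starRingEnd ℂ) _)]
    rw [lintegral_enorm_sq_integral_modulation hcut.integrable hcut.memLp]
    refine lintegral_congr fun lam => ?_
    rw [enorm_mul, enorm_mul, mul_pow, mul_pow, enorm_sqrt_abs_sq, RCLike.enorm_conj]
    ring
  simp_rw [e1]
  have hm : Measurable (fun w : (ℝ × ℝ) × ℝ => ‖w.2‖ₑ * ‖c w.2‖ₑ ^ 2 *
      ‖wignerFun m n (w.2 / √|w.2| * w.1.1) (√|w.2| * w.1.2)‖ₑ ^ 2) := by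
    have := hc.measurable
    refine Measurable.mul (by fun_prop) (hWm.enorm.pow_const 2)
  have e2 : ∀ p, ∫⁻ q, ∫⁻ lam, ‖lam‖ₑ * ‖c lam‖ₑ ^ 2 *
          ‖wignerFun m n (lam / √|lam| * p) (√|lam| * q)‖ₑ ^ 2
      = ∫⁻ lam, ∫⁻ q, ‖lam‖ₑ * ‖c lam‖ₑ ^ 2 *
          ‖wignerFun m n (lam / √|lam| * p) (√|lam| * q)‖ₑ ^ 2 := fun p =>
    lintegral_lintegral_swap (Measurable.comp (g := fun w : (ℝ × ℝ) × ℝ => ‖w.2‖ₑ * ‖c w.2‖ₑ ^ 2 *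
      ‖wignerFun m n (w.2 / √|w.2| * w.1.1) (√|w.2| * w.1.2)‖ₑ ^ 2)
      (f := fun w : ℝ × ℝ => ((p, w.1), w.2)) hm (by fun_prop)).aemeasurable
  simp_rw [e2]
  have hm2 : Measurable (fun w : ℝ × ℝ => ∫⁻ q, ‖w.2‖ₑ * ‖c w.2‖ₑ ^ 2 *
      ‖wignerFun m n (w.2 / √|w.2| * w.1) (√|w.2| * q)‖ₑ ^ 2) :=
    Measurable.lintegral_prod_right' (f := fun v : (ℝ × ℝ) × ℝ => ‖v.1.2‖ₑ * ‖c v.1.2‖ₑ ^ 2 *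
      ‖wignerFun m n (v.1.2 / √|v.1.2| * v.1.1) (√|v.1.2| * v.2)‖ₑ ^ 2)
      (Measurable.comp (g := fun w : (ℝ × ℝ) × ℝ => ‖w.2‖ₑ * ‖c w.2‖ₑ ^ 2 *
      ‖wignerFun m n (w.2 / √|w.2| * w.1.1) (√|w.2| * w.1.2)‖ₑ ^ 2)
      (f := fun v : (ℝ × ℝ) × ℝ => ((v.1.1, v.2), v.1.2)) hm (by fun_prop))
  rw [lintegral_lintegral_swap hm2.aemeasurable]
  have hne : ∀ᵐ lam : ℝ, lam ≠ 0 := by simp [ae_iff, measure_singleton]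
  refine lintegral_congr_ae ?_
  filter_upwards [hne] with lam hlam
  have hfin : ‖lam‖ₑ * ‖c lam‖ₑ ^ 2 ≠ ⊤ :=
    ENNReal.mul_ne_top enorm_ne_top (ENNReal.pow_ne_top enorm_ne_top)
  simp_rw [lintegral_const_mul' _ _ hfin]
  rw [mul_comm ‖lam‖ₑ, mul_assoc, lintegral_wignerFun_scaled m n hlam, mul_one]

theorem memLp_wavePacket (m n : ℕ) {c : ℝ → ℂ} (hc : IsCutoffFun c) :
    MemLp (wavePacket m n c) 2 (volume : Measure Heisenberg) :=
  memLp_two_of_lintegral_lt_top (measurable_wavePacket m n hc.measurable).aestronglyMeasurable (by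
    rw [lintegral_wavePacket m n hc]; exact lintegral_enorm_sq_lt_top hc.memLp)

/-- `wavePacket` as an element of `L²(ℍ)`. -/
def packet (m n : ℕ) {c : ℝ → ℂ} (hc : IsCutoffFun c) : L2H := (memLp_wavePacket m n hc).toLp _

theorem norm_packet (m n : ℕ) {c : ℝ → ℂ} (hc : IsCutoffFun c) :
    ‖packet m n hc‖ = ‖sheet m n hc‖ := by
  have h1 : ‖packet m n hc‖ₑ ^ 2 = ‖sheet m n hc‖ₑ ^ 2 := by
    rw [← lintegral_enorm_sq_eq, ← lintegral_enorm_sq_eq]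
    rw [lintegral_congr_ae (g := fun x => ‖wavePacket m n c x‖ₑ ^ 2) ?_,
      lintegral_wavePacket m n hc, ← lintegral_sheetFun m n hc.measurable]
    · refine lintegral_congr_ae ?_
      filter_upwards [(memLp_sheetFun m n hc).coeFn_toLp] with z hz
      rw [sheet, hz]
    · filter_upwards [(memLp_wavePacket m n hc).coeFn_toLp] with z hz
      rw [packet, hz]
  rw [← ofReal_norm, ← ofReal_norm, ← ENNReal.ofReal_pow (norm_nonneg _),
    ← ENNReal.ofReal_pow (norm_nonneg _),
    ENNReal.ofReal_eq_ofReal_iff (by positivity) (by positivity)] at h1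
  exact (sq_eq_sq₀ (norm_nonneg _) (norm_nonneg _)).1 h1

theorem inner_packet_of_integrable (m n : ℕ) {c : ℝ → ℂ} (hc : IsCutoffFun c) {f : L2H}
    (hf : Integrable f) :
    inner ℂ (packet m n hc) f = inner ℂ (sheet m n hc) (coeffTransform f) := by
  rw [inner_sheet m n hc (coeffTransform_ae_eq hf), inner_L2_eq]
  have hmat : Measurable (fun z : ℝ × Heisenberg => matCoeff m n z.1 z.2) := measurable_matCoeff m n
  have hI : Integrable (Function.uncurry fun (lam : ℝ) (x : Heisenberg) =>
      (starRingEnd ℂ) (((√|lam| : ℝ) : ℂ) * c lam) * f x * matCoeff m n lam x)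
      ((volume : Measure ℝ).prod (volume : Measure Heisenberg)) := by
    refine (hc.sqrt_mul.conj.integrable.mul_prod hf).mul_bdd (c := 1) hmat.aestronglyMeasurable ?_
    exact Eventually.of_forall fun z => norm_matCoeff_le _ _ _ _
  have h1 : ∀ᵐ x : Heisenberg, (starRingEnd ℂ) (packet m n hc x) * f x
      = ∫ lam, (starRingEnd ℂ) (((√|lam| : ℝ) : ℂ) * c lam) * f x * matCoeff m n lam x := by
    filter_upwards [(memLp_wavePacket m n hc).coeFn_toLp] with x hx
    rw [packet, hx, wavePacket, ← integral_conj, ← integral_mul_const]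
    refine integral_congr_ae (Eventually.of_forall fun lam => ?_)
    simp only [map_mul, Complex.conj_conj]
    ring
  rw [integral_congr_ae h1, ← integral_integral_swap hI]
  refine integral_congr_ae (Eventually.of_forall fun lam => ?_)
  simp only [coeffFun, map_mul, Complex.conj_ofReal]
  rw [← mul_assoc, ← integral_const_mul]
  refine integral_congr_ae (Eventually.of_forall fun x => ?_)
  ring

theorem inner_packet (m n : ℕ) {c : ℝ → ℂ} (hc : IsCutoffFun c) (f : L2H) :
    inner ℂ (packet m n hc) f = inner ℂ (sheet m n hc) (coeffTransform f) := by
  refine denseRange_integrableSubmodule.induction_on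
    (p := fun f => inner ℂ (packet m n hc) f = inner ℂ (sheet m n hc) (coeffTransform f)) f
    (isClosed_eq (by fun_prop) ?_) fun v => inner_packet_of_integrable m n hc v.2
  exact continuous_const.inner coeffTransform.continuous

/-- The coefficient transform of a wave packet is the elementary function it is built from: the
adjoint of the transform maps the one to the other, and both have the same norm. -/
theorem coeffTransform_packet (m n : ℕ) {c : ℝ → ℂ} (hc : IsCutoffFun c) :
    coeffTransform (packet m n hc) = sheet m n hc := by
  have h1 := inner_packet m n hc (packet m n hc)
  rw [inner_self_eq_ofReal_norm_sq] at h1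
  rw [← sub_eq_zero, ← norm_eq_zero, ← sq_eq_zero_iff, @norm_sub_sq ℂ, coeffTransform.norm_map,
    ← norm_packet, ← inner_re_symm, ← h1]
  norm_cast
  simp only [RCLike.re_to_complex, Complex.ofReal_re]
  ring

/-- The range is closed, and a function orthogonal to the transforms of all wave packets
vanishes. -/
theorem coeffTransform_surjective : Function.Surjective coeffTransform := by
  have hcl : IsClosed (LinearMap.range coeffTransform.toLinearMap : Set L2X) :=
    coeffTransform.isometry.isClosedEmbedding.isClosed_range
  have : CompleteSpace (LinearMap.range coeffTransform.toLinearMap) := hcl.completeSpace_coe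
  have h1 : (LinearMap.range coeffTransform.toLinearMap)ᗮ = ⊥ := by
    rw [Submodule.eq_bot_iff]
    intro u hu
    refine Lp.eq_zero_iff_ae_eq_zero.2 (ae_eq_zero_of_sheets (Lp.stronglyMeasurable u).measurable
      fun m n c hc => ?_)
    rw [← inner_sheet m n hc (EventuallyEq.refl _ _), ← coeffTransform_packet]
    exact (Submodule.mem_orthogonal _ _).1 hu _ ⟨_, rfl⟩
  rw [Submodule.orthogonal_eq_bot_iff] at h1
  exact LinearMap.range_eq_top.1 h1

/-- The coefficient transform as a unitary operator. -/
def coeffEquiv : L2H ≃ₗᵢ[ℂ] L2X :=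
  LinearIsometryEquiv.ofSurjective coeffTransform coeffTransform_surjective

theorem coeffEquiv_ae_eq {u : L2H} (hu : Integrable u) :
    coeffEquiv u =ᵐ[coeffMeasure] coeffFun u := coeffTransform_ae_eq hu

theorem coeffEquiv_packet (m n : ℕ) {c : ℝ → ℂ} (hc : IsCutoffFun c) :
    coeffEquiv (packet m n hc) = sheet m n hc := coeffTransform_packet m n hc

/-! ### Ladder relations for Fourier-Wigner transforms -/

/-- Differentiation under the integral sign, for a derivative with finitely many components. -/
theorem hasFDerivAt_integral_sum {E ι : Type*} [NormedAddCommGroup E] [NormedSpace ℝ E] [Fintype ι]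
    (P : ι → E →L[ℝ] ℝ) {F : E → ℝ → ℂ} {A : ι → E → ℝ → ℂ} {bound : ι → ℝ → ℝ} {x₀ : E} {s : Set E}
    (hs : s ∈ 𝓝 x₀) (hFm : ∀ x, AEStronglyMeasurable (F x)) (hFi : Integrable (F x₀))
    (hA : ∀ i, AEStronglyMeasurable (A i x₀)) (hb : ∀ i, ∀ x ∈ s, ∀ u, ‖A i x u‖ ≤ bound i u)
    (hbi : ∀ i, Integrable (bound i))
    (hd : ∀ u, ∀ x ∈ s, HasFDerivAt (F · u) (∑ i, (P i).smulRight (A i x u)) x) :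
    HasFDerivAt (fun x => ∫ u, F x u) (∑ i, (P i).smulRight (∫ u, A i x₀ u)) x₀ := by
  have hAi : ∀ i, Integrable (A i x₀) := fun i =>
    (hbi i).mono' (hA i) (Eventually.of_forall fun u => hb i x₀ (mem_of_mem_nhds hs) u)
  have hAP : ∀ i, Integrable (fun u => (P i).smulRight (A i x₀ u)) := fun i =>
    ContinuousLinearMap.integrable_comp (φ := A i x₀)
      (ContinuousLinearMap.smulRightL ℝ E ℂ (P i)) (hAi i)
  have hsum : Integrable (fun u => ∑ i, (P i).smulRight (A i x₀ u)) :=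
    integrable_finsetSum (f := fun i u => (P i).smulRight (A i x₀ u)) Finset.univ fun i _ => hAP i
  have hbsum : Integrable (fun u => ∑ i, ‖P i‖ * bound i u) :=
    integrable_finsetSum (f := fun i u => ‖P i‖ * bound i u) Finset.univ
      fun i _ => (hbi i).const_mul _
  have h1 := hasFDerivAt_integral_of_dominated_of_fderiv_le
    (bound := fun u => ∑ i, ‖P i‖ * bound i u) (F' := fun x u => ∑ i, (P i).smulRight (A i x u))
    hs (Eventually.of_forall hFm) hFi hsum.1
    (Eventually.of_forall fun u x hx => ?_)
    hbsum (Eventually.of_forall hd)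
  · rw [integral_finsetSum (f := fun i u => (P i).smulRight (A i x₀ u)) Finset.univ
      fun i _ => hAP i] at h1
    have h2 : ∀ i, ∫ u, (P i).smulRight (A i x₀ u) = (P i).smulRight (∫ u, A i x₀ u) := fun i =>
      ContinuousLinearMap.integral_comp_comm (φ := A i x₀)
        (ContinuousLinearMap.smulRightL ℝ E ℂ (P i)) (hAi i)
    simp_rw [h2] at h1
    exact h1
  · refine (norm_sum_le _ _).trans (Finset.sum_le_sum fun i _ => ?_)
    rw [ContinuousLinearMap.norm_smulRight_apply]
    exact mul_le_mul_of_nonneg_left (hb i x hx u) (norm_nonneg _)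

/-- The action of multiplication by the variable in the Hermite basis. -/
def ladderX (G : ℕ → ℂ) (n : ℕ) : ℂ :=
  (ladderCoeff (n + 1) : ℂ) * G (n + 1) + (ladderCoeff n : ℂ) * G (n - 1)

/-- The action of differentiation in the Hermite basis. -/
def ladderD (G : ℕ → ℂ) (n : ℕ) : ℂ :=
  (ladderCoeff n : ℂ) * G (n - 1) - (ladderCoeff (n + 1) : ℂ) * G (n + 1)

section Ladder

variable {α : Type*} [MeasurableSpace α] {μ : Measure α} {G : ℕ → α → ℂ}

theorem MeasureTheory.Integrable.ladderX (hG : ∀ k, Integrable (G k) μ) (n : ℕ) :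
    Integrable (fun u => ladderX (fun k => G k u) n) μ :=
  ((hG _).const_mul _).add ((hG _).const_mul _)

theorem MeasureTheory.Integrable.ladderD (hG : ∀ k, Integrable (G k) μ) (n : ℕ) :
    Integrable (fun u => ladderD (fun k => G k u) n) μ :=
  ((hG _).const_mul _).sub ((hG _).const_mul _)

theorem integral_ladderX (hG : ∀ k, Integrable (G k) μ) (n : ℕ) :
    ∫ u, ladderX (fun k => G k u) n ∂μ = ladderX (fun k => ∫ u, G k u ∂μ) n := by
  simp only [ladderX]
  rw [integral_add ((hG _).const_mul _) ((hG _).const_mul _), integral_const_mul,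
    integral_const_mul]

theorem integral_ladderD (hG : ∀ k, Integrable (G k) μ) (n : ℕ) :
    ∫ u, ladderD (fun k => G k u) n ∂μ = ladderD (fun k => ∫ u, G k u ∂μ) n := by
  simp only [ladderD]
  rw [integral_sub ((hG _).const_mul _) ((hG _).const_mul _), integral_const_mul,
    integral_const_mul]

end Ladder

theorem ladderCoeff_nonneg (n : ℕ) : 0 ≤ ladderCoeff n := Real.sqrt_nonneg _

theorem norm_ladderX_le (G : ℕ → ℂ) (n : ℕ) : ‖ladderX G n‖
    ≤ ladderCoeff (n + 1) * ‖G (n + 1)‖ + ladderCoeff n * ‖G (n - 1)‖ := by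
  refine (norm_add_le _ _).trans_eq ?_
  rw [norm_mul, norm_mul, Complex.norm_of_nonneg (ladderCoeff_nonneg _),
    Complex.norm_of_nonneg (ladderCoeff_nonneg _)]

theorem norm_ladderD_le (G : ℕ → ℂ) (n : ℕ) : ‖ladderD G n‖
    ≤ ladderCoeff n * ‖G (n - 1)‖ + ladderCoeff (n + 1) * ‖G (n + 1)‖ := by
  refine (norm_sub_le _ _).trans_eq ?_
  rw [norm_mul, norm_mul, Complex.norm_of_nonneg (ladderCoeff_nonneg _),
    Complex.norm_of_nonneg (ladderCoeff_nonneg _)]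

/-- The integrand of `wignerFun`. -/
def wignerKernel (m n : ℕ) (a b u : ℝ) : ℂ :=
  ((hermiteFun m (u + a / 2) * hermiteFun n (u - a / 2) : ℝ) : ℂ) * modulationFun b u

theorem continuous_wignerKernel (m n : ℕ) (a b : ℝ) : Continuous (wignerKernel m n a b) := by
  unfold wignerKernel modulationFun
  have := continuous_hermiteFun m
  have := continuous_hermiteFun n
  fun_prop

theorem wignerFun_eq (m n : ℕ) (a b : ℝ) : wignerFun m n a b = ∫ u, wignerKernel m n a b u := rfl

theorem exists_norm_wignerKernel_le (R : ℝ) (m n : ℕ) :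
    ∃ C, ∀ a b u, |a| ≤ R → ‖wignerKernel m n a b u‖ ≤ C * (1 + u ^ 2)⁻¹ := by
  obtain ⟨C, hC0, hC⟩ := exists_decay_hermiteFun m
  obtain ⟨D, hD0, hD⟩ := exists_le_hermiteFun n
  refine ⟨C * (2 * (1 + R ^ 2)) * D, fun a b u ha => ?_⟩
  rw [wignerKernel, norm_mul, norm_modulationFun, mul_one, Complex.norm_real, Real.norm_eq_abs,
    abs_mul]
  have h1 : (1 + (u + a / 2) ^ 2)⁻¹ ≤ 2 * (1 + R ^ 2) * (1 + u ^ 2)⁻¹ := by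
    rw [← div_eq_mul_inv, inv_eq_one_div, div_le_div_iff₀ (by positivity) (by positivity)]
    have h2 : a ^ 2 ≤ R ^ 2 := by
      rw [← sq_abs a]
      exact pow_le_pow_left₀ (abs_nonneg _) ha 2
    nlinarith [sq_nonneg (u + a), mul_nonneg (sq_nonneg R) (sq_nonneg (u + a / 2))]
  calc |hermiteFun m (u + a / 2)| * |hermiteFun n (u - a / 2)|
      ≤ C * (2 * (1 + R ^ 2) * (1 + u ^ 2)⁻¹) * D := by
        gcongr
        · exact (hC _).trans (by gcongr)
        · exact hD _
    _ = _ := by ring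

theorem integrable_wignerKernel (m n : ℕ) (a b : ℝ) : Integrable (wignerKernel m n a b) := by
  obtain ⟨C, hC⟩ := exists_norm_wignerKernel_le |a| m n
  exact (integrable_inv_one_add_sq.const_mul C).mono'
    (continuous_wignerKernel m n a b).aestronglyMeasurable
    (Eventually.of_forall fun u => hC a b u le_rfl)

theorem mul_wignerKernel_left (m n : ℕ) (a b u : ℝ) :
    ((u + a / 2 : ℝ) : ℂ) * wignerKernel m n a b u
      = ladderX (fun k => wignerKernel k n a b u) m := by
  have h := mul_hermiteFun m (u + a / 2)
  simp only [wignerKernel, ladderX]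
  rw [← mul_assoc, ← Complex.ofReal_mul, ← mul_assoc, h]
  push_cast; ring

theorem mul_wignerKernel_right (m n : ℕ) (a b u : ℝ) :
    ((u - a / 2 : ℝ) : ℂ) * wignerKernel m n a b u
      = ladderX (fun k => wignerKernel m k a b u) n := by
  have h := mul_hermiteFun n (u - a / 2)
  simp only [wignerKernel, ladderX]
  rw [← mul_assoc, ← Complex.ofReal_mul, mul_left_comm, h]
  push_cast; ring

/-- Multiplication by `a = (u + a/2) - (u - a/2)` acts through the ladder relations for `x h_m`. -/
theorem mul_left_wignerFun (m n : ℕ) (a b : ℝ) : (a : ℂ) * wignerFun m n a b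
    = ladderX (fun k => wignerFun k n a b) m - ladderX (fun k => wignerFun m k a b) n := by
  simp only [wignerFun_eq]
  rw [← integral_ladderX (fun k => integrable_wignerKernel k n a b),
    ← integral_ladderX (fun k => integrable_wignerKernel m k a b), ← integral_sub
      (Integrable.ladderX (fun k => integrable_wignerKernel k n a b) m)
      (Integrable.ladderX (fun k => integrable_wignerKernel m k a b) n), ← integral_const_mul]
  refine integral_congr_ae (Eventually.of_forall fun u => ?_)
  simp only [← mul_wignerKernel_left, ← mul_wignerKernel_right]
  push_cast; ring

theorem hasDerivAt_modulationFun (b u : ℝ) :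
    HasDerivAt (modulationFun b) (2 * Real.pi * Complex.I * b * modulationFun b u) u := by
  have h1 : HasDerivAt (fun x : ℝ => (2 * Real.pi * Complex.I * b * (x : ℂ)))
      (2 * Real.pi * Complex.I * b * 1) u :=
    (HasDerivAt.ofReal_comp (hasDerivAt_id u)).const_mul _
  have h2 := h1.cexp
  convert! h2 using 1
  rw [modulationFun]; ring

/-- Multiplication by `2πib` acts, after integrating by parts in `u`, through the ladder relations
for `h_m'`. -/
theorem mul_right_wignerFun (m n : ℕ) (a b : ℝ) : 2 * Real.pi * Complex.I * b * wignerFun m n a b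
    = -(ladderD (fun k => wignerFun k n a b) m + ladderD (fun k => wignerFun m k a b) n) := by
  have hd : ∀ u, HasDerivAt (wignerKernel m n a b)
      (ladderD (fun k => wignerKernel k n a b u) m + ladderD (fun k => wignerKernel m k a b u) n
        + 2 * Real.pi * Complex.I * b * wignerKernel m n a b u) u := by
    intro u
    have h1 := (hasDerivAt_hermiteFun m (u + a / 2)).comp_add_const u (a / 2)
    have h2 := (hasDerivAt_hermiteFun n (u - a / 2)).comp_sub_const u (a / 2)
    have h3 := ((h1.mul h2).ofReal_comp).mul (hasDerivAt_modulationFun b u)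
    convert! h3 using 1
    simp only [ladderD, wignerKernel, Pi.mul_apply]
    push_cast; ring
  have hD1 := Integrable.ladderD (fun k => integrable_wignerKernel k n a b) m
  have hD2 := Integrable.ladderD (fun k => integrable_wignerKernel m k a b) n
  have hK := (integrable_wignerKernel m n a b).const_mul (2 * Real.pi * Complex.I * b)
  have h0 := integral_eq_zero_of_hasDerivAt_of_integrable hd ((hD1.add hD2).add hK)
    (integrable_wignerKernel m n a b)
  rw [integral_add (f := fun u => ladderD (fun k => wignerKernel k n a b u) m
    + ladderD (fun k => wignerKernel m k a b u) n) (hD1.add hD2) hK, integral_add hD1 hD2,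
    integral_const_mul,
    integral_ladderD fun k => integrable_wignerKernel k n a b,
    integral_ladderD fun k => integrable_wignerKernel m k a b] at h0
  simp only [wignerFun_eq]
  linear_combination h0

/-- Differentiation under the integral sign. The derivatives in `a` and `b` again act through the
ladder relations, since `u = ((u + a/2) + (u - a/2)) / 2`. -/
theorem hasFDerivAt_wignerFun (m n : ℕ) (z : ℝ × ℝ) :
    HasFDerivAt (fun z : ℝ × ℝ => wignerFun m n z.1 z.2)
      ((ContinuousLinearMap.fst ℝ ℝ ℝ).smulRight (2⁻¹ *
          (ladderD (fun k => wignerFun k n z.1 z.2) m - ladderD (fun k => wignerFun m k z.1 z.2) n))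
        + (ContinuousLinearMap.snd ℝ ℝ ℝ).smulRight (Real.pi * Complex.I *
          (ladderX (fun k => wignerFun k n z.1 z.2) m
            + ladderX (fun k => wignerFun m k z.1 z.2) n))) z := by
  set A : Fin 2 → ℝ × ℝ → ℝ → ℂ := ![fun w u => 2⁻¹ *
      (ladderD (fun k => wignerKernel k n w.1 w.2 u) m
        - ladderD (fun k => wignerKernel m k w.1 w.2 u) n),
    fun w u => Real.pi * Complex.I * (ladderX (fun k => wignerKernel k n w.1 w.2 u) m
            + ladderX (fun k => wignerKernel m k w.1 w.2 u) n)] with hA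
  have hD1 := fun w : ℝ × ℝ => Integrable.ladderD (fun k => integrable_wignerKernel k n w.1 w.2) m
  have hD2 := fun w : ℝ × ℝ => Integrable.ladderD (fun k => integrable_wignerKernel m k w.1 w.2) n
  have hX1 := fun w : ℝ × ℝ => Integrable.ladderX (fun k => integrable_wignerKernel k n w.1 w.2) m
  have hX2 := fun w : ℝ × ℝ => Integrable.ladderX (fun k => integrable_wignerKernel m k w.1 w.2) n
  choose C hC using fun i j => exists_norm_wignerKernel_le (|z.1| + 1) i j
  have hα := ladderCoeff_nonneg
  have hmem : ∀ w ∈ Metric.ball z 1, |w.1| ≤ |z.1| + 1 := by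
    intro w hw
    have h1 : dist w.1 z.1 < 1 := lt_of_le_of_lt (le_max_left _ _) (Metric.mem_ball.1 hw)
    rw [Real.dist_eq] at h1
    have h2 := abs_sub_abs_le_abs_sub w.1 z.1
    linarith
  have key := hasFDerivAt_integral_sum
    ![ContinuousLinearMap.fst ℝ ℝ ℝ, ContinuousLinearMap.snd ℝ ℝ ℝ]
    (F := fun w u => wignerKernel m n w.1 w.2 u) (A := A)
    (bound := ![fun u => 2⁻¹ * ((ladderCoeff m * (C (m - 1) n * (1 + u ^ 2)⁻¹)
        + ladderCoeff (m + 1) * (C (m + 1) n * (1 + u ^ 2)⁻¹))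
        + (ladderCoeff n * (C m (n - 1) * (1 + u ^ 2)⁻¹)
        + ladderCoeff (n + 1) * (C m (n + 1) * (1 + u ^ 2)⁻¹))),
      fun u => Real.pi * ((ladderCoeff (m + 1) * (C (m + 1) n * (1 + u ^ 2)⁻¹)
        + ladderCoeff m * (C (m - 1) n * (1 + u ^ 2)⁻¹))
        + (ladderCoeff (n + 1) * (C m (n + 1) * (1 + u ^ 2)⁻¹)
        + ladderCoeff n * (C m (n - 1) * (1 + u ^ 2)⁻¹)))])
    (Metric.ball_mem_nhds z one_pos)
    (fun w => (continuous_wignerKernel m n w.1 w.2).aestronglyMeasurable)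
    (integrable_wignerKernel m n z.1 z.2) ?_ ?_ ?_ ?_
  · convert! key using 1
    rw [Fin.sum_univ_two]
    simp only [hA, Matrix.cons_val_zero, Matrix.cons_val_one]
    rw [integral_const_mul, integral_const_mul, integral_sub (hD1 z) (hD2 z),
      integral_add (hX1 z) (hX2 z),
      integral_ladderD fun k => integrable_wignerKernel k n z.1 z.2,
      integral_ladderD fun k => integrable_wignerKernel m k z.1 z.2,
      integral_ladderX fun k => integrable_wignerKernel k n z.1 z.2,
      integral_ladderX fun k => integrable_wignerKernel m k z.1 z.2]
    rfl
  · rw [Fin.forall_fin_two]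
    exact ⟨(((hD1 z).sub (hD2 z)).const_mul _).1, (((hX1 z).add (hX2 z)).const_mul _).1⟩
  · rw [Fin.forall_fin_two]
    refine ⟨fun w hw u => ?_, fun w hw u => ?_⟩
    · have h := fun i j => hC i j w.1 w.2 u (hmem w hw)
      simp only [hA, Matrix.cons_val_zero, norm_mul]
      rw [norm_inv, Complex.norm_ofNat]
      refine mul_le_mul_of_nonneg_left ((norm_sub_le _ _).trans (add_le_add ?_ ?_)) (by norm_num)
      · refine (norm_ladderD_le _ _).trans (add_le_add ?_ ?_) <;>
          exact mul_le_mul_of_nonneg_left (h _ _) (hα _)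
      · refine (norm_ladderD_le _ _).trans (add_le_add ?_ ?_) <;>
          exact mul_le_mul_of_nonneg_left (h _ _) (hα _)
    · have h := fun i j => hC i j w.1 w.2 u (hmem w hw)
      simp only [hA, Matrix.cons_val_one, Matrix.cons_val_fin_one, norm_mul]
      rw [Complex.norm_I, mul_one, Complex.norm_of_nonneg Real.pi_pos.le]
      refine mul_le_mul_of_nonneg_left ((norm_add_le _ _).trans (add_le_add ?_ ?_))
        Real.pi_pos.le
      · refine (norm_ladderX_le _ _).trans (add_le_add ?_ ?_) <;>
          exact mul_le_mul_of_nonneg_left (h _ _) (hα _)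
      · refine (norm_ladderX_le _ _).trans (add_le_add ?_ ?_) <;>
          exact mul_le_mul_of_nonneg_left (h _ _) (hα _)
  · have hi : ∀ C : ℝ, Integrable (fun u : ℝ => C * (1 + u ^ 2)⁻¹) := fun C =>
      integrable_inv_one_add_sq.const_mul C
    rw [Fin.forall_fin_two]
    exact ⟨((((hi _).const_mul _).add ((hi _).const_mul _)).add
        (((hi _).const_mul _).add ((hi _).const_mul _))).const_mul _,
      ((((hi _).const_mul _).add ((hi _).const_mul _)).add
        (((hi _).const_mul _).add ((hi _).const_mul _))).const_mul _⟩
  · intro u w _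
    have g1 : HasFDerivAt (fun w : ℝ × ℝ => u + w.1 / 2)
        ((2⁻¹ : ℝ) • ContinuousLinearMap.fst ℝ ℝ ℝ) w := by
      have := ((hasFDerivAt_fst (𝕜 := ℝ) (p := w)).const_smul (2⁻¹ : ℝ)).const_add u
      convert! this using 2
      simp [div_eq_inv_mul]
    have g2 : HasFDerivAt (fun w : ℝ × ℝ => u - w.1 / 2)
        (-((2⁻¹ : ℝ) • ContinuousLinearMap.fst ℝ ℝ ℝ)) w := by
      have := ((hasFDerivAt_fst (𝕜 := ℝ) (p := w)).const_smul (2⁻¹ : ℝ)).const_sub u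
      convert! this using 2
      simp [div_eq_inv_mul]
    have h1 := (hasDerivAt_hermiteFun m (u + w.1 / 2)).comp_hasFDerivAt w g1
    have h2 := (hasDerivAt_hermiteFun n (u - w.1 / 2)).comp_hasFDerivAt w g2
    have h3 : HasFDerivAt (fun w : ℝ × ℝ => modulationFun w.2 u)
        ((ContinuousLinearMap.snd ℝ ℝ ℝ).smulRight
          (2 * Real.pi * Complex.I * u * modulationFun w.2 u)) w := by
      have h4 := (hasDerivAt_modulationFun u w.2).hasFDerivAt.comp w
        (hasFDerivAt_snd (𝕜 := ℝ) (p := w))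
      simp_rw [modulationFun_comm _ u]
      exact h4
    have h5 := ((Complex.ofRealCLM.hasFDerivAt).comp w (h1.mul h2)).mul h3
    convert! h5 using 1
    rw [Fin.sum_univ_two]
    simp only [hA, Matrix.cons_val_zero, Matrix.cons_val_one, Matrix.cons_val_fin_one]
    have hX : (2 * Real.pi * Complex.I * u * wignerKernel m n w.1 w.2 u : ℂ)
        = Real.pi * Complex.I * (ladderX (fun k => wignerKernel k n w.1 w.2 u) m
            + ladderX (fun k => wignerKernel m k w.1 w.2 u) n) := by
      rw [← mul_wignerKernel_left, ← mul_wignerKernel_right]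
      push_cast; ring
    rw [← hX]
    ext
    · simp [ladderD, wignerKernel]
      ring
    · simp [wignerKernel]
      ring

/-! ### Smoothness of wave packets and the action of the invariant fields -/

namespace Heisenberg

/-- The coordinate functionals of `ℍ = ℝ³`. -/
def coordCLM : Fin 3 → Heisenberg →L[ℝ] ℝ :=
  ![(ContinuousLinearMap.fst ℝ ℝ (ℝ × ℝ) : ℝ × ℝ × ℝ →L[ℝ] ℝ),
    ((ContinuousLinearMap.fst ℝ ℝ ℝ).comp (ContinuousLinearMap.snd ℝ ℝ (ℝ × ℝ)) :
      ℝ × ℝ × ℝ →L[ℝ] ℝ),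
    ((ContinuousLinearMap.snd ℝ ℝ ℝ).comp (ContinuousLinearMap.snd ℝ ℝ (ℝ × ℝ)) :
      ℝ × ℝ × ℝ →L[ℝ] ℝ)]

theorem coordCLM_zero_apply (x : Heisenberg) : coordCLM 0 x = x.p := rfl
theorem coordCLM_one_apply (x : Heisenberg) : coordCLM 1 x = x.q := rfl
theorem coordCLM_two_apply (x : Heisenberg) : coordCLM 2 x = x.t := rfl

end Heisenberg

theorem conj_ladderX (G : ℕ → ℂ) (n : ℕ) :
    (starRingEnd ℂ) (ladderX G n) = ladderX (fun k => (starRingEnd ℂ) (G k)) n := by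
  simp [ladderX]

theorem conj_ladderD (G : ℕ → ℂ) (n : ℕ) :
    (starRingEnd ℂ) (ladderD G n) = ladderD (fun k => (starRingEnd ℂ) (G k)) n := by
  simp [ladderD]

theorem mul_ladderX (z : ℂ) (G : ℕ → ℂ) (n : ℕ) :
    z * ladderX G n = ladderX (fun k => z * G k) n := by
  simp only [ladderX]; ring

theorem mul_ladderD (z : ℂ) (G : ℕ → ℂ) (n : ℕ) :
    z * ladderD G n = ladderD (fun k => z * G k) n := by
  simp only [ladderD]; ring

/-- The harmonic oscillator `x² - d²/dx²` is diagonal in the Hermite basis. -/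
theorem ladderX_ladderX_sub_ladderD_ladderD (G : ℕ → ℂ) (n : ℕ) :
    ladderX (ladderX G) n - ladderD (ladderD G) n = (2 * n + 1) * G n := by
  have h1 : (ladderCoeff (n + 1) : ℂ) * ladderCoeff (n + 1) = (n + 1) / 2 := by
    rw [← Complex.ofReal_mul, ladderCoeff_sq]; push_cast; ring
  have h2 : (ladderCoeff n : ℂ) * ladderCoeff n = n / 2 := by
    rw [← Complex.ofReal_mul, ladderCoeff_sq]; push_cast; ring
  cases n with
  | zero =>
    simp only [ladderX, ladderD, ladderCoeff_zero, Nat.add_sub_cancel] at h1 ⊢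
    push_cast at h1 ⊢
    linear_combination 2 * G 0 * h1
  | succ n =>
    simp only [ladderX, ladderD, Nat.add_sub_cancel]
    linear_combination 2 * G (n + 1) * (h1 + h2)

/-- The factor `λ/√|λ|` by which `ρ_λ` scales the first coordinate. -/
def scaleP (lam : ℝ) : ℝ := lam / √|lam|

theorem scaleP_sq (lam : ℝ) : scaleP lam * scaleP lam = |lam| := by
  rw [scaleP, div_mul_div_comm, Real.mul_self_sqrt (abs_nonneg _), ← abs_mul_abs_self lam,
    mul_self_div_self]

theorem scaleP_mul_sqrt (lam : ℝ) : scaleP lam * √|lam| = lam := by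
  rcases eq_or_ne lam 0 with rfl | h
  · simp
  · rw [scaleP, div_mul_cancel₀ _ (Real.sqrt_pos.2 (abs_pos.2 h)).ne']

theorem measurable_scaleP : Measurable scaleP := by unfold scaleP; fun_prop

theorem abs_scaleP (lam : ℝ) : |scaleP lam| = √|lam| := by
  rw [← Real.sqrt_mul_self_eq_abs, scaleP_sq]

namespace IsCutoffFun

theorem scaleP_mul {c : ℝ → ℂ} (hc : IsCutoffFun c) :
    IsCutoffFun (fun lam => (scaleP lam : ℂ) * c lam) :=
  hc.mul (Complex.measurable_ofReal.comp measurable_scaleP) fun R => ⟨√R, fun lam h => by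
    rw [Complex.norm_real, Real.norm_eq_abs, abs_scaleP]
    exact Real.sqrt_le_sqrt h⟩

theorem central_mul {c : ℝ → ℂ} (hc : IsCutoffFun c) :
    IsCutoffFun (fun lam => 2 * Real.pi * Complex.I * lam * c lam) :=
  hc.mul_continuous (w := fun lam => 2 * Real.pi * Complex.I * (lam : ℂ)) (by fun_prop)

theorem abs_mul {c : ℝ → ℂ} (hc : IsCutoffFun c) (k : ℂ) :
    IsCutoffFun (fun lam => (|lam| : ℝ) * k * c lam) :=
  hc.mul_continuous (w := fun lam => ((|lam| : ℝ) : ℂ) * k) (by fun_prop)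

end IsCutoffFun

/-- The complex conjugate of `matCoeff`. -/
def conjMat (m n : ℕ) (lam : ℝ) (x : Heisenberg) : ℂ := (starRingEnd ℂ) (matCoeff m n lam x)

theorem conjMat_eq (m n : ℕ) (lam : ℝ) (x : Heisenberg) : conjMat m n lam x
    = modulationFun lam x.t *
      (starRingEnd ℂ) (wignerFun m n (scaleP lam * x.p) (√|lam| * x.q)) := by
  rw [conjMat, matCoeff, map_mul, conj_modulationFun, neg_neg, scaleP]

theorem measurable_conjMat (m n : ℕ) (x : Heisenberg) :
    Measurable (fun lam => conjMat m n lam x) :=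
  Complex.continuous_conj.measurable.comp (Measurable.comp
    (g := fun z : ℝ × Heisenberg => matCoeff m n z.1 z.2) (f := fun lam : ℝ => (lam, x))
    (measurable_matCoeff m n) measurable_prodMk_right)

theorem norm_conjMat_le (m n : ℕ) (lam : ℝ) (x : Heisenberg) : ‖conjMat m n lam x‖ ≤ 1 := by
  rw [conjMat, RCLike.norm_conj]; exact norm_matCoeff_le _ _ _ _

theorem mul_p_conjMat (m n : ℕ) (lam : ℝ) (x : Heisenberg) :
    ((scaleP lam * x.p : ℝ) : ℂ) * conjMat m n lam x
      = ladderX (fun k => conjMat k n lam x) m - ladderX (fun k => conjMat m k lam x) n := by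
  have h := congrArg (starRingEnd ℂ) (mul_left_wignerFun m n (scaleP lam * x.p) (√|lam| * x.q))
  rw [map_mul, map_sub, conj_ladderX, conj_ladderX, Complex.conj_ofReal] at h
  simp only [conjMat_eq, ← mul_ladderX]
  linear_combination modulationFun lam x.t * h

theorem mul_q_conjMat (m n : ℕ) (lam : ℝ) (x : Heisenberg) :
    2 * Real.pi * Complex.I * ((√|lam| * x.q : ℝ) : ℂ) * conjMat m n lam x
      = ladderD (fun k => conjMat k n lam x) m + ladderD (fun k => conjMat m k lam x) n := by
  have h := congrArg (starRingEnd ℂ) (mul_right_wignerFun m n (scaleP lam * x.p) (√|lam| * x.q))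
  rw [map_neg, map_add, conj_ladderD, conj_ladderD] at h
  simp only [map_mul, Complex.conj_ofReal, Complex.conj_I, Complex.conj_ofNat] at h
  simp only [conjMat_eq, ← mul_ladderD]
  linear_combination -modulationFun lam x.t * h

theorem hasFDerivAt_conjMat (m n : ℕ) (lam : ℝ) (x : Heisenberg) :
    HasFDerivAt (conjMat m n lam) (∑ i, (Heisenberg.coordCLM i).smulRight
      (![(scaleP lam : ℂ) * (2⁻¹ * (ladderD (fun k => conjMat k n lam x) m
          - ladderD (fun k => conjMat m k lam x) n)),
        ((√|lam| : ℝ) : ℂ) * (-(Real.pi * Complex.I) * (ladderX (fun k => conjMat k n lam x) m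
          + ladderX (fun k => conjMat m k lam x) n)),
        2 * Real.pi * Complex.I * lam * conjMat m n lam x] i)) x := by
  have h1 : HasFDerivAt (fun x : Heisenberg => (scaleP lam * x.p, √|lam| * x.q))
      ((scaleP lam • Heisenberg.coordCLM 0).prod (√|lam| • Heisenberg.coordCLM 1)) x :=
    ((scaleP lam • Heisenberg.coordCLM 0).prod (√|lam| • Heisenberg.coordCLM 1)).hasFDerivAt
  have h2 := (hasFDerivAt_wignerFun m n (scaleP lam * x.p, √|lam| * x.q)).comp x h1
  have h3 := (Complex.conjCLE.toContinuousLinearMap.hasFDerivAt).comp x h2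
  have h4 := (hasDerivAt_modulationFun lam x.t).hasFDerivAt.comp x
    (Heisenberg.coordCLM 2).hasFDerivAt
  have h5 := h4.mul h3
  have he : conjMat m n lam = fun x => modulationFun lam x.t *
      (starRingEnd ℂ) (wignerFun m n (scaleP lam * x.p) (√|lam| * x.q)) :=
    funext fun x => conjMat_eq m n lam x
  rw [he]
  convert! h5 using 1
  rw [Fin.sum_univ_three]
  simp only [Matrix.cons_val]
  simp only [conjMat_eq, ← mul_ladderD, ← mul_ladderX]
  ext v
  simp [← conj_ladderD, ← conj_ladderX, Complex.conj_ofNat]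
  ring

/-- The integrand of `wavePacket`. -/
def packetKernel (m n : ℕ) (c : ℝ → ℂ) (x : Heisenberg) (lam : ℝ) : ℂ :=
  ((√|lam| : ℝ) : ℂ) * c lam * conjMat m n lam x

theorem wavePacket_eq_integral (m n : ℕ) (c : ℝ → ℂ) (x : Heisenberg) :
    wavePacket m n c x = ∫ lam, packetKernel m n c x lam := rfl

theorem norm_packetKernel_le (m n : ℕ) (c : ℝ → ℂ) (x : Heisenberg) (lam : ℝ) :
    ‖packetKernel m n c x lam‖ ≤ ‖((√|lam| : ℝ) : ℂ) * c lam‖ := by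
  rw [packetKernel, norm_mul]
  exact mul_le_of_le_one_right (norm_nonneg _) (norm_conjMat_le _ _ _ _)

theorem integrable_packetKernel (m n : ℕ) {c : ℝ → ℂ} (hc : IsCutoffFun c) (x : Heisenberg) :
    Integrable (packetKernel m n c x) :=
  hc.sqrt_mul.integrable.mul_bdd (measurable_conjMat m n x).aestronglyMeasurable
    (Eventually.of_forall fun lam => norm_conjMat_le m n lam x)

set_option maxHeartbeats 1000000 in
/-- Differentiation of a wave packet under the integral over `λ`. The coordinates `p`, `q`, `t` act,
up to factors depending on `λ`, as the derivatives of the Fourier-Wigner transform and as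
multiplication by `2πiλ`. -/
theorem hasFDerivAt_wavePacket (m n : ℕ) {c : ℝ → ℂ} (hc : IsCutoffFun c) (x : Heisenberg) :
    HasFDerivAt (wavePacket m n c) (∑ i, (Heisenberg.coordCLM i).smulRight
      (![2⁻¹ * (ladderD (fun k => wavePacket k n (fun lam => (scaleP lam : ℂ) * c lam) x) m
          - ladderD (fun k => wavePacket m k (fun lam => (scaleP lam : ℂ) * c lam) x) n),
        -(Real.pi * Complex.I) *
          (ladderX (fun k => wavePacket k n (fun lam => ((√|lam| : ℝ) : ℂ) * c lam) x) m
          + ladderX (fun k => wavePacket m k (fun lam => ((√|lam| : ℝ) : ℂ) * c lam) x) n),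
        wavePacket m n (fun lam => 2 * Real.pi * Complex.I * lam * c lam) x] i)) x := by
  set A : Fin 3 → Heisenberg → ℝ → ℂ :=
    ![fun x u => 2⁻¹ *
          (ladderD (fun k => packetKernel k n (fun lam => (scaleP lam : ℂ) * c lam) x u) m
          - ladderD (fun k => packetKernel m k (fun lam => (scaleP lam : ℂ) * c lam) x u) n),
      fun x u => -(Real.pi * Complex.I) *
          (ladderX (fun k => packetKernel k n (fun lam => ((√|lam| : ℝ) : ℂ) * c lam) x u) m
          + ladderX (fun k => packetKernel m k (fun lam => ((√|lam| : ℝ) : ℂ) * c lam) x u) n),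
      fun x u => packetKernel m n (fun lam => 2 * Real.pi * Complex.I * lam * c lam) x u] with hA
  set b0 : ℝ → ℝ := fun lam => ‖((√|lam| : ℝ) : ℂ) * ((scaleP lam : ℂ) * c lam)‖ with hb0
  set b1 : ℝ → ℝ := fun lam => ‖((√|lam| : ℝ) : ℂ) * (((√|lam| : ℝ) : ℂ) * c lam)‖ with hb1
  set b2 : ℝ → ℝ := fun lam =>
    ‖((√|lam| : ℝ) : ℂ) * (2 * Real.pi * Complex.I * lam * c lam)‖ with hb2
  have hi0 : Integrable b0 := hc.scaleP_mul.sqrt_mul.integrable.norm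
  have hi1 : Integrable b1 := hc.sqrt_mul.sqrt_mul.integrable.norm
  have hi2 : Integrable b2 := hc.central_mul.sqrt_mul.integrable.norm
  have hK0 := fun m n => integrable_packetKernel m n hc.scaleP_mul x
  have hK1 := fun m n => integrable_packetKernel m n hc.sqrt_mul x
  have hD1 := Integrable.ladderD (fun k => hK0 k n) m
  have hD2 := Integrable.ladderD (fun k => hK0 m k) n
  have hX1 := Integrable.ladderX (fun k => hK1 k n) m
  have hX2 := Integrable.ladderX (fun k => hK1 m k) n
  have hα := ladderCoeff_nonneg
  have hB0 : Integrable (fun u => 2⁻¹ * ((ladderCoeff m * b0 u + ladderCoeff (m + 1) * b0 u)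
      + (ladderCoeff n * b0 u + ladderCoeff (n + 1) * b0 u))) :=
    (((hi0.const_mul _).add (hi0.const_mul _)).add
      ((hi0.const_mul _).add (hi0.const_mul _))).const_mul _
  have hB1 : Integrable (fun u => Real.pi * ((ladderCoeff (m + 1) * b1 u + ladderCoeff m * b1 u)
      + (ladderCoeff (n + 1) * b1 u + ladderCoeff n * b1 u))) :=
    (((hi1.const_mul _).add (hi1.const_mul _)).add
      ((hi1.const_mul _).add (hi1.const_mul _))).const_mul _
  have key := hasFDerivAt_integral_sum Heisenberg.coordCLM
    (F := packetKernel m n c) (A := A) (x₀ := x) (s := Set.univ)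
    (bound := ![fun u => 2⁻¹ * ((ladderCoeff m * b0 u + ladderCoeff (m + 1) * b0 u)
        + (ladderCoeff n * b0 u + ladderCoeff (n + 1) * b0 u)),
      fun u => Real.pi * ((ladderCoeff (m + 1) * b1 u + ladderCoeff m * b1 u)
        + (ladderCoeff (n + 1) * b1 u + ladderCoeff n * b1 u)), b2])
    univ_mem (fun w => (integrable_packetKernel m n hc w).1)
    (integrable_packetKernel m n hc x) ?_ ?_ ?_ ?_
  · convert! key using 1
    rw [Fin.sum_univ_three, Fin.sum_univ_three]
    simp only [hA, Matrix.cons_val]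
    rw [integral_const_mul, integral_const_mul, integral_sub hD1 hD2, integral_add hX1 hX2,
      integral_ladderD fun k => hK0 k n, integral_ladderD fun k => hK0 m k,
      integral_ladderX fun k => hK1 k n, integral_ladderX fun k => hK1 m k]
    rfl
  · intro i
    fin_cases i
    · exact ((hD1.sub hD2).const_mul _).1
    · exact ((hX1.add hX2).const_mul _).1
    · exact (integrable_packetKernel m n hc.central_mul x).1
  · intro i w _ u
    fin_cases i
    · simp only [hA, Fin.zero_eta, Matrix.cons_val, norm_mul]
      rw [norm_inv, Complex.norm_ofNat]
      refine mul_le_mul_of_nonneg_left ((norm_sub_le _ _).trans (add_le_add ?_ ?_))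
        (by norm_num) <;>
      · refine (norm_ladderD_le _ _).trans (add_le_add ?_ ?_) <;>
          exact mul_le_mul_of_nonneg_left (norm_packetKernel_le _ _ _ _ _) (hα _)
    · simp only [hA, Fin.mk_one, Matrix.cons_val, norm_mul, norm_neg]
      rw [Complex.norm_I, mul_one, Complex.norm_of_nonneg Real.pi_pos.le]
      refine mul_le_mul_of_nonneg_left ((norm_add_le _ _).trans (add_le_add ?_ ?_))
        Real.pi_pos.le <;>
      · refine (norm_ladderX_le _ _).trans (add_le_add ?_ ?_) <;>
          exact mul_le_mul_of_nonneg_left (norm_packetKernel_le _ _ _ _ _) (hα _)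
    · exact norm_packetKernel_le m n (fun lam => 2 * Real.pi * Complex.I * lam * c lam) w u
  · exact Fin.forall_fin_succ.2 ⟨hB0, Fin.forall_fin_two.2 ⟨hB1, hi2⟩⟩
  · intro u w _
    have h := (hasFDerivAt_conjMat m n u w).const_mul (((√|u| : ℝ) : ℂ) * c u)
    convert! h using 1
    rw [Fin.sum_univ_three, Fin.sum_univ_three]
    simp only [hA, Matrix.cons_val, packetKernel, ← mul_ladderD, ← mul_ladderX]
    ext v
    simp
    ring

theorem contDiff_ladderX {E : Type*} [NormedAddCommGroup E] [NormedSpace ℝ E] {N : WithTop ℕ∞}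
    {G : ℕ → E → ℂ} (hG : ∀ k, ContDiff ℝ N (G k)) (n : ℕ) :
    ContDiff ℝ N (fun x => ladderX (fun k => G k x) n) :=
  (contDiff_const.mul (hG _)).add (contDiff_const.mul (hG _))

theorem contDiff_ladderD {E : Type*} [NormedAddCommGroup E] [NormedSpace ℝ E] {N : WithTop ℕ∞}
    {G : ℕ → E → ℂ} (hG : ∀ k, ContDiff ℝ N (G k)) (n : ℕ) :
    ContDiff ℝ N (fun x => ladderD (fun k => G k x) n) :=
  (contDiff_const.mul (hG _)).sub (contDiff_const.mul (hG _))

/-- Wave packets are smooth: their partial derivatives are combinations of wave packets. -/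
theorem contDiff_wavePacket (m n : ℕ) {c : ℝ → ℂ} (hc : IsCutoffFun c) :
    ContDiff ℝ ∞ (wavePacket m n c) := by
  refine contDiff_infty.2 fun N => ?_
  induction N generalizing m n c with
  | zero =>
    refine contDiff_zero.2 (continuous_iff_continuousAt.2 fun x => ?_)
    exact (hasFDerivAt_wavePacket m n hc x).continuousAt
  | succ N ih =>
    push_cast
    refine contDiff_succ_iff_hasFDerivAt.2 ⟨_, ?_, hasFDerivAt_wavePacket m n hc⟩
    refine ContDiff.sum fun i _ => contDiff_const.smulRight ?_
    fin_cases i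
    · exact contDiff_const.mul ((contDiff_ladderD (fun k => ih k n hc.scaleP_mul) m).sub
        (contDiff_ladderD (fun k => ih m k hc.scaleP_mul) n))
    · exact contDiff_const.mul ((contDiff_ladderX (fun k => ih k n hc.sqrt_mul) m).add
        (contDiff_ladderX (fun k => ih m k hc.sqrt_mul) n))
    · exact ih m n hc.central_mul

theorem differentiable_wavePacket (m n : ℕ) {c : ℝ → ℂ} (hc : IsCutoffFun c) :
    Differentiable ℝ (wavePacket m n c) := (contDiff_wavePacket m n hc).differentiable (by simp)

/-- On wave packets `P` acts as differentiation in the Hermite basis, on the second index only: the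
part acting on `m` cancels against the term with `q ∂_t`. -/
theorem fieldP_wavePacket (m n : ℕ) {c : ℝ → ℂ} (hc : IsCutoffFun c) :
    fieldP (wavePacket m n c)
      = fun x => -ladderD (fun k => wavePacket m k (fun lam => (scaleP lam : ℂ) * c lam) x) n := by
  rw [fieldP, leftInvariantDeriv_eq _ _ (differentiable_wavePacket m n hc)]
  funext x
  have hK0 := fun m n => integrable_packetKernel m n hc.scaleP_mul x
  have hD1 := Integrable.ladderD (fun k => hK0 k n) m
  have hD2 := Integrable.ladderD (fun k => hK0 m k) n
  rw [(hasFDerivAt_wavePacket m n hc x).fderiv, Fin.sum_univ_three]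
  simp only [Matrix.cons_val, add_apply, ContinuousLinearMap.smulRight_apply,
    Heisenberg.coordCLM_zero_apply, Heisenberg.coordCLM_one_apply, Heisenberg.coordCLM_two_apply,
    Heisenberg.mk_p, Heisenberg.mk_q, Heisenberg.mk_t, Complex.real_smul]
  have h1 : (((x.p * 0 - 1 * x.q) / 2 : ℝ) : ℂ) *
      wavePacket m n (fun lam => 2 * Real.pi * Complex.I * lam * c lam) x
      = -(2⁻¹ * (ladderD (fun k => wavePacket k n (fun lam => (scaleP lam : ℂ) * c lam) x) m
        + ladderD (fun k => wavePacket m k (fun lam => (scaleP lam : ℂ) * c lam) x) n)) := by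
    simp only [wavePacket_eq_integral]
    rw [← integral_ladderD fun k => hK0 k n, ← integral_ladderD fun k => hK0 m k,
      ← integral_add hD1 hD2, ← integral_const_mul, ← integral_const_mul, ← integral_neg]
    refine integral_congr_ae (Eventually.of_forall fun lam => ?_)
    have h2 := mul_q_conjMat m n lam x
    have h3 := congrArg ((↑) : ℝ → ℂ) (scaleP_mul_sqrt lam)
    simp only [packetKernel, ← mul_ladderD]
    push_cast at h2 h3 ⊢
    linear_combination (-(x.q : ℂ) * Real.pi * Complex.I * √|lam| * c lam * conjMat m n lam x) * -h3
      - (2⁻¹ * √|lam| * scaleP lam * c lam) * h2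
  rw [h1]
  push_cast
  ring

/-- On wave packets `Q` acts as multiplication in the Hermite basis, on the second index only: the
part acting on `m` cancels against the term with `p ∂_t`. -/
theorem fieldQ_wavePacket (m n : ℕ) {c : ℝ → ℂ} (hc : IsCutoffFun c) :
    fieldQ (wavePacket m n c)
      = fun x => -(2 * Real.pi * Complex.I) *
        ladderX (fun k => wavePacket m k (fun lam => ((√|lam| : ℝ) : ℂ) * c lam) x) n := by
  rw [fieldQ, leftInvariantDeriv_eq _ _ (differentiable_wavePacket m n hc)]
  funext x
  have hK1 := fun m n => integrable_packetKernel m n hc.sqrt_mul x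
  have hX1 := Integrable.ladderX (fun k => hK1 k n) m
  have hX2 := Integrable.ladderX (fun k => hK1 m k) n
  rw [(hasFDerivAt_wavePacket m n hc x).fderiv, Fin.sum_univ_three]
  simp only [Matrix.cons_val, add_apply, ContinuousLinearMap.smulRight_apply,
    Heisenberg.coordCLM_zero_apply, Heisenberg.coordCLM_one_apply, Heisenberg.coordCLM_two_apply,
    Heisenberg.mk_p, Heisenberg.mk_q, Heisenberg.mk_t, Complex.real_smul]
  have h1 : (((x.p * 1 - 0 * x.q) / 2 : ℝ) : ℂ) *
      wavePacket m n (fun lam => 2 * Real.pi * Complex.I * lam * c lam) x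
      = Real.pi * Complex.I *
        (ladderX (fun k => wavePacket k n (fun lam => ((√|lam| : ℝ) : ℂ) * c lam) x) m
        - ladderX (fun k => wavePacket m k (fun lam => ((√|lam| : ℝ) : ℂ) * c lam) x) n) := by
    simp only [wavePacket_eq_integral]
    rw [← integral_ladderX fun k => hK1 k n, ← integral_ladderX fun k => hK1 m k,
      ← integral_sub hX1 hX2, ← integral_const_mul, ← integral_const_mul]
    refine integral_congr_ae (Eventually.of_forall fun lam => ?_)
    have h2 := mul_p_conjMat m n lam x
    have h3 := congrArg ((↑) : ℝ → ℂ) (scaleP_mul_sqrt lam)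
    simp only [packetKernel, ← mul_ladderX]
    push_cast at h2 h3 ⊢
    linear_combination ((x.p : ℂ) * Real.pi * Complex.I * √|lam| * c lam * conjMat m n lam x) * -h3
      + (Real.pi * Complex.I * √|lam| * √|lam| * c lam) * h2
  rw [h1]
  push_cast
  ring

theorem HasDerivAt.ladderX {G : ℕ → ℝ → ℂ} {G' : ℕ → ℂ} {t : ℝ}
    (hG : ∀ k, HasDerivAt (G k) (G' k) t) (n : ℕ) :
    HasDerivAt (fun s => ladderX (fun k => G k s) n) (ladderX G' n) t :=
  ((hG _).const_mul _).add ((hG _).const_mul _)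

theorem HasDerivAt.ladderD {G : ℕ → ℝ → ℂ} {G' : ℕ → ℂ} {t : ℝ}
    (hG : ∀ k, HasDerivAt (G k) (G' k) t) (n : ℕ) :
    HasDerivAt (fun s => ladderD (fun k => G k s) n) (ladderD G' n) t :=
  ((hG _).const_mul _).sub ((hG _).const_mul _)

theorem hasDerivAt_leftInvariantDeriv (a b : ℝ) {f : Heisenberg → ℂ} (hf : Differentiable ℝ f)
    (x : Heisenberg) : HasDerivAt (fun h : ℝ => f (x * Heisenberg.mk (h * a) (h * b) 0))
      (leftInvariantDeriv a b f x) 0 :=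
  (hasDerivAt_oneParam a b hf x).differentiableAt.hasDerivAt

theorem fieldP_fieldP_wavePacket (m n : ℕ) {c : ℝ → ℂ} (hc : IsCutoffFun c) (x : Heisenberg) :
    fieldP (fieldP (wavePacket m n c)) x = ladderD (ladderD fun k =>
      wavePacket m k (fun lam => ((|lam| : ℝ) : ℂ) * c lam) x) n := by
  have h1 := (HasDerivAt.ladderD (fun k => hasDerivAt_leftInvariantDeriv 1 0
    (differentiable_wavePacket m k hc.scaleP_mul) x) n).neg.deriv
  rw [fieldP_wavePacket m n hc]
  refine h1.trans ?_
  have h2 : ∀ lam : ℝ, (scaleP lam : ℂ) * ((scaleP lam : ℂ) * c lam)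
      = ((|lam| : ℝ) : ℂ) * c lam := by
    intro lam
    rw [← mul_assoc, ← Complex.ofReal_mul, scaleP_sq]
  have h3 : ∀ k, leftInvariantDeriv 1 0 (wavePacket m k fun lam => (scaleP lam : ℂ) * c lam) x
      = -ladderD (fun j => wavePacket m j (fun lam => ((|lam| : ℝ) : ℂ) * c lam) x) k := by
    intro k
    rw [← funext h2]
    exact congrFun (fieldP_wavePacket m k hc.scaleP_mul) x
  simp_rw [h3]
  simp only [ladderD]
  ring

theorem fieldQ_fieldQ_wavePacket (m n : ℕ) {c : ℝ → ℂ} (hc : IsCutoffFun c) (x : Heisenberg) :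
    fieldQ (fieldQ (wavePacket m n c)) x = -(4 * Real.pi ^ 2) * ladderX (ladderX fun k =>
      wavePacket m k (fun lam => ((|lam| : ℝ) : ℂ) * c lam) x) n := by
  have h1 := ((HasDerivAt.ladderX (fun k => hasDerivAt_leftInvariantDeriv 0 1
    (differentiable_wavePacket m k hc.sqrt_mul) x) n).const_mul (-(2 * Real.pi * Complex.I))).deriv
  rw [fieldQ_wavePacket m n hc]
  refine h1.trans ?_
  have h2 : ∀ lam : ℝ, ((√|lam| : ℝ) : ℂ) * (((√|lam| : ℝ) : ℂ) * c lam)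
      = ((|lam| : ℝ) : ℂ) * c lam := by
    intro lam
    rw [← mul_assoc, ← Complex.ofReal_mul, Real.mul_self_sqrt (abs_nonneg _)]
  have h3 : ∀ k, leftInvariantDeriv 0 1 (wavePacket m k fun lam => ((√|lam| : ℝ) : ℂ) * c lam) x
      = -(2 * Real.pi * Complex.I) *
        ladderX (fun j => wavePacket m j (fun lam => ((|lam| : ℝ) : ℂ) * c lam) x) k := by
    intro k
    rw [← funext h2]
    exact congrFun (fieldQ_wavePacket m k hc.sqrt_mul) x
  simp_rw [h3]
  rw [← mul_ladderX, ← mul_assoc]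
  congr 1
  linear_combination 4 * (Real.pi : ℂ) ^ 2 * Complex.I_sq

/-- Wave packets are eigenfunctions of the sub-Laplacian on each fibre, with eigenvalue
`|λ| (2n + 1)`. -/
theorem subLaplacianFun_wavePacket (m n : ℕ) {c : ℝ → ℂ} (hc : IsCutoffFun c) :
    subLaplacianFun (wavePacket m n c)
      = wavePacket m n (fun lam => (|lam| : ℝ) * (2 * n + 1) * c lam) := by
  funext x
  rw [subLaplacianFun, fieldP_fieldP_wavePacket m n hc, fieldQ_fieldQ_wavePacket m n hc]
  have hpi : (4 * (Real.pi : ℂ) ^ 2) ≠ 0 := by simp [Real.pi_ne_zero]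
  have h1 := ladderX_ladderX_sub_ladderD_ladderD
    (fun k => wavePacket m k (fun lam => ((|lam| : ℝ) : ℂ) * c lam) x) n
  rw [neg_mul, neg_div, mul_div_cancel_left₀ _ hpi, sub_neg_eq_add, neg_add_eq_sub, h1]
  simp only [wavePacket]
  rw [← integral_const_mul]
  refine integral_congr_ae (Eventually.of_forall fun lam => ?_)
  ring

/-! ### Symmetry of the sub-Laplacian -/

instance : FiniteDimensional ℝ Heisenberg := inferInstanceAs (FiniteDimensional ℝ (ℝ × ℝ × ℝ))
instance : (volume : Measure Heisenberg).IsAddHaarMeasure :=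
  Measure.prod.instIsAddHaarMeasure (volume : Measure ℝ) (volume : Measure (ℝ × ℝ))

theorem IsTestFunction.mul {f g : Heisenberg → ℂ} (hf : IsTestFunction f)
    (hg : ContDiff ℝ ∞ g) : IsTestFunction (fun x => f x * g x) :=
  ⟨hf.1.mul hg, hf.2.mul_right⟩

theorem IsTestFunction.integrable {f : Heisenberg → ℂ} (hf : IsTestFunction f) : Integrable f :=
  hf.1.continuous.integrable_of_hasCompactSupport hf.2

theorem ContDiff.leftInvariantDeriv (a b : ℝ) {f : Heisenberg → ℂ} (hf : ContDiff ℝ ∞ f) :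
    ContDiff ℝ ∞ (leftInvariantDeriv a b f) := by
  rw [leftInvariantDeriv_eq a b (hf.differentiable (by simp))]
  exact (hf.fderiv_right (by simp)).clm_apply (contDiff_direction a b)

theorem leftInvariantDeriv_mul (a b : ℝ) {f g : Heisenberg → ℂ} (hf : Differentiable ℝ f)
    (hg : Differentiable ℝ g) (x : Heisenberg) :
    leftInvariantDeriv a b (fun x => f x * g x) x
      = leftInvariantDeriv a b f x * g x + f x * leftInvariantDeriv a b g x := by
  have h := ((hasDerivAt_leftInvariantDeriv a b hf x).mul
    (hasDerivAt_leftInvariantDeriv a b hg x)).deriv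
  have h0 : x * Heisenberg.mk ((0 : ℝ) * a) ((0 : ℝ) * b) 0 = x := by
    rw [zero_mul, zero_mul]; exact mul_one x
  rw [h0] at h
  exact h

/-- Left-invariant vector fields are divergence free. -/
theorem integral_leftInvariantDeriv (a b : ℝ) {g : Heisenberg → ℂ} (hg : IsTestFunction g) :
    ∫ x, leftInvariantDeriv a b g x = 0 := by
  rw [leftInvariantDeriv_eq a b hg.differentiable]
  set l : Heisenberg →L[ℝ] ℂ := Complex.ofRealCLM.comp
    ((1 / 2 : ℝ) • (b • Heisenberg.coordCLM 0 - a • Heisenberg.coordCLM 1)) with hl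
  have hfd : ∀ v, IsTestFunction (fun x => fderiv ℝ g x v) := by
    intro v
    refine ⟨(hg.1.fderiv_right (by simp)).clm_apply contDiff_const, ?_⟩
    exact (hg.2.fderiv ℝ).mono' fun x hx => subset_tsupport _ fun h0 => hx (by simp [h0])
  -- a constant vector field plus a multiple of `∂_t` by a linear function not depending on `t`
  have hsplit : ∀ x, fderiv ℝ g x (Heisenberg.mk a b ((x.p * b - a * x.q) / 2))
      = fderiv ℝ g x (Heisenberg.mk a b 0) + l x * fderiv ℝ g x (Heisenberg.mk 0 0 1) := by
    intro x
    have h1 : Heisenberg.mk a b ((x.p * b - a * x.q) / 2)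
        = Heisenberg.mk a b 0 + ((x.p * b - a * x.q) / 2) • Heisenberg.mk 0 0 1 := by
      refine Heisenberg.ext_coord ?_ ?_ ?_
      · exact (by simp : a = a + ((x.p * b - a * x.q) / 2) * 0)
      · exact (by simp : b = b + ((x.p * b - a * x.q) / 2) * 0)
      · exact (by ring : ((x.p * b - a * x.q) / 2) = 0 + ((x.p * b - a * x.q) / 2) * 1)
    have h2 : l x = (((x.p * b - a * x.q) / 2 : ℝ) : ℂ) := by
      change (((1 / 2 : ℝ) * (b * x.p - a * x.q) : ℝ) : ℂ) = _
      congr 1; ring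
    rw [h1, map_add, map_smul, h2, Complex.real_smul]
  simp_rw [hsplit]
  have hi2 : Integrable (fun x => l x * fderiv ℝ g x (Heisenberg.mk 0 0 1)) := by
    have := ((hfd (Heisenberg.mk 0 0 1)).mul l.contDiff).integrable
    simpa only [mul_comm] using this
  have hi3 : Integrable (fun x => l x * g x) := by
    have := (hg.mul l.contDiff).integrable
    simpa only [mul_comm] using this
  rw [integral_add (hfd _).integrable hi2]
  have hl0 : ∀ x, fderiv ℝ l x (Heisenberg.mk 0 0 1) = 0 := by
    intro x
    rw [l.fderiv]
    change (((1 / 2 : ℝ) * (b * 0 - a * 0) : ℝ) : ℂ) = 0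
    simp
  have e2 := integral_mul_fderiv_eq_neg_fderiv_mul_of_integrable (f := l) (g := g)
    (v := Heisenberg.mk 0 0 1) (μ := volume)
    (by simp only [hl0, zero_mul]; exact integrable_zero _ _ _) hi2 hi3
    (fun x _ => l.differentiableAt) (fun x _ => hg.differentiable x)
  have e1 := integral_mul_fderiv_eq_neg_fderiv_mul_of_integrable (f := fun _ => (1 : ℂ)) (g := g)
    (v := Heisenberg.mk a b 0) (μ := volume) (by simp) (by simpa using (hfd _).integrable)
    (by simpa using hg.integrable)
    (fun x _ => differentiableAt_const _) (fun x _ => hg.differentiable x)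
  simp only [one_mul, fderiv_fun_const, Pi.zero_apply, zero_apply, zero_mul, integral_zero,
    neg_zero] at e1
  simp only [hl0, zero_mul, integral_zero, neg_zero] at e2
  rw [e1, e2, add_zero]

theorem integral_leftInvariantDeriv_mul (a b : ℝ) {f g : Heisenberg → ℂ} (hf : IsTestFunction f)
    (hg : ContDiff ℝ ∞ g) : ∫ x, leftInvariantDeriv a b f x * g x
      = -∫ x, f x * leftInvariantDeriv a b g x := by
  have h := integral_leftInvariantDeriv a b (hf.mul hg)
  simp_rw [leftInvariantDeriv_mul a b hf.differentiable (hg.differentiable (by simp))] at h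
  rw [integral_add ((hf.leftInvariantDeriv a b).mul hg).integrable
    (hf.mul (hg.leftInvariantDeriv a b)).integrable] at h
  exact eq_neg_of_add_eq_zero_left h

/-- The sub-Laplacian is symmetric for the bilinear pairing of test functions with smooth
functions. -/
theorem integral_subLaplacianFun_mul {f g : Heisenberg → ℂ} (hf : IsTestFunction f)
    (hg : ContDiff ℝ ∞ g) :
    ∫ x, subLaplacianFun f x * g x = ∫ x, f x * subLaplacianFun g x := by
  have h : ∀ a b, ∫ x, leftInvariantDeriv a b (leftInvariantDeriv a b f) x * g x
      = ∫ x, f x * leftInvariantDeriv a b (leftInvariantDeriv a b g) x := by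
    intro a b
    rw [integral_leftInvariantDeriv_mul a b (hf.leftInvariantDeriv a b) hg,
      integral_leftInvariantDeriv_mul a b hf (hg.leftInvariantDeriv a b), neg_neg]
  have e1 : ∀ x, subLaplacianFun f x * g x = -(fieldP (fieldP f) x * g x)
      + -(1 / (4 * Real.pi ^ 2)) * (fieldQ (fieldQ f) x * g x) := by
    intro x; rw [subLaplacianFun]; ring
  have e2 : ∀ x, f x * subLaplacianFun g x = -(f x * fieldP (fieldP g) x)
      + -(1 / (4 * Real.pi ^ 2)) * (f x * fieldQ (fieldQ g) x) := by
    intro x; rw [subLaplacianFun]; ring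
  simp_rw [e1, e2]
  rw [integral_add, integral_add, integral_neg, integral_neg, integral_const_mul,
    integral_const_mul, h, h]
  · exact (hf.mul ((hg.leftInvariantDeriv _ _).leftInvariantDeriv _ _)).integrable.neg
  · exact (hf.mul ((hg.leftInvariantDeriv _ _).leftInvariantDeriv _ _)).integrable.const_mul _
  · exact (((hf.leftInvariantDeriv _ _).leftInvariantDeriv _ _).mul hg).integrable.neg
  · exact (((hf.leftInvariantDeriv _ _).leftInvariantDeriv _ _).mul hg).integrable.const_mul _

theorem leftInvariantDeriv_conj (a b : ℝ) (f : Heisenberg → ℂ) :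
    leftInvariantDeriv a b (fun x => (starRingEnd ℂ) (f x))
      = fun x => (starRingEnd ℂ) (leftInvariantDeriv a b f x) :=
  funext fun _ => deriv.star

theorem subLaplacianFun_conj (f : Heisenberg → ℂ) :
    subLaplacianFun (fun x => (starRingEnd ℂ) (f x))
      = fun x => (starRingEnd ℂ) (subLaplacianFun f x) := by
  funext x
  simp only [subLaplacianFun, fieldP, fieldQ, leftInvariantDeriv_conj]
  simp [Complex.conj_ofNat]

/-! ### Wave packets lie in the domain of the closure -/

/-- The automorphic dilation `(p, q, t) ↦ (sp, sq, s²t)`. -/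
def Heisenberg.dilate (s : ℝ) (x : Heisenberg) : Heisenberg :=
  Heisenberg.mk (s * x.p) (s * x.q) (s ^ 2 * x.t)

namespace Heisenberg

theorem dilate_mul (s : ℝ) (x y : Heisenberg) : dilate s (x * y) = dilate s x * dilate s y := by
  refine ext_coord ?_ ?_ ?_
  · exact mul_add _ _ _
  · exact mul_add _ _ _
  · change s ^ 2 * (x.t + y.t + (x.p * y.q - y.p * x.q) / 2)
      = s ^ 2 * x.t + s ^ 2 * y.t + (s * x.p * (s * y.q) - s * y.p * (s * x.q)) / 2
    ring

theorem contDiff_dilate (s : ℝ) : ContDiff ℝ ∞ (dilate s) := by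
  have h : ContDiff ℝ ∞ (fun x : ℝ × ℝ × ℝ => (s * x.1, s * x.2.1, s ^ 2 * x.2.2)) := by fun_prop
  exact h

theorem dilate_dilate (s r : ℝ) (x : Heisenberg) : dilate s (dilate r x) = dilate (s * r) x := by
  refine ext_coord ?_ ?_ ?_
  · exact (mul_assoc _ _ _).symm
  · exact (mul_assoc _ _ _).symm
  · change s ^ 2 * (r ^ 2 * x.t) = (s * r) ^ 2 * x.t
    ring

theorem dilate_one (x : Heisenberg) : dilate 1 x = x := by
  refine ext_coord ?_ ?_ ?_
  · exact one_mul _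
  · exact one_mul _
  · change 1 ^ 2 * x.t = x.t
    ring

theorem tendsto_dilate (x : Heisenberg) : Tendsto (fun s => dilate s x) (𝓝 0) (𝓝 0) := by
  have h : Continuous (fun s : ℝ => dilate s x) := by
    have : Continuous (fun s : ℝ => ((s * x.p, s * x.q, s ^ 2 * x.t) : ℝ × ℝ × ℝ)) := by fun_prop
    exact this
  have h2 := h.tendsto 0
  have h3 : dilate 0 x = 0 := by
    refine ext_coord ?_ ?_ ?_
    · exact zero_mul _
    · exact zero_mul _
    · exact (by ring : (0 : ℝ) ^ 2 * x.t = 0)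
  rwa [h3] at h2

end Heisenberg

theorem IsTestFunction.comp_dilate {f : Heisenberg → ℂ} (hf : IsTestFunction f) {s : ℝ}
    (hs : s ≠ 0) : IsTestFunction (fun x => f (Heisenberg.dilate s x)) := by
  refine ⟨hf.1.comp (Heisenberg.contDiff_dilate s), ?_⟩
  refine HasCompactSupport.intro
    (hf.2.isCompact.image (Heisenberg.contDiff_dilate s⁻¹).continuous) fun x hx => ?_
  by_contra h0
  refine hx ⟨Heisenberg.dilate s x, subset_tsupport _ h0, ?_⟩
  rw [Heisenberg.dilate_dilate, inv_mul_cancel₀ hs, Heisenberg.dilate_one]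

theorem leftInvariantDeriv_comp_dilate (a b : ℝ) {f : Heisenberg → ℂ} (hf : Differentiable ℝ f)
    (s : ℝ) (x : Heisenberg) :
    leftInvariantDeriv a b (fun x => f (Heisenberg.dilate s x)) x
      = s * leftInvariantDeriv a b f (Heisenberg.dilate s x) := by
  have h1 := hasDerivAt_leftInvariantDeriv a b hf (Heisenberg.dilate s x)
  have h2 : HasDerivAt (fun h : ℝ => s * h) s 0 := by
    simpa using (hasDerivAt_id (0 : ℝ)).const_mul s
  rw [← mul_zero s] at h1
  have h3 := (h1.scomp (0 : ℝ) h2).deriv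
  rw [Complex.real_smul] at h3
  rw [← h3, leftInvariantDeriv]
  congr 1
  funext h
  simp only [Function.comp_apply]
  rw [Heisenberg.dilate_mul]
  congr 2
  refine Heisenberg.ext_coord ?_ ?_ ?_
  · simp [Heisenberg.dilate, mul_assoc]
  · simp [Heisenberg.dilate, mul_assoc]
  · simp [Heisenberg.dilate]

theorem subLaplacianFun_mul {f g : Heisenberg → ℂ} (hf : ContDiff ℝ ∞ f) (hg : ContDiff ℝ ∞ g)
    (x : Heisenberg) : subLaplacianFun (fun x => f x * g x) x
      = f x * subLaplacianFun g x + -2 * fieldP f x * fieldP g x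
        + -(1 / (2 * Real.pi ^ 2)) * fieldQ f x * fieldQ g x + subLaplacianFun f x * g x := by
  have hd := fun {u : Heisenberg → ℂ} (h : ContDiff ℝ ∞ u) => h.differentiable (by simp)
  have key : ∀ a b, leftInvariantDeriv a b (leftInvariantDeriv a b (fun x => f x * g x)) x
      = leftInvariantDeriv a b (leftInvariantDeriv a b f) x * g x
        + 2 * leftInvariantDeriv a b f x * leftInvariantDeriv a b g x
        + f x * leftInvariantDeriv a b (leftInvariantDeriv a b g) x := by
    intro a b
    have hf' := hf.leftInvariantDeriv a b
    have hg' := hg.leftInvariantDeriv a b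
    rw [funext (leftInvariantDeriv_mul a b (hd hf) (hd hg))]
    have h0 : x * Heisenberg.mk ((0 : ℝ) * a) ((0 : ℝ) * b) 0 = x := by
      rw [zero_mul, zero_mul]; exact mul_one x
    have h1 := (((hasDerivAt_leftInvariantDeriv a b (hd hf') x).mul
      (hasDerivAt_leftInvariantDeriv a b (hd hg) x)).add
      ((hasDerivAt_leftInvariantDeriv a b (hd hf) x).mul
      (hasDerivAt_leftInvariantDeriv a b (hd hg') x))).deriv
    rw [h0] at h1
    refine h1.trans ?_
    ring
  simp only [subLaplacianFun, fieldP, fieldQ] at key ⊢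
  rw [key 1 0, key 0 1]
  ring

/-- Multiplication by bounded functions converging pointwise to a constant converges strongly in
`L²`. -/
theorem tendsto_toLp_mul {v : Heisenberg → ℂ} (hv : MemLp v 2 volume) {w : ℕ → Heisenberg → ℂ}
    {C : ℝ} {l : ℂ} (hC : ∀ k x, ‖w k x‖ ≤ C)
    (hl : ∀ x, Tendsto (fun k => w k x) atTop (𝓝 l))
    (h : ∀ k, MemLp (fun x => w k x * v x) 2 volume) :
    Tendsto (fun k => (h k).toLp _) atTop (𝓝 (l • hv.toLp v)) := by
  refine tendsto_L2_of_lintegral ?_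
  have e : ∀ k, ∫⁻ x, ‖(h k).toLp _ x - (l • hv.toLp v : L2H) x‖ₑ ^ 2
      = ∫⁻ x, ‖w k x * v x - l * v x‖ₑ ^ 2 := by
    intro k
    refine lintegral_congr_ae ?_
    filter_upwards [(h k).coeFn_toLp, Lp.coeFn_smul l (hv.toLp v), hv.coeFn_toLp] with x h1 h2 h3
    rw [h1, h2, Pi.smul_apply, h3, smul_eq_mul]
  simp_rw [e]
  have hlC : ‖l‖ ≤ C := le_of_tendsto (hl 0).norm (Eventually.of_forall fun k => hC k 0)
  have hlim := tendsto_lintegral_of_dominated_convergence'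
    (μ := (volume : Measure Heisenberg)) (F := fun k x => ‖w k x * v x - l * v x‖ₑ ^ 2)
    (f := fun _ => 0) (fun x => ENNReal.ofReal (2 * C) ^ 2 * ‖v x‖ₑ ^ 2)
    (fun k => ((h k).1.sub (hv.1.const_mul l)).enorm.pow_const 2)
    (fun k => Eventually.of_forall fun x => ?_) ?_ (Eventually.of_forall fun x => ?_)
  · simpa using hlim
  · change ‖w k x * v x - l * v x‖ₑ ^ 2 ≤ ENNReal.ofReal (2 * C) ^ 2 * ‖v x‖ₑ ^ 2
    rw [← sub_mul, enorm_mul, mul_pow]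
    gcongr
    rw [← ofReal_norm]
    refine ENNReal.ofReal_le_ofReal ((norm_sub_le _ _).trans ?_)
    linarith [hC k x]
  · rw [lintegral_const_mul' _ _ (ENNReal.pow_ne_top ENNReal.ofReal_ne_top)]
    exact ENNReal.mul_ne_top (ENNReal.pow_ne_top ENNReal.ofReal_ne_top)
      (lintegral_enorm_sq_lt_top hv).ne
  · have h1 : Tendsto (fun k => w k x * v x - l * v x) atTop (𝓝 0) := by
      simpa using ((hl x).mul_const (v x)).sub_const (l * v x)
    have h2 := ENNReal.Tendsto.pow (n := 2) h1.enorm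
    simpa using h2

theorem mem_graph_subLaplacianCore {f : Heisenberg → ℂ} (hf : IsTestFunction f) :
    (hf.memLp.toLp f, hf.subLaplacianFun.memLp.toLp _) ∈ subLaplacianCore.graph := by
  have hmem : hf.memLp.toLp f ∈ testSubmodule := ⟨f, hf, hf.memLp.coeFn_toLp⟩
  rw [LinearPMap.mem_graph_iff]
  refine ⟨⟨_, hmem⟩, rfl, ?_⟩
  have h1 : testRep ⟨_, hmem⟩ = f := (isTestFunction_testRep _).eq_of_ae hf
    ((coeFn_ae_eq_testRep ⟨_, hmem⟩).symm.trans hf.memLp.coeFn_toLp)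
  change (isTestFunction_testRep ⟨_, hmem⟩).subLaplacianFun.memLp.toLp _ = _
  rw [MemLp.toLp_eq_toLp_iff, h1]

theorem IsTestFunction.exists_bound {f : Heisenberg → ℂ} (hf : IsTestFunction f) :
    ∃ C, ∀ x, ‖f x‖ ≤ C := hf.1.continuous.bounded_above_of_compact_support hf.2

theorem IsTestFunction.mul_memLp {f v : Heisenberg → ℂ} (hf : IsTestFunction f)
    (hv : MemLp v 2 volume) : MemLp (fun x => f x * v x) 2 volume := by
  obtain ⟨C, hC⟩ := hf.exists_bound
  refine MemLp.of_le (hv.const_mul (C : ℂ)) (hf.1.continuous.aestronglyMeasurable.mul hv.1)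
    (Eventually.of_forall fun x => ?_)
  rw [norm_mul, norm_mul, Complex.norm_real]
  exact mul_le_mul_of_nonneg_right ((hC x).trans (le_abs_self C)) (norm_nonneg _)

/-- A smooth `φ` with `φ`, `Pφ`, `Qφ`, `𝓛φ` in `L²` lies in the domain of the closure of the
sub-Laplacian: multiply by dilated cutoff functions. -/
theorem mem_closure_graph_subLaplacianCore {v : Heisenberg → ℂ} (hv : ContDiff ℝ ∞ v)
    (h0 : MemLp v 2 volume) (hP : MemLp (fieldP v) 2 volume) (hQ : MemLp (fieldQ v) 2 volume)
    (hL : MemLp (subLaplacianFun v) 2 volume) :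
    (h0.toLp v, hL.toLp _) ∈ subLaplacianCore.graph.topologicalClosure := by
  let χb : ContDiffBump (0 : Heisenberg) := ⟨1, 2, one_pos, one_lt_two⟩
  set χ : Heisenberg → ℂ := fun x => ((χb x : ℝ) : ℂ) with hχ
  have hχt : IsTestFunction χ := by
    refine ⟨Complex.ofRealCLM.contDiff.comp χb.contDiff, ?_⟩
    exact χb.hasCompactSupport.comp_left (g := ((↑) : ℝ → ℂ)) Complex.ofReal_zero
  have hχ0 : χ 0 = 1 := by
    simp only [hχ]
    rw [χb.one_of_mem_closedBall (Metric.mem_closedBall_self χb.rIn_pos.le), Complex.ofReal_one]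
  have hPχ := hχt.leftInvariantDeriv 1 0
  have hQχ := hχt.leftInvariantDeriv 0 1
  have hLχ := hχt.subLaplacianFun
  set s : ℕ → ℝ := fun k => 1 / ((k : ℝ) + 1) with hs
  have hs0 : ∀ k, s k ≠ 0 := fun k => by positivity
  have hs1 : ∀ k, |s k| ≤ 1 := fun k => by
    rw [abs_of_nonneg (by positivity), hs]
    exact (div_le_one (by positivity)).2 (by linarith [(Nat.cast_nonneg k : (0 : ℝ) ≤ k)])
  have hst : Tendsto s atTop (𝓝 0) := tendsto_one_div_add_atTop_nhds_zero_nat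
  set W : (Heisenberg → ℂ) → ℕ → Heisenberg → ℂ := fun f k x => f (Heisenberg.dilate (s k) x)
  have hWt : ∀ {f}, IsTestFunction f → ∀ k, IsTestFunction (W f k) := fun hf k =>
    hf.comp_dilate (hs0 k)
  have hWb : ∀ {f}, IsTestFunction f → ∃ C, ∀ k x, ‖W f k x‖ ≤ C := fun hf => by
    obtain ⟨C, hC⟩ := hf.exists_bound
    exact ⟨C, fun k x => hC _⟩
  have hWl : ∀ {f}, IsTestFunction f → ∀ x, Tendsto (fun k => W f k x) atTop (𝓝 (f 0)) :=
    fun hf x => (hf.1.continuous.tendsto 0).comp ((Heisenberg.tendsto_dilate x).comp hst)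
  -- the terms carrying a derivative of the cutoff have a factor `s k`, which tends to zero
  have hsmall : ∀ {f v : Heisenberg → ℂ} (hf : IsTestFunction f) (hv : MemLp v 2 volume) (z : ℂ)
      (j : ℕ), j ≠ 0 → ∃ h : ∀ k, MemLp (fun x => (z * (s k : ℂ) ^ j * W f k x) * v x) 2 volume,
      Tendsto (fun k => (h k).toLp _) atTop (𝓝 (0 : L2H)) := by
    intro f v hf hv z j hj
    refine ⟨fun k => ((hWt hf k).smul (z * (s k : ℂ) ^ j)).mul_memLp hv, ?_⟩
    obtain ⟨C, hC⟩ := hWb hf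
    rw [← zero_smul ℂ (hv.toLp v)]
    refine tendsto_toLp_mul hv (C := ‖z‖ * C) (fun k x => ?_) (fun x => ?_) _
    · rw [norm_mul, norm_mul, norm_pow, Complex.norm_real]
      have h1 : ‖s k‖ ^ j ≤ 1 := pow_le_one₀ (norm_nonneg _) (hs1 k)
      calc ‖z‖ * ‖s k‖ ^ j * ‖W f k x‖ ≤ ‖z‖ * 1 * C := by
            gcongr
            exact hC k x
        _ = _ := by ring
    · have h1 : Tendsto (fun k => (s k : ℂ)) atTop (𝓝 ((0 : ℝ) : ℂ)) :=
        (Complex.continuous_ofReal.tendsto 0).comp hst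
      rw [Complex.ofReal_zero] at h1
      have h2 := ((h1.pow j).const_mul z).mul (hWl hf x)
      simpa [hj] using h2
  obtain ⟨m1, l1⟩ := hsmall hPχ hP (-2) 1 one_ne_zero
  obtain ⟨m2, l2⟩ := hsmall hQχ hQ (-(1 / (2 * Real.pi ^ 2))) 1 one_ne_zero
  obtain ⟨m3, l3⟩ := hsmall hLχ h0 1 2 two_ne_zero
  obtain ⟨C, hC⟩ := hWb hχt
  have m0 : ∀ k, MemLp (fun x => W χ k x * v x) 2 volume := fun k => (hWt hχt k).mul_memLp h0
  have m0' : ∀ k, MemLp (fun x => W χ k x * subLaplacianFun v x) 2 volume := fun k =>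
    (hWt hχt k).mul_memLp hL
  have l0 := tendsto_toLp_mul h0 hC (fun x => hWl hχt x) m0
  have l0' := tendsto_toLp_mul hL hC (fun x => hWl hχt x) m0'
  rw [hχ0, one_smul] at l0 l0'
  have hlim := ((l0'.add l1).add l2).add l3
  rw [add_zero, add_zero, add_zero] at hlim
  refine mem_closure_of_tendsto (l0.prodMk_nhds hlim) (Eventually.of_forall fun k => ?_)
  have ht := (hWt hχt k).mul hv
  convert! mem_graph_subLaplacianCore ht using 2
  rw [← MemLp.toLp_add, ← MemLp.toLp_add, ← MemLp.toLp_add, MemLp.toLp_eq_toLp_iff]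
  refine Eventually.of_forall fun x => ?_
  have e := fun a b => leftInvariantDeriv_comp_dilate a b hχt.differentiable (s k)
  have e' := fun a b => leftInvariantDeriv_comp_dilate a b
    (hχt.leftInvariantDeriv a b).differentiable (s k) x
  have e2 : ∀ a b, leftInvariantDeriv a b (leftInvariantDeriv a b (W χ k)) x
      = (s k : ℂ) ^ 2 * W (leftInvariantDeriv a b (leftInvariantDeriv a b χ)) k x := by
    intro a b
    rw [funext (e a b)]
    have h1 := leftInvariantDeriv_smul a b (s k : ℂ)
      ((hχt.leftInvariantDeriv a b).comp_dilate (hs0 k))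
    have h2 := congrFun h1 x
    rw [Pi.smul_apply, e', smul_eq_mul] at h2
    refine h2.trans ?_
    ring
  rw [subLaplacianFun_mul (hWt hχt k).1 hv]
  simp only [Pi.add_apply]
  rw [fieldP, fieldQ, e 1 0 x, e 0 1 x]
  simp only [subLaplacianFun, fieldP, fieldQ, e2]
  simp only [W, subLaplacianFun, fieldP, fieldQ]
  ring

/-! ### The sub-Laplacian as a multiplication operator -/

/-- The spectral symbol `|λ| (2n + 1)` of the sub-Laplacian. -/
def oscillatorSymbol (z : ℝ × ℕ × ℕ) : ℝ := |z.1| * (2 * z.2.2 + 1)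

theorem measurable_oscillatorSymbol : Measurable oscillatorSymbol := by
  unfold oscillatorSymbol
  have : Measurable (fun z : ℝ × ℕ × ℕ => ((z.2.2 : ℕ) : ℝ)) :=
    measurable_from_top.comp (measurable_snd.comp measurable_snd)
  fun_prop

theorem memLp_fieldP_wavePacket (m n : ℕ) {c : ℝ → ℂ} (hc : IsCutoffFun c) :
    MemLp (fieldP (wavePacket m n c)) 2 volume := by
  rw [fieldP_wavePacket m n hc]
  exact (((memLp_wavePacket m _ hc.scaleP_mul).const_mul _).sub
    ((memLp_wavePacket m _ hc.scaleP_mul).const_mul _)).neg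

theorem memLp_fieldQ_wavePacket (m n : ℕ) {c : ℝ → ℂ} (hc : IsCutoffFun c) :
    MemLp (fieldQ (wavePacket m n c)) 2 volume := by
  rw [fieldQ_wavePacket m n hc]
  exact (((memLp_wavePacket m _ hc.sqrt_mul).const_mul _).add
    ((memLp_wavePacket m _ hc.sqrt_mul).const_mul _)).const_mul _

theorem packet_mem_closure_graph (m n : ℕ) {c : ℝ → ℂ} (hc : IsCutoffFun c) :
    (packet m n hc, packet m n (hc.abs_mul (2 * n + 1)))
      ∈ subLaplacianCore.graph.topologicalClosure := by
  have hL : MemLp (subLaplacianFun (wavePacket m n c)) 2 volume := by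
    rw [subLaplacianFun_wavePacket m n hc]
    exact memLp_wavePacket m n (hc.abs_mul (2 * n + 1))
  convert! mem_closure_graph_subLaplacianCore (contDiff_wavePacket m n hc)
    (memLp_wavePacket m n hc) (memLp_fieldP_wavePacket m n hc) (memLp_fieldQ_wavePacket m n hc) hL
    using 2
  rw [packet, MemLp.toLp_eq_toLp_iff, subLaplacianFun_wavePacket m n hc]

/-- The closed subspace of pairs `(u, v)` such that `v = 𝓛u` holds weakly against all wave
packets. -/
def weakGraph : Submodule ℂ (L2H × L2H) where
  carrier := {w | ∀ m n c (hc : IsCutoffFun c), inner ℂ (packet m n hc) w.2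
    = inner ℂ (packet m n (hc.abs_mul (2 * n + 1))) w.1}
  add_mem' := by
    intro v w hv hw m n c hc
    rw [Prod.snd_add, Prod.fst_add, inner_add_right, inner_add_right, hv, hw]
  zero_mem' := by
    intro m n c hc
    rw [Prod.snd_zero, Prod.fst_zero, inner_zero_right, inner_zero_right]
  smul_mem' := by
    intro z w hw m n c hc
    rw [Prod.smul_snd, Prod.smul_fst, inner_smul_right, inner_smul_right, hw]

theorem isClosed_weakGraph : IsClosed (weakGraph : Set (L2H × L2H)) := by
  have : (weakGraph : Set (L2H × L2H)) = ⋂ (m) (n) (c) (hc : IsCutoffFun c),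
      {w | inner ℂ (packet m n hc) w.2 = inner ℂ (packet m n (hc.abs_mul (2 * n + 1))) w.1} := by
    ext w
    simp only [Set.mem_iInter]
    rfl
  rw [this]
  refine isClosed_iInter fun m => isClosed_iInter fun n => isClosed_iInter fun c =>
    isClosed_iInter fun hc => isClosed_eq ?_ ?_
  · exact continuous_const.inner continuous_snd
  · exact continuous_const.inner continuous_fst

theorem memLp_sheet_section (u : L2X) (k : ℕ × ℕ) :
    MemLp (fun lam => u (lam, k)) 2 (volume : Measure ℝ) := by
  have hm := (Lp.stronglyMeasurable u).measurable
  refine memLp_two_of_lintegral_lt_top (hm.comp measurable_prodMk_right).aestronglyMeasurable ?_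
  refine lt_of_le_of_lt ?_ (lintegral_enorm_sq_lt_top (Lp.memLp u))
  rw [lintegral_coeffMeasure (hm.enorm.pow_const 2)]
  exact ENNReal.le_tsum (f := fun k => ∫⁻ lam, ‖u (lam, k)‖ₑ ^ 2) k

theorem IsCutoffFun.integrable_conj_mul_section {c : ℝ → ℂ} (hc : IsCutoffFun c) (u : L2X)
    (k : ℕ × ℕ) : Integrable (fun lam => (starRingEnd ℂ) (c lam) * u (lam, k)) :=
  hc.conj.memLp.integrable_mul (memLp_sheet_section u k)

theorem inner_packet_eq_integral (m n : ℕ) {c : ℝ → ℂ} (hc : IsCutoffFun c) (u : L2H) :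
    inner ℂ (packet m n hc) u
      = ∫ lam, (starRingEnd ℂ) (c lam) * coeffEquiv u (lam, (m, n)) := by
  rw [inner_packet, inner_sheet m n hc (EventuallyEq.refl _ _)]
  rfl

theorem mem_weakGraph_iff {u v : L2H} : (u, v) ∈ weakGraph ↔
    coeffEquiv v =ᵐ[coeffMeasure] fun z => (oscillatorSymbol z : ℂ) * coeffEquiv u z := by
  have hconj : ∀ (n : ℕ) (c : ℝ → ℂ) (lam : ℝ),
      (starRingEnd ℂ) ((|lam| : ℝ) * (2 * n + 1) * c lam)
        = (starRingEnd ℂ) (c lam) * ((|lam| * (2 * n + 1) : ℝ) : ℂ) := by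
    intro n c lam
    simp only [map_mul, map_add, map_one, Complex.conj_ofReal, Complex.conj_natCast,
      Complex.conj_ofNat]
    push_cast; ring
  constructor
  · intro h
    have hum := (Lp.stronglyMeasurable (coeffEquiv u)).measurable
    have hvm := (Lp.stronglyMeasurable (coeffEquiv v)).measurable
    have hg : Measurable (fun z => coeffEquiv v z - (oscillatorSymbol z : ℂ) * coeffEquiv u z) :=
      hvm.sub ((Complex.measurable_ofReal.comp measurable_oscillatorSymbol).mul hum)
    have h0 := ae_eq_zero_of_sheets hg fun m n c hc => by
      have h1 := h m n c hc
      have hi := (hc.abs_mul (2 * n + 1)).integrable_conj_mul_section (coeffEquiv u) (m, n)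
      rw [inner_packet_eq_integral, inner_packet_eq_integral, ← sub_eq_zero, ← integral_sub
        (hc.integrable_conj_mul_section _ _) hi] at h1
      rw [← h1]
      refine integral_congr_ae (Eventually.of_forall fun lam => ?_)
      simp only [hconj, oscillatorSymbol]
      ring
    filter_upwards [h0] with z hz
    exact sub_eq_zero.1 hz
  · intro h m n c hc
    rw [inner_packet, inner_sheet m n hc (u := coeffTransform v) h, inner_packet_eq_integral]
    refine integral_congr_ae (Eventually.of_forall fun lam => ?_)
    simp only [hconj, oscillatorSymbol]
    ring

theorem graph_subLaplacianCore_le : subLaplacianCore.graph ≤ weakGraph := by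
  rintro ⟨u, v⟩ huv m n c hc
  rw [LinearPMap.mem_graph_iff] at huv
  obtain ⟨w, rfl : (w : L2H) = u, rfl : subLaplacianCore w = v⟩ := huv
  have hf := isTestFunction_testRep w
  have hφ := contDiff_wavePacket m n hc
  have hφc : ContDiff ℝ ∞ (fun x => (starRingEnd ℂ) (wavePacket m n c x)) :=
    Complex.conjCLE.contDiff.comp hφ
  have h1 := integral_subLaplacianFun_mul hf hφc
  rw [subLaplacianFun_conj, subLaplacianFun_wavePacket m n hc] at h1
  have hd : (subLaplacianCore w : L2H) = hf.subLaplacianFun.memLp.toLp _ := rfl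
  rw [inner_L2_eq, inner_L2_eq, hd]
  have e1 : ∫ x, (starRingEnd ℂ) (packet m n hc x) * hf.subLaplacianFun.memLp.toLp _ x
      = ∫ x, subLaplacianFun (testRep w) x * (starRingEnd ℂ) (wavePacket m n c x) := by
    refine integral_congr_ae ?_
    filter_upwards [(memLp_wavePacket m n hc).coeFn_toLp,
      hf.subLaplacianFun.memLp.coeFn_toLp] with x h2 h3
    rw [packet, h2, h3, mul_comm]
  have e2 : ∫ x, (starRingEnd ℂ) (packet m n (hc.abs_mul (2 * n + 1)) x) * (w : L2H) x
      = ∫ x, testRep w x * (starRingEnd ℂ)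
        (wavePacket m n (fun lam => (|lam| : ℝ) * (2 * n + 1) * c lam) x) := by
    refine integral_congr_ae ?_
    filter_upwards [(memLp_wavePacket m n (hc.abs_mul (2 * n + 1))).coeFn_toLp,
      coeFn_ae_eq_testRep w] with x h2 h3
    rw [packet, h2, h3, mul_comm]
  exact e1.trans (h1.trans e2.symm)

/-- The closure of the graph of the sub-Laplacian on test functions is the full weak graph: an
element of the weak graph orthogonal to all pairs `(φ, 𝓛φ)` with `φ` a wave packet vanishes. -/
theorem closure_graph_subLaplacianCore :
    subLaplacianCore.graph.topologicalClosure = weakGraph := by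
  refine le_antisymm (Submodule.topologicalClosure_minimal _ graph_subLaplacianCore_le
    isClosed_weakGraph) ?_
  set e := WithLp.prodContinuousLinearEquiv 2 ℂ L2H L2H with he
  set G : Submodule ℂ (WithLp 2 (L2H × L2H)) :=
    subLaplacianCore.graph.topologicalClosure.comap (e : WithLp 2 (L2H × L2H) →ₗ[ℂ] L2H × L2H)
  set M : Submodule ℂ (WithLp 2 (L2H × L2H)) :=
    weakGraph.comap (e : WithLp 2 (L2H × L2H) →ₗ[ℂ] L2H × L2H)
  have hGM : G ≤ M := Submodule.comap_mono
    (Submodule.topologicalClosure_minimal _ graph_subLaplacianCore_le isClosed_weakGraph)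
  have hG : IsClosed (G : Set (WithLp 2 (L2H × L2H))) :=
    (Submodule.isClosed_topologicalClosure _).preimage e.continuous
  have : CompleteSpace G := hG.completeSpace_coe
  -- orthogonality in the graph inner product to all `(φ, 𝓛φ)` gives `(1 + a²) Uu = 0`, where `a` is
  -- the symbol and `U` the coefficient transform
  have hbot : Gᗮ ⊓ M = ⊥ := by
    rw [Submodule.eq_bot_iff]
    rintro w ⟨hw1, hw2⟩
    have hw2' := mem_weakGraph_iff.1 (show (w.fst, w.snd) ∈ weakGraph from hw2)
    have hum := (Lp.stronglyMeasurable (coeffEquiv w.fst)).measurable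
    have hg : Measurable (fun z => coeffEquiv w.fst z
        + (oscillatorSymbol z : ℂ) * ((oscillatorSymbol z : ℂ) * coeffEquiv w.fst z)) := by
      have ho := Complex.measurable_ofReal.comp measurable_oscillatorSymbol
      exact hum.add (ho.mul (ho.mul hum))
    have h0 := ae_eq_zero_of_sheets hg fun m n c hc => by
      have hmem : e.symm (packet m n hc, packet m n (hc.abs_mul (2 * n + 1))) ∈ G := by
        change e (e.symm _) ∈ subLaplacianCore.graph.topologicalClosure
        rw [e.apply_symm_apply]
        exact packet_mem_closure_graph m n hc
      have h1 := (Submodule.mem_orthogonal _ _).1 hw1 _ hmem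
      rw [WithLp.prod_inner_apply] at h1
      change inner ℂ (packet m n hc) w.fst
        + inner ℂ (packet m n (hc.abs_mul (2 * n + 1))) w.snd = 0 at h1
      have hi := (hc.abs_mul (2 * n + 1)).integrable_conj_mul_section (coeffEquiv w.snd) (m, n)
      rw [inner_packet_eq_integral, inner_packet_eq_integral, ← integral_add
        (hc.integrable_conj_mul_section _ _) hi] at h1
      rw [← h1]
      refine integral_congr_ae ?_
      filter_upwards [ae_coeffMeasure_iff.1 hw2'] with lam hlam
      rw [hlam (m, n)]
      simp only [map_mul, map_add, map_one, Complex.conj_ofReal, Complex.conj_natCast,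
        Complex.conj_ofNat, oscillatorSymbol]
      push_cast; ring
    have hu : w.fst = 0 := by
      rw [← coeffEquiv.map_eq_zero_iff, Lp.eq_zero_iff_ae_eq_zero]
      filter_upwards [h0] with z hz
      have h2 : ((1 + oscillatorSymbol z ^ 2 : ℝ) : ℂ) * coeffEquiv w.fst z = 0 := by
        refine Eq.trans ?_ hz
        push_cast; ring
      rcases mul_eq_zero.1 h2 with h3 | h3
      · rw [Complex.ofReal_eq_zero] at h3
        nlinarith [sq_nonneg (oscillatorSymbol z)]
      · exact h3
    have hv : w.snd = 0 := by
      rw [← coeffEquiv.map_eq_zero_iff, Lp.eq_zero_iff_ae_eq_zero]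
      filter_upwards [hw2', Lp.eq_zero_iff_ae_eq_zero.1
        (coeffEquiv.map_eq_zero_iff.2 hu)] with z h1 h2
      rw [h1, h2]; simp
    exact e.injective (Prod.ext hu hv)
  have hGM' : G = M := by
    have := Submodule.sup_orthogonal_inf_of_hasOrthogonalProjection hGM
    rwa [hbot, sup_bot_eq] at this
  intro w hw
  have h1 : e.symm w ∈ M := by
    change e (e.symm w) ∈ weakGraph
    rwa [e.apply_symm_apply]
  rw [← hGM'] at h1
  change e (e.symm w) ∈ subLaplacianCore.graph.topologicalClosure at h1
  rwa [e.apply_symm_apply] at h1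

/-- Under the coefficient transform, the sub-Laplacian becomes multiplication by
`|λ| (2n + 1)`. -/
theorem isMultiplication_subLaplacian :
    IsMultiplication coeffEquiv oscillatorSymbol subLaplacian := by
  have hcl : subLaplacianCore.IsClosable := by
    refine ⟨weakGraph.toLinearPMap, ?_⟩
    rw [closure_graph_subLaplacianCore, Submodule.toLinearPMap_graph_eq]
    rintro ⟨u, v⟩ hw (rfl : u = 0)
    rw [mem_weakGraph_iff, map_zero] at hw
    change v = 0
    rw [← coeffEquiv.map_eq_zero_iff, Lp.eq_zero_iff_ae_eq_zero]
    filter_upwards [hw, Lp.coeFn_zero ℂ 2 coeffMeasure] with z h1 h2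
    rw [h1, h2]; simp
  intro u v
  rw [subLaplacian, ← hcl.graph_closure_eq_closure_graph, closure_graph_subLaplacianCore,
    mem_weakGraph_iff]

/-! ### Plancherel transforms and their coefficients -/

theorem ext_of_hilbertBasis {H ι : Type*} [NormedAddCommGroup H] [InnerProductSpace ℂ H]
    (b : HilbertBasis ι ℂ H) {S T : H →L[ℂ] H}
    (h : ∀ i j, inner ℂ (b i) (S (b j)) = inner ℂ (b i) (T (b j))) : S = T := by
  have h1 : ∀ j, S (b j) = T (b j) := fun j => by
    refine b.repr.injective ?_
    ext i
    rw [b.repr_apply_apply, b.repr_apply_apply, h]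
  refine ContinuousLinearMap.ext fun x => ?_
  have hS := (b.hasSum_repr x).mapL S
  have hT := (b.hasSum_repr x).mapL T
  simp only [map_smul, h1] at hS hT
  exact hS.unique hT

section Operators

variable {H : Type*} [NormedAddCommGroup H] [InnerProductSpace ℂ H] [CompleteSpace H]

/-- Vectors with square summable norms are the images of a Hilbert basis under a bounded
operator. -/
theorem exists_clm_of_hilbertBasis (b : HilbertBasis ℕ ℂ H) {v : ℕ → H}
    (hv : Summable fun n => ‖v n‖ ^ 2) : ∃ T : H →L[ℂ] H, ∀ n, T (b n) = v n := by
  have hs : Summable (fun n => InnerProductSpace.rankOne ℂ (v n) (b n)) := by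
    rw [summable_iff_vanishing_norm] at hv ⊢
    intro ε hε
    obtain ⟨s, hs⟩ := hv ((ε / 2) ^ 2) (by positivity)
    refine ⟨s, fun t ht => ?_⟩
    have h1 := hs t ht
    rw [Real.norm_of_nonneg (Finset.sum_nonneg fun _ _ => by positivity)] at h1
    refine lt_of_le_of_lt (ContinuousLinearMap.opNorm_le_bound _ (by positivity) fun x => ?_)
      (half_lt_self hε)
    have e1 : (∑ n ∈ t, InnerProductSpace.rankOne ℂ (v n) (b n)) x
        = ∑ n ∈ t, inner ℂ (b n) x • v n := by
      rw [sum_apply]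
      rfl
    rw [e1]
    have h2 : ‖∑ n ∈ t, inner ℂ (b n) x • v n‖ ≤ ∑ n ∈ t, ‖inner ℂ (b n) x‖ * ‖v n‖ :=
      (norm_sum_le _ _).trans_eq (Finset.sum_congr rfl fun n _ => norm_smul _ _)
    have h3 := Finset.sum_mul_sq_le_sq_mul_sq t (fun n => ‖inner ℂ (b n) x‖) (fun n => ‖v n‖)
    have h4 := b.orthonormal.sum_inner_products_le (s := t) (x := x)
    refine h2.trans (abs_le_of_sq_le_sq' ?_ (by positivity)).2
    refine h3.trans ?_
    rw [mul_pow, mul_comm]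
    exact mul_le_mul h1.le h4 (Finset.sum_nonneg fun _ _ => by positivity) (by positivity)
  refine ⟨∑' n, InnerProductSpace.rankOne ℂ (v n) (b n), fun n => ?_⟩
  have h1 := hs.hasSum.mapL (ContinuousLinearMap.apply ℂ H (b n))
  refine h1.unique ?_
  have h2 : ∀ k, ContinuousLinearMap.apply ℂ H (b n) (InnerProductSpace.rankOne ℂ (v k) (b k))
      = if k = n then v n else 0 := by
    intro k
    change inner ℂ (b k) (b n) • v k = _
    rw [orthonormal_iff_ite.1 b.orthonormal]
    split_ifs with hk
    · rw [hk, one_smul]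
    · rw [zero_smul]
  simp_rw [h2]
  exact hasSum_ite_eq n (v n)

/-- Every square summable matrix is the matrix of a bounded operator. -/
theorem exists_clm_of_matrix (b : HilbertBasis ℕ ℂ H) {c : ℕ × ℕ → ℂ}
    (hc : ∑' k, ‖c k‖ₑ ^ 2 < ⊤) : ∃ T : H →L[ℂ] H, ∀ m n, inner ℂ (b m) (T (b n)) = c (m, n) := by
  have hc' : ∑' n, ∑' m, ‖c (m, n)‖ₑ ^ 2 < ⊤ := by
    rwa [ENNReal.tsum_comm, ← ENNReal.tsum_prod (f := fun m n => ‖c (m, n)‖ₑ ^ 2)]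
  have hrow : ∀ n, ∑' m, ‖c (m, n)‖ₑ ^ 2 < ⊤ := fun n =>
    (ENNReal.le_tsum n).trans_lt hc'
  have hsum : ∀ n, Summable (fun m => ‖c (m, n)‖ ^ 2) := by
    intro n
    have h1 := ENNReal.summable_toReal (hrow n).ne
    simpa [ENNReal.toReal_pow] using h1
  have hmem : ∀ n, Memℓp (fun m => c (m, n)) 2 := fun n => by
    refine memℓp_gen ?_
    simpa using hsum n
  set v : ℕ → H := fun n => b.repr.symm ⟨fun m => c (m, n), hmem n⟩ with hv
  have hvc : ∀ m n, inner ℂ (b m) (v n) = c (m, n) := by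
    intro m n
    rw [← b.repr_apply_apply, hv, LinearIsometryEquiv.apply_symm_apply]
  have hvs : Summable (fun n => ‖v n‖ ^ 2) := by
    have h1 : ∀ n, ∑' m, ‖c (m, n)‖ₑ ^ 2 = ‖v n‖ₑ ^ 2 := fun n => by
      rw [← b.tsum_enorm_inner_sq]
      simp_rw [hvc]
    simp_rw [h1] at hc'
    have h2 := ENNReal.summable_toReal hc'.ne
    simpa [ENNReal.toReal_pow] using h2
  obtain ⟨T, hT⟩ := exists_clm_of_hilbertBasis b hvs
  exact ⟨T, fun m n => by rw [hT, hvc]⟩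

theorem hsNormSq_comp_adjoint {U : H →L[ℂ] H} (hU : ∀ x, ‖U x‖ = ‖x‖) (T : H →L[ℂ] H) :
    hsNormSq (U.comp T.adjoint) = hsNormSq T := by
  obtain ⟨b, -⟩ := (exists_hilbertBasis ℂ H).choose_spec
  rw [hsNormSq_eq b, hsNormSq_eq b, b.tsum_enorm_sq_adjoint b T]
  refine tsum_congr fun i => ?_
  rw [ContinuousLinearMap.comp_apply, ← ofReal_norm, hU, ofReal_norm]

end Operators

/-- The matrix coefficients of an operator in the basis `h_{n,λ}`. -/
def opCoeff (F : ℝ → L2R →L[ℂ] L2R) (z : ℝ × ℕ × ℕ) : ℂ :=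
  ((√|z.1| : ℝ) : ℂ) * inner ℂ (dilatedHermite z.2.1 z.1) (F z.1 (dilatedHermite z.2.2 z.1))

theorem ae_ne_zero : ∀ᵐ lam : ℝ, lam ≠ 0 := by simp [ae_iff, measure_singleton]

/-- The Hilbert-Schmidt norm may be computed in the basis `h_{n,λ}`. -/
theorem enorm_mul_hsNormSq (F : ℝ → L2R →L[ℂ] L2R) {lam : ℝ} (h : lam ≠ 0) :
    ‖lam‖ₑ * hsNormSq (F lam) = ∑' k, ‖opCoeff F (lam, k)‖ₑ ^ 2 := by
  rw [hsNormSq_eq (hermiteBasis h), ENNReal.tsum_prod', ENNReal.tsum_comm, ← ENNReal.tsum_mul_left]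
  refine tsum_congr fun n => ?_
  rw [← (hermiteBasis h).tsum_enorm_inner_sq, ← ENNReal.tsum_mul_left]
  refine tsum_congr fun m => ?_
  rw [opCoeff, enorm_mul, mul_pow, enorm_sqrt_abs_sq, hermiteBasis_apply, hermiteBasis_apply]

theorem lintegral_hsNormSq (F : ℝ → L2R →L[ℂ] L2R) :
    ∫⁻ lam, hsNormSq (F lam) ∂plancherelMeasure
      = ∫⁻ lam, ∑' k, ‖opCoeff F (lam, k)‖ₑ ^ 2 := by
  rw [plancherelMeasure, lintegral_withDensity_eq_lintegral_mul_non_measurable _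
    measurable_enorm (Eventually.of_forall fun _ => enorm_lt_top)]
  refine lintegral_congr_ae ?_
  filter_upwards [ae_ne_zero] with lam h
  exact enorm_mul_hsNormSq F h

theorem IsGroupFourier.opCoeff_eq {f : Heisenberg → ℂ} {F : ℝ → L2R →L[ℂ] L2R} {lam : ℝ}
    (h0 : lam ≠ 0) (h : IsGroupFourier lam f (F lam)) (k : ℕ × ℕ) :
    opCoeff F (lam, k) = coeffFun f (lam, k) := by
  rw [opCoeff, coeffFun, h]
  simp_rw [inner_schrodinger_dilatedHermite h0]

theorem opCoeff_sub (F G : ℝ → L2R →L[ℂ] L2R) (z : ℝ × ℕ × ℕ) :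
    opCoeff (fun lam => F lam - G lam) z = opCoeff F z - opCoeff G z := by
  simp only [opCoeff, sub_apply, inner_sub_right, mul_sub]

theorem eq_of_opCoeff {F G : ℝ → L2R →L[ℂ] L2R} {lam : ℝ} (h0 : lam ≠ 0)
    (h : ∀ k, opCoeff F (lam, k) = opCoeff G (lam, k)) : F lam = G lam := by
  refine ext_of_hilbertBasis (hermiteBasis h0) fun m n => ?_
  have h1 := h (m, n)
  have h2 : ((√|lam| : ℝ) : ℂ) ≠ 0 := by
    rw [Complex.ofReal_ne_zero]
    exact (Real.sqrt_pos.2 (abs_pos.2 h0)).ne'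
  simp only [opCoeff] at h1
  rw [hermiteBasis_apply, hermiteBasis_apply]
  exact mul_left_cancel₀ h2 h1

/-! ### Measurability of fields of operators -/

theorem measurable_inner_dilatedHermite (n : ℕ) (g : L2R) :
    Measurable (fun lam => inner ℂ (dilatedHermite n lam) g) := by
  simp_rw [inner_dilatedHermite_left]
  refine StronglyMeasurable.measurable ?_
  refine StronglyMeasurable.integral_prod_right (f := fun (lam x : ℝ) =>
    (dilatedHermiteFun n lam x : ℂ) * g x) (Measurable.stronglyMeasurable ?_)
  have h1 : Measurable (hermiteFun n) := (continuous_hermiteFun n).measurable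
  have h2 : Measurable (fun w : ℝ × ℝ => dilatedHermiteFun n w.1 w.2) := by
    unfold dilatedHermiteFun
    fun_prop
  exact (Complex.measurable_ofReal.comp h2).mul
    ((Lp.stronglyMeasurable g).measurable.comp measurable_snd)

theorem measurable_inner_dilatedHermite_right (n : ℕ) (g : L2R) :
    Measurable (fun lam => inner ℂ g (dilatedHermite n lam)) := by
  simp_rw [← inner_conj_symm g]
  exact Complex.continuous_conj.measurable.comp (measurable_inner_dilatedHermite n g)

/-- Measurability of `⟨w, F a⟩` may be tested on a measurable family of Hilbert bases. -/
theorem aemeasurable_inner_apply {b : ℕ → ℝ → L2R} {F : ℝ → L2R →L[ℂ] L2R} {a w : ℝ → L2R}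
    (hb : ∀ᵐ lam : ℝ, ∃ B : HilbertBasis ℕ ℂ L2R, ∀ n, B n = b n lam)
    (h1 : ∀ n, AEMeasurable (fun lam => inner ℂ (b n lam) (a lam)))
    (h2 : ∀ n, AEMeasurable (fun lam => inner ℂ (w lam) (F lam (b n lam)))) :
    AEMeasurable (fun lam => inner ℂ (w lam) (F lam (a lam))) := by
  refine aemeasurable_of_tendsto_metrizable_ae atTop
    (f := fun N lam => ∑ n ∈ Finset.range N,
      inner ℂ (b n lam) (a lam) * inner ℂ (w lam) (F lam (b n lam)))
    (fun N => Finset.aemeasurable_fun_sum _ fun n _ => (h1 n).mul (h2 n)) ?_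
  filter_upwards [hb] with lam hlam
  obtain ⟨B, hB⟩ := hlam
  have h3 := ((B.hasSum_repr (a lam)).mapL (F lam)).mapL (innerSL ℂ (w lam))
  refine (h3.tendsto_sum_nat).congr fun N => Finset.sum_congr rfl fun n _ => ?_
  rw [map_smul, map_smul, innerSL_apply_apply, B.repr_apply_apply, hB, smul_eq_mul]

theorem aemeasurable_inner {b : ℕ → ℝ → L2R} {a w : ℝ → L2R}
    (hb : ∀ᵐ lam : ℝ, ∃ B : HilbertBasis ℕ ℂ L2R, ∀ n, B n = b n lam)
    (h1 : ∀ n, AEMeasurable (fun lam => inner ℂ (b n lam) (a lam)))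
    (h2 : ∀ n, AEMeasurable (fun lam => inner ℂ (w lam) (b n lam))) :
    AEMeasurable (fun lam => inner ℂ (w lam) (a lam)) :=
  aemeasurable_inner_apply (F := fun _ => ContinuousLinearMap.id ℂ L2R) hb h1 h2

theorem ae_exists_hermiteBasis :
    ∀ᵐ lam : ℝ, ∃ B : HilbertBasis ℕ ℂ L2R, ∀ n, B n = dilatedHermite n lam := by
  filter_upwards [ae_ne_zero] with lam h
  exact ⟨hermiteBasis h, hermiteBasis_apply h⟩

theorem ae_exists_const_basis :
    ∀ᵐ _ : ℝ, ∃ B : HilbertBasis ℕ ℂ L2R, ∀ n, B n = dilatedHermite n 1 :=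
  Eventually.of_forall fun _ => ⟨hermiteBasis one_ne_zero, hermiteBasis_apply one_ne_zero⟩

theorem aemeasurable_inner_field {F : ℝ → L2R →L[ℂ] L2R}
    (hF : ∀ g h : L2R, AEMeasurable (fun lam => inner ℂ h (F lam g))) {a w : ℝ → L2R}
    (ha : ∀ g, AEMeasurable (fun lam => inner ℂ g (a lam)))
    (hw : ∀ g, AEMeasurable (fun lam => inner ℂ (w lam) g)) :
    AEMeasurable (fun lam => inner ℂ (w lam) (F lam (a lam))) := by
  have h1 : ∀ n, AEMeasurable (fun lam => inner ℂ (w lam) (F lam (dilatedHermite n 1))) := by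
    intro n
    exact aemeasurable_inner (b := fun n _ => dilatedHermite n 1) (w := w)
      (a := fun lam => F lam (dilatedHermite n 1)) ae_exists_const_basis
      (fun j => hF (dilatedHermite n 1) (dilatedHermite j 1)) fun j => hw (dilatedHermite j 1)
  exact aemeasurable_inner_apply (b := fun n _ => dilatedHermite n 1) (w := w) (F := F) (a := a)
    ae_exists_const_basis (fun n => ha (dilatedHermite n 1)) h1

theorem aemeasurable_opCoeff {F : ℝ → L2R →L[ℂ] L2R}
    (hF : ∀ g h : L2R, AEMeasurable (fun lam => inner ℂ h (F lam g))) (k : ℕ × ℕ) :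
    AEMeasurable (fun lam => opCoeff F (lam, k)) := by
  have h1 := aemeasurable_inner_field hF (a := dilatedHermite k.2) (w := dilatedHermite k.1)
    (fun g => (measurable_inner_dilatedHermite_right _ g).aemeasurable)
    (fun g => (measurable_inner_dilatedHermite _ g).aemeasurable)
  have h2 : AEMeasurable (fun lam : ℝ => ((√|lam| : ℝ) : ℂ)) := by fun_prop
  exact h2.mul h1

theorem aemeasurable_field_of_opCoeff {F : ℝ → L2R →L[ℂ] L2R}
    (hF : ∀ k, AEMeasurable (fun lam => opCoeff F (lam, k))) (g h : L2R) :
    AEMeasurable (fun lam => inner ℂ h (F lam g)) := by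
  have h1 : ∀ m n, AEMeasurable (fun lam =>
      inner ℂ (dilatedHermite m lam) (F lam (dilatedHermite n lam))) := by
    intro m n
    have h2 : AEMeasurable (fun lam : ℝ => ((√|lam| : ℝ) : ℂ)⁻¹ * opCoeff F (lam, (m, n))) :=
      AEMeasurable.mul (by fun_prop) (hF (m, n))
    refine h2.congr ?_
    filter_upwards [ae_ne_zero] with lam h0
    rw [opCoeff, inv_mul_cancel_left₀]
    rw [Complex.ofReal_ne_zero]
    exact (Real.sqrt_pos.2 (abs_pos.2 h0)).ne'
  refine aemeasurable_inner_apply (w := fun _ => h) (a := fun _ => g) ae_exists_hermiteBasis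
    (fun n => (measurable_inner_dilatedHermite n g).aemeasurable) fun n => ?_
  exact aemeasurable_inner (a := fun lam => F lam (dilatedHermite n lam)) (w := fun _ => h)
    ae_exists_hermiteBasis
    (fun m => h1 m n) fun m => (measurable_inner_dilatedHermite_right m h).aemeasurable

/-! ### Characterization of the Plancherel transform -/

theorem lintegral_tsum_sub_coeffEquiv (u v : L2H) :
    ∫⁻ lam, ∑' k, ‖coeffEquiv u (lam, k) - coeffEquiv v (lam, k)‖ₑ ^ 2 = ‖u - v‖ₑ ^ 2 := by
  have hu := (Lp.stronglyMeasurable (coeffEquiv u)).measurable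
  have hv := (Lp.stronglyMeasurable (coeffEquiv v)).measurable
  have hm := (hu.sub hv).enorm.pow_const 2
  have h1 : ‖u - v‖ₑ = ‖coeffEquiv u - coeffEquiv v‖ₑ := by
    rw [← map_sub, ← ofReal_norm, ← ofReal_norm, coeffEquiv.norm_map]
  rw [h1, ← lintegral_enorm_sq_eq, lintegral_tsum
    (f := fun k lam => ‖coeffEquiv u (lam, k) - coeffEquiv v (lam, k)‖ₑ ^ 2)
    fun k => (hm.comp measurable_prodMk_right).aemeasurable]
  refine (lintegral_coeffMeasure hm).symm.trans (lintegral_congr_ae ?_)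
  filter_upwards [Lp.coeFn_sub (coeffEquiv u) (coeffEquiv v)] with z hz
  rw [hz]

theorem enorm_sub_sq_le (a b c : ℂ) :
    ‖a - c‖ₑ ^ 2 ≤ 2 * (‖a - b‖ₑ ^ 2 + ‖b - c‖ₑ ^ 2) := by
  have h1 : ‖a - c‖ ^ 2 ≤ 2 * (‖a - b‖ ^ 2 + ‖b - c‖ ^ 2) := by
    have h2 := norm_sub_le_norm_sub_add_norm_sub a b c
    nlinarith [sq_nonneg (‖a - b‖ - ‖b - c‖), norm_nonneg (a - c), norm_nonneg (a - b),
      norm_nonneg (b - c)]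
  have h3 := ENNReal.ofReal_le_ofReal h1
  rw [ENNReal.ofReal_mul (by norm_num), ENNReal.ofReal_add (by positivity) (by positivity)] at h3
  simpa [ENNReal.ofReal_pow, ofReal_norm] using h3

/-- A measurable field is the Plancherel transform of `f` if and only if its matrix coefficients
are those of `f`. -/
theorem isPlancherelTransform_iff {f : L2H} {F : ℝ → L2R →L[ℂ] L2R} :
    IsPlancherelTransform f F ↔
      (∀ g h : L2R, AEMeasurable (fun lam => inner ℂ h (F lam g))) ∧
        ∀ᵐ lam : ℝ, ∀ k, coeffEquiv f (lam, k) = opCoeff F (lam, k) := by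
  refine and_congr_right fun hF => ⟨?_, ?_⟩
  · rintro ⟨f', F', hi, hG, hlim, hint⟩
    -- both `coeffEquiv f` and the coefficients of `F` are limits of those of the
    -- approximating sequence
    have hcm : ∀ k, AEMeasurable (fun lam => opCoeff F (lam, k)) := aemeasurable_opCoeff hF
    have e1 : ∀ n, ∫⁻ lam, hsNormSq (F' n lam - F lam) ∂plancherelMeasure
        = ∫⁻ lam, ∑' k, ‖coeffEquiv (f' n) (lam, k) - opCoeff F (lam, k)‖ₑ ^ 2 := by
      intro n
      rw [lintegral_hsNormSq fun lam => F' n lam - F lam]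
      refine lintegral_congr_ae ?_
      filter_upwards [ae_ne_zero, ae_coeffMeasure_iff.1 (coeffEquiv_ae_eq (hi n))] with lam h0 h1
      refine tsum_congr fun k => ?_
      rw [opCoeff_sub, (hG n lam h0).opCoeff_eq h0, h1]
    simp_rw [e1] at hint
    have hum : ∀ (u : L2H) k, Measurable (fun lam => coeffEquiv u (lam, k)) := fun u k =>
      (Lp.stronglyMeasurable (coeffEquiv u)).measurable.comp measurable_prodMk_right
    have hle : ∀ n, ∫⁻ lam, ∑' k, ‖coeffEquiv f (lam, k) - opCoeff F (lam, k)‖ₑ ^ 2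
        ≤ 2 * (‖f - f' n‖ₑ ^ 2 +
          ∫⁻ lam, ∑' k, ‖coeffEquiv (f' n) (lam, k) - opCoeff F (lam, k)‖ₑ ^ 2) := by
      intro n
      have hm1 : Measurable
          (fun lam => ∑' k, ‖coeffEquiv f (lam, k) - coeffEquiv (f' n) (lam, k)‖ₑ ^ 2) :=
        Measurable.tsum fun k => ((hum f k).sub (hum (f' n) k)).enorm.pow_const 2
      rw [← lintegral_tsum_sub_coeffEquiv, ← lintegral_add_left hm1,
        ← lintegral_const_mul' _ _ (by norm_num)]
      refine lintegral_mono fun lam => ?_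
      rw [← ENNReal.tsum_add, ← ENNReal.tsum_mul_left]
      exact ENNReal.tsum_le_tsum fun k => enorm_sub_sq_le _ _ _
    have hz : ∫⁻ lam, ∑' k, ‖coeffEquiv f (lam, k) - opCoeff F (lam, k)‖ₑ ^ 2 = 0 := by
      refine le_antisymm (ge_of_tendsto (x := atTop) ?_ (Eventually.of_forall hle)) bot_le
      have h1 : Tendsto (fun n => ‖f - f' n‖ₑ ^ 2) atTop (𝓝 0) := by
        have h2 : Tendsto (fun n => f - f' n) atTop (𝓝 0) := by
          simpa using hlim.const_sub f
        simpa using ENNReal.Tendsto.pow (n := 2) h2.enorm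
      have h3 := ENNReal.Tendsto.const_mul (a := 2) (h1.add hint) (Or.inr (by norm_num))
      simpa using h3
    have hm2 : AEMeasurable
        (fun lam => ∑' k, ‖coeffEquiv f (lam, k) - opCoeff F (lam, k)‖ₑ ^ 2) :=
      AEMeasurable.tsum fun k => ((hum f k).aemeasurable.sub (hcm k)).enorm.pow_const 2
    rw [lintegral_eq_zero_iff' hm2] at hz
    filter_upwards [hz] with lam hlam k
    have h1 := ENNReal.tsum_eq_zero.1 hlam k
    simpa [sub_eq_zero] using h1
  · intro h
    -- approximate `f` by integrable functions; the coefficient transform is an isometry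
    obtain ⟨u, hu, hlim⟩ := mem_closure_iff_seq_limit.1 (denseRange_integrableSubmodule f)
    have hi : ∀ n, Integrable (u n) volume := fun n => by
      obtain ⟨v, hv⟩ := hu n
      rw [← hv]
      exact v.2
    choose G hG using fun (n : ℕ) (lam : ℝ) => exists_isGroupFourier (hi n) lam
    refine ⟨u, G, hi, fun n lam _ => hG n lam, hlim, ?_⟩
    have e1 : ∀ n, ∫⁻ lam, hsNormSq (G n lam - F lam) ∂plancherelMeasure = ‖u n - f‖ₑ ^ 2 := by
      intro n
      rw [lintegral_hsNormSq fun lam => G n lam - F lam, ← lintegral_tsum_sub_coeffEquiv]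
      refine lintegral_congr_ae ?_
      filter_upwards [ae_ne_zero, h, ae_coeffMeasure_iff.1 (coeffEquiv_ae_eq (hi n))]
        with lam h0 h1 h2
      refine tsum_congr fun k => ?_
      rw [opCoeff_sub, (hG n lam).opCoeff_eq h0, h1, h2]
    simp_rw [e1]
    have h2 : Tendsto (fun n => u n - f) atTop (𝓝 0) := by
      simpa using hlim.sub_const f
    simpa using ENNReal.Tendsto.pow (n := 2) h2.enorm

/-! ### Existence and uniqueness of the Plancherel transform -/

theorem ae_tsum_coeffEquiv_lt_top (f : L2H) :
    ∀ᵐ lam : ℝ, ∑' k, ‖coeffEquiv f (lam, k)‖ₑ ^ 2 < ⊤ := by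
  have hm := (Lp.stronglyMeasurable (coeffEquiv f)).measurable.enorm.pow_const 2
  have hk : ∀ k, Measurable (fun lam => ‖coeffEquiv f (lam, k)‖ₑ ^ 2) := fun k =>
    hm.comp measurable_prodMk_right
  have h1 := lintegral_coeffMeasure hm
  rw [← lintegral_tsum (f := fun k lam => ‖coeffEquiv f (lam, k)‖ₑ ^ 2)
    fun k => (hk k).aemeasurable] at h1
  refine ae_lt_top (Measurable.tsum hk) ?_
  rw [← h1]
  exact (lintegral_enorm_sq_lt_top (Lp.memLp (coeffEquiv f))).ne

theorem exists_isPlancherelTransform (f : L2H) :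
    ∃ F : ℝ → L2R →L[ℂ] L2R, IsPlancherelTransform f F := by
  have h1 : ∀ lam : ℝ, ∃ T : L2R →L[ℂ] L2R,
      lam ≠ 0 → ∑' k, ‖coeffEquiv f (lam, k)‖ₑ ^ 2 < ⊤ → ∀ m n,
        inner ℂ (dilatedHermite m lam) (T (dilatedHermite n lam))
          = ((√|lam| : ℝ) : ℂ)⁻¹ * coeffEquiv f (lam, (m, n)) := by
    intro lam
    by_cases h : lam ≠ 0 ∧ ∑' k, ‖coeffEquiv f (lam, k)‖ₑ ^ 2 < ⊤
    · obtain ⟨T, hT⟩ := exists_clm_of_matrix (hermiteBasis h.1)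
        (c := fun k => ((√|lam| : ℝ) : ℂ)⁻¹ * coeffEquiv f (lam, k)) (by
          simp_rw [enorm_mul, mul_pow]
          rw [ENNReal.tsum_mul_left]
          exact ENNReal.mul_lt_top (ENNReal.pow_lt_top enorm_lt_top) h.2)
      refine ⟨T, fun h0 _ m n => ?_⟩
      rw [← hT, hermiteBasis_apply, hermiteBasis_apply]
    · exact ⟨0, fun h0 h2 => absurd ⟨h0, h2⟩ h⟩
  choose F hF using h1
  have h2 : ∀ᵐ lam : ℝ, ∀ k, coeffEquiv f (lam, k) = opCoeff F (lam, k) := by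
    filter_upwards [ae_ne_zero, ae_tsum_coeffEquiv_lt_top f] with lam h0 h k
    rw [opCoeff, hF lam h0 h, mul_inv_cancel_left₀]
    rw [Complex.ofReal_ne_zero]
    exact (Real.sqrt_pos.2 (abs_pos.2 h0)).ne'
  refine ⟨F, isPlancherelTransform_iff.2 ⟨aemeasurable_field_of_opCoeff fun k => ?_, h2⟩⟩
  refine AEMeasurable.congr (f := fun lam => coeffEquiv f (lam, k)) ?_ (h2.mono fun lam h => h k)
  exact ((Lp.stronglyMeasurable (coeffEquiv f)).measurable.comp
    measurable_prodMk_right).aemeasurable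

theorem IsPlancherelTransform.ae_eq {f : L2H} {F G : ℝ → L2R →L[ℂ] L2R}
    (hF : IsPlancherelTransform f F) (hG : IsPlancherelTransform f G) :
    ∀ᵐ lam : ℝ, G lam = F lam := by
  filter_upwards [ae_ne_zero, (isPlancherelTransform_iff.1 hF).2,
    (isPlancherelTransform_iff.1 hG).2] with lam h0 h1 h2
  exact eq_of_opCoeff h0 fun k => by rw [← h1, ← h2]

/-! ### The projections onto the low Hermite functions -/

theorem le_hermiteCutoff_iff {lam : ℝ} (h0 : lam ≠ 0) (m n : ℕ) :
    (n : ℤ) ≤ hermiteCutoff lam ↔ oscillatorSymbol (lam, (m, n)) ∈ Set.Icc (0 : ℝ) 1 := by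
  have hpos : 0 < |lam| := abs_pos.2 h0
  have h2 : 0 ≤ oscillatorSymbol (lam, (m, n)) := by
    unfold oscillatorSymbol
    positivity
  rw [hermiteCutoff, Int.le_floor, Set.mem_Icc, and_iff_right h2, oscillatorSymbol,
    le_sub_iff_add_le,
    le_div_iff₀ (by positivity), Int.cast_natCast]
  constructor <;> intro h <;> nlinarith

theorem paleyWienerFiber_dilatedHermite {lam : ℝ} (h0 : lam ≠ 0) (n : ℕ) :
    paleyWienerFiber lam (dilatedHermite n lam)
      = if (n : ℤ) ≤ hermiteCutoff lam then dilatedHermite n lam else 0 := by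
  have h1 : ∀ k, InnerProductSpace.rankOne ℂ (dilatedHermite k lam) (dilatedHermite k lam)
      (dilatedHermite n lam) = if n = k then dilatedHermite n lam else 0 := by
    intro k
    change inner ℂ (dilatedHermite k lam) (dilatedHermite n lam) • dilatedHermite k lam = _
    rw [orthonormal_iff_ite.1 (orthonormal_dilatedHermite h0)]
    by_cases hk : k = n
    · subst hk
      simp
    · rw [if_neg hk, if_neg (Ne.symm hk), zero_smul]
  rw [paleyWienerFiber, sum_apply]
  simp_rw [h1]
  rw [Finset.sum_ite_eq]
  have h2 : n ∈ Finset.range (hermiteCutoff lam + 1).toNat ↔ (n : ℤ) ≤ hermiteCutoff lam := by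
    rw [Finset.mem_range]
    omega
  simp_rw [h2]

theorem inner_paleyWienerFiber {lam : ℝ} (h0 : lam ≠ 0) (m n : ℕ) :
    inner ℂ (dilatedHermite m lam) (paleyWienerFiber lam (dilatedHermite n lam))
      = if m = n ∧ (n : ℤ) ≤ hermiteCutoff lam then 1 else 0 := by
  rw [paleyWienerFiber_dilatedHermite h0]
  by_cases h : (n : ℤ) ≤ hermiteCutoff lam
  · simp only [h, if_true, and_true]
    exact orthonormal_iff_ite.1 (orthonormal_dilatedHermite h0) m n
  · simp [h]

theorem isStarProjection_paleyWienerFiber {lam : ℝ} (h0 : lam ≠ 0) :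
    IsStarProjection (paleyWienerFiber lam) where
  isIdempotentElem := by
    refine ext_of_hilbertBasis (hermiteBasis h0) fun m n => ?_
    rw [hermiteBasis_apply, hermiteBasis_apply, mul_apply_eq_comp,
      paleyWienerFiber_dilatedHermite h0]
    split_ifs with h
    · rw [paleyWienerFiber_dilatedHermite h0, if_pos h]
    · rw [map_zero]
  isSelfAdjoint := by
    refine ext_of_hilbertBasis (hermiteBasis h0) fun m n => ?_
    rw [ContinuousLinearMap.star_eq_adjoint, ContinuousLinearMap.adjoint_inner_right,
      ← inner_conj_symm, hermiteBasis_apply, hermiteBasis_apply, inner_paleyWienerFiber h0,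
      inner_paleyWienerFiber h0]
    by_cases h : m = n
    · subst h
      split_ifs <;> simp
    · simp [h, Ne.symm h]

theorem range_paleyWienerFiber {lam : ℝ} (h0 : lam ≠ 0) :
    (paleyWienerFiber lam).range =
      Submodule.span ℂ {u | ∃ n : ℕ, (n : ℤ) ≤ hermiteCutoff lam ∧ u = dilatedHermite n lam} := by
  refine le_antisymm ?_ (Submodule.span_le.2 ?_)
  · rintro _ ⟨x, rfl⟩
    change paleyWienerFiber lam x ∈ _
    rw [paleyWienerFiber, sum_apply]
    refine Submodule.sum_mem _ fun n hn => ?_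
    refine Submodule.smul_mem _ _ (Submodule.subset_span ⟨n, ?_, rfl⟩)
    rw [Finset.mem_range] at hn
    omega
  · rintro _ ⟨n, hn, rfl⟩
    exact ⟨dilatedHermite n lam, (paleyWienerFiber_dilatedHermite h0 n).trans (if_pos hn)⟩

/-! ### The spectral projection on the Fourier side -/

/-- The spectral projection acts on the coefficients as the indicator of the region where the
symbol lies in `[0, 1]`. -/
theorem coeffEquiv_proj {E : ProjectionValuedMeasure L2H} (hE : IsSpectralMeasure subLaplacian E)
    (f : L2H) :
    coeffEquiv (E.proj (Set.Icc 0 1) f) =ᵐ[coeffMeasure]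
      (oscillatorSymbol ⁻¹' Set.Icc 0 1).indicator (coeffEquiv f) := by
  rw [IsSpectralMeasure.proj_Icc_eq measurable_oscillatorSymbol isMultiplication_subLaplacian hE
    zero_lt_one]
  exact coeFn_indicatorL2 _ _

theorem opCoeff_comp_paleyWienerFiber (F : ℝ → L2R →L[ℂ] L2R) {lam : ℝ} (h0 : lam ≠ 0)
    (k : ℕ × ℕ) :
    opCoeff (fun lam => (F lam).comp (paleyWienerFiber lam)) (lam, k)
      = (oscillatorSymbol ⁻¹' Set.Icc 0 1).indicator (opCoeff F) (lam, k) := by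
  obtain ⟨m, n⟩ := k
  simp only [opCoeff, ContinuousLinearMap.comp_apply, paleyWienerFiber_dilatedHermite h0,
    le_hermiteCutoff_iff h0 m]
  by_cases h : oscillatorSymbol (lam, (m, n)) ∈ Set.Icc (0 : ℝ) 1
  · rw [if_pos h, Set.indicator_of_mem (by exact h)]
    rfl
  · rw [if_neg h, Set.indicator_of_notMem (by exact h), map_zero, inner_zero_right, mul_zero]

theorem IsPlancherelTransform.ae_eq_comp_paleyWienerFiber {E : ProjectionValuedMeasure L2H}
    (hE : IsSpectralMeasure subLaplacian E) {f : L2H} {F G : ℝ → L2R →L[ℂ] L2R}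
    (hF : IsPlancherelTransform f F) (hG : IsPlancherelTransform (E.proj (Set.Icc 0 1) f) G) :
    ∀ᵐ lam : ℝ, G lam = (F lam).comp (paleyWienerFiber lam) := by
  filter_upwards [ae_ne_zero, (isPlancherelTransform_iff.1 hF).2,
    (isPlancherelTransform_iff.1 hG).2, ae_coeffMeasure_iff.1 (coeffEquiv_proj hE f)]
    with lam h0 h1 h2 h3
  refine eq_of_opCoeff (G := fun lam => (F lam).comp (paleyWienerFiber lam)) h0 fun k => ?_
  rw [← h2, h3, opCoeff_comp_paleyWienerFiber F h0]
  simp only [Set.indicator, h1]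

/-! ### The convolution kernel of the spectral projection -/

/-- The coefficients of the field `P̂_λ`. -/
def fiberCoeff (z : ℝ × ℕ × ℕ) : ℂ :=
  if z.2.1 = z.2.2 ∧ oscillatorSymbol z ∈ Set.Icc (0 : ℝ) 1 then ((√|z.1| : ℝ) : ℂ) else 0

theorem measurable_fiberCoeff : Measurable fiberCoeff := by
  refine Measurable.ite ?_ (by fun_prop) measurable_const
  have h1 : MeasurableSet {z : ℝ × ℕ × ℕ | z.2.1 = z.2.2} :=
    measurableSet_eq_fun (by fun_prop) (by fun_prop)
  exact h1.inter (measurable_oscillatorSymbol measurableSet_Icc)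

theorem opCoeff_paleyWienerFiber {lam : ℝ} (h0 : lam ≠ 0) (k : ℕ × ℕ) :
    opCoeff paleyWienerFiber (lam, k) = fiberCoeff (lam, k) := by
  obtain ⟨m, n⟩ := k
  simp only [opCoeff, fiberCoeff, inner_paleyWienerFiber h0, le_hermiteCutoff_iff h0 m]
  split_ifs <;> simp

/-- The diagonal sheets contribute at most `2 / (2n + 1)²`, because `|λ| ≤ 1 / (2n + 1)` on the
support of the `n`-th one. -/
theorem memLp_fiberCoeff : MemLp fiberCoeff 2 coeffMeasure := by
  refine memLp_two_of_lintegral_lt_top measurable_fiberCoeff.aestronglyMeasurable ?_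
  rw [lintegral_coeffMeasure (measurable_fiberCoeff.enorm.pow_const 2), ENNReal.tsum_prod']
  have h1 : ∀ m, ∑' n, ∫⁻ lam, ‖fiberCoeff (lam, (m, n))‖ₑ ^ 2
      = ∫⁻ lam, ‖fiberCoeff (lam, (m, m))‖ₑ ^ 2 := fun m =>
    tsum_eq_single m fun n hn => by simp [fiberCoeff, Ne.symm hn]
  have h2 : ∀ n : ℕ, ∫⁻ lam, ‖fiberCoeff (lam, (n, n))‖ₑ ^ 2
      ≤ ENNReal.ofReal (2 * (1 / ((n : ℝ) + 1) ^ 2)) := by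
    intro n
    set r : ℝ := 1 / ((n : ℝ) + 1) with hr
    have hr0 : 0 < r := by positivity
    calc ∫⁻ lam, ‖fiberCoeff (lam, (n, n))‖ₑ ^ 2
        ≤ ∫⁻ lam, (Set.Icc (-r) r).indicator (fun _ => ENNReal.ofReal r) lam := by
          refine lintegral_mono fun lam => ?_
          by_cases h : oscillatorSymbol (lam, (n, n)) ∈ Set.Icc (0 : ℝ) 1
          · have h3 : |lam| ≤ r := by
              rw [hr, le_div_iff₀ (by positivity)]
              have h4 : |lam| * (2 * n + 1) ≤ 1 := h.2
              have h5 : 0 ≤ |lam| * n := by positivity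
              linarith
            rw [Set.indicator_of_mem (by exact abs_le.1 h3)]
            simp only [fiberCoeff, h, and_self, if_true]
            rw [enorm_sqrt_abs_sq, ← ofReal_norm]
            exact ENNReal.ofReal_le_ofReal h3
          · simp [fiberCoeff, h]
      _ = ENNReal.ofReal (2 * (1 / ((n : ℝ) + 1) ^ 2)) := by
          rw [lintegral_indicator measurableSet_Icc, setLIntegral_const, Real.volume_Icc,
            ← ENNReal.ofReal_mul hr0.le]
          congr 1
          rw [hr]
          field_simp
          ring
  simp_rw [h1]
  refine (ENNReal.tsum_le_tsum h2).trans_lt ?_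
  have h3 : Summable (fun n : ℕ => 2 * (1 / ((n : ℝ) + 1) ^ 2)) := by
    have h4 := (summable_nat_add_iff 1).2 (Real.summable_one_div_nat_pow.2 one_lt_two)
    refine (h4.congr fun n => ?_).mul_left 2
    push_cast
    rfl
  rw [← ENNReal.ofReal_tsum_of_nonneg (fun n => by positivity) h3]
  exact ENNReal.ofReal_lt_top

/-- The function whose Plancherel transform is the field `P̂_λ`. -/
def paleyWienerKernel : L2H := coeffEquiv.symm (memLp_fiberCoeff.toLp _)

theorem isPlancherelTransform_paleyWienerKernel :
    IsPlancherelTransform paleyWienerKernel paleyWienerFiber := by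
  have h1 : ∀ᵐ lam : ℝ, ∀ k, coeffEquiv paleyWienerKernel (lam, k)
      = opCoeff paleyWienerFiber (lam, k) := by
    rw [paleyWienerKernel, LinearIsometryEquiv.apply_symm_apply]
    filter_upwards [ae_ne_zero, ae_coeffMeasure_iff.1 memLp_fiberCoeff.coeFn_toLp] with lam h0 h k
    rw [h, opCoeff_paleyWienerFiber h0]
  refine isPlancherelTransform_iff.2 ⟨aemeasurable_field_of_opCoeff fun k => ?_, h1⟩
  refine AEMeasurable.congr (f := fun lam => fiberCoeff (lam, k))
    (measurable_fiberCoeff.comp measurable_prodMk_right).aemeasurable ?_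
  filter_upwards [ae_ne_zero] with lam h0
  rw [opCoeff_paleyWienerFiber h0]

/-! ### Reflected translates -/

theorem inv_mul_eq_inv_comp (x : Heisenberg) : (fun y : Heisenberg => y⁻¹ * x)
    = (fun y => y⁻¹) ∘ fun y => x⁻¹ * y := by
  funext y
  simp

theorem measurePreserving_inv_mul (x : Heisenberg) :
    MeasurePreserving (fun y : Heisenberg => y⁻¹ * x) volume volume := by
  rw [inv_mul_eq_inv_comp]
  exact Heisenberg.measurePreserving_inv.comp (Heisenberg.measurePreserving_mul_left x⁻¹)

theorem measurableEmbedding_inv_mul (x : Heisenberg) :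
    MeasurableEmbedding (fun y : Heisenberg => y⁻¹ * x) := by
  rw [inv_mul_eq_inv_comp]
  exact Heisenberg.measurableEmbedding_inv.comp (Heisenberg.measurableEmbedding_mul_left x⁻¹)

theorem memLp_conj_comp_inv_mul (x : Heisenberg) (u : L2H) :
    MemLp (fun y => (starRingEnd ℂ) (u (y⁻¹ * x))) 2 (volume : Measure Heisenberg) :=
  ((Lp.memLp u).comp_measurePreserving (measurePreserving_inv_mul x)).star

/-- The function `y ↦ conj (u (y⁻¹ x))`; the value at `x` of a convolution `f * u` is the inner
product of this function with `f`. -/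
def reflectL2 (x : Heisenberg) (u : L2H) : L2H := (memLp_conj_comp_inv_mul x u).toLp _

theorem coeFn_reflectL2 (x : Heisenberg) (u : L2H) :
    reflectL2 x u =ᵐ[volume] fun y => (starRingEnd ℂ) (u (y⁻¹ * x)) :=
  (memLp_conj_comp_inv_mul x u).coeFn_toLp

theorem integrable_convolutionIntegrand (f u : L2H) (x : Heisenberg) :
    Integrable (convolutionIntegrand f u x) :=
  (Lp.memLp f).integrable_mul
    ((Lp.memLp u).comp_measurePreserving (measurePreserving_inv_mul x))

theorem heisenbergConvolution_eq_inner (f u : L2H) (x : Heisenberg) :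
    heisenbergConvolution f u x = inner ℂ (reflectL2 x u) f := by
  rw [heisenbergConvolution, inner_L2_eq]
  refine integral_congr_ae ?_
  filter_upwards [coeFn_reflectL2 x u] with y hy
  rw [hy, Complex.conj_conj, convolutionIntegrand, mul_comm]

theorem tendsto_reflectL2 (x : Heisenberg) {u : ℕ → L2H} {v : L2H} (h : Tendsto u atTop (𝓝 v)) :
    Tendsto (fun n => reflectL2 x (u n)) atTop (𝓝 (reflectL2 x v)) := by
  refine tendsto_L2_of_lintegral ?_
  have h1 : ∀ n, ∫⁻ y, ‖reflectL2 x (u n) y - reflectL2 x v y‖ₑ ^ 2 = ‖u n - v‖ₑ ^ 2 := by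
    intro n
    rw [← lintegral_enorm_sq_eq, ← (measurePreserving_inv_mul x).lintegral_comp_emb
      (measurableEmbedding_inv_mul x) (fun z => ‖(u n - v) z‖ₑ ^ 2)]
    refine lintegral_congr_ae ?_
    filter_upwards [coeFn_reflectL2 x (u n), coeFn_reflectL2 x v,
      (measurePreserving_inv_mul x).quasiMeasurePreserving.ae (Lp.coeFn_sub (u n) v)]
      with y h1 h2 h3
    rw [h1, h2, h3, ← map_sub, RCLike.enorm_conj]
    rfl
  simp_rw [h1]
  have h2 : Tendsto (fun n => u n - v) atTop (𝓝 0) := by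
    simpa using h.sub_const v
  simpa using ENNReal.Tendsto.pow (n := 2) h2.enorm

theorem integrable_reflectL2 (x : Heisenberg) {u : L2H} (hu : Integrable u) :
    Integrable (reflectL2 x u) := by
  have h1 := ((measurePreserving_inv_mul x).integrable_comp_emb
    (measurableEmbedding_inv_mul x)).2 hu
  have h2 : Integrable (fun y => (starRingEnd ℂ) (u (y⁻¹ * x))) :=
    Complex.conjCLE.toContinuousLinearMap.integrable_comp h1
  exact h2.congr (coeFn_reflectL2 x u).symm

/-- `ρ_λ` of the function `y ↦ conj (u (y⁻¹ x))` is `ρ_λ(x) ρ_λ(u)†`. -/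
theorem IsGroupFourier.reflectL2 (x : Heisenberg) {lam : ℝ} {u : L2H} {A : L2R →L[ℂ] L2R}
    (h : IsGroupFourier lam u A) :
    IsGroupFourier lam (reflectL2 x u) ((schrodinger lam x).comp A.adjoint) := by
  intro g k
  have h1 : inner ℂ k ((schrodinger lam x).comp A.adjoint g)
      = (starRingEnd ℂ) (inner ℂ g (A (schrodinger lam x⁻¹ k))) := by
    rw [ContinuousLinearMap.comp_apply, inner_conj_symm, ← ContinuousLinearMap.adjoint_inner_right,
      ← inner_schrodinger_inv, inv_inv]
  rw [h1, h, ← integral_conj, ← (measurePreserving_inv_mul x).integral_comp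
    (measurableEmbedding_inv_mul x)]
  refine integral_congr_ae ?_
  filter_upwards [coeFn_reflectL2 x u] with y hy
  rw [hy, map_mul, inner_conj_symm, ← mul_apply_eq_comp, ← schrodinger_mul,
    mul_inv_cancel_right, ← inner_schrodinger_inv, inv_inv]

theorem measurable_inner_schrodinger (x : Heisenberg) (g k : L2R) :
    Measurable (fun lam => inner ℂ k (schrodinger lam x g)) :=
  Measurable.comp (g := fun z : ℝ × Heisenberg => inner ℂ k (schrodinger z.1 z.2 g))
    (f := fun lam : ℝ => (lam, x)) (stronglyMeasurable_inner_schrodinger g k).measurable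
    measurable_prodMk_right

/-- The Plancherel transform of `y ↦ conj (u (y⁻¹ x))` is `ρ_λ(x) F(λ)†`. -/
theorem IsPlancherelTransform.reflectL2 (x : Heisenberg) {u : L2H} {F : ℝ → L2R →L[ℂ] L2R}
    (h : IsPlancherelTransform u F) :
    IsPlancherelTransform (reflectL2 x u)
      (fun lam => (schrodinger lam x).comp (F lam).adjoint) := by
  obtain ⟨hm, f', F', hi, hG, hlim, hint⟩ := h
  refine ⟨fun g k => ?_, fun n => _root_.reflectL2 x (f' n),
    fun n lam => (schrodinger lam x).comp (F' n lam).adjoint,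
    fun n => integrable_reflectL2 x (hi n), fun n lam h0 => (hG n lam h0).reflectL2 x,
    tendsto_reflectL2 x hlim, ?_⟩
  · have h1 := aemeasurable_inner_field hm (w := fun _ => g) (a := fun lam => schrodinger lam x⁻¹ k)
      (fun v => (measurable_inner_schrodinger x⁻¹ k v).aemeasurable)
      (fun v => aemeasurable_const)
    refine (Complex.continuous_conj.measurable.comp_aemeasurable h1).congr
      (Eventually.of_forall fun lam => ?_)
    simp only [Function.comp_apply]
    rw [ContinuousLinearMap.comp_apply, inner_conj_symm, ← ContinuousLinearMap.adjoint_inner_right,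
      ← inner_schrodinger_inv, inv_inv]
  · refine hint.congr fun n => lintegral_congr fun lam => ?_
    have h1 : (schrodinger lam x).comp (F' n lam).adjoint - (schrodinger lam x).comp (F lam).adjoint
        = (schrodinger lam x).comp (F' n lam - F lam).adjoint := by
      rw [map_sub, ContinuousLinearMap.comp_sub]
    rw [h1, hsNormSq_comp_adjoint (norm_schrodinger lam x)]

/-! ### The spectral projection as a convolution operator -/

/-- The coefficients of `ρ_λ(x) P̂_λ`: those of `ρ_λ(x)`, cut off to `|λ| (2n + 1) ≤ 1`. -/
theorem coeffEquiv_reflectL2_paleyWienerKernel (x : Heisenberg) :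
    ∀ᵐ lam : ℝ, ∀ m n, coeffEquiv (reflectL2 x paleyWienerKernel) (lam, (m, n))
      = if oscillatorSymbol (lam, (m, n)) ∈ Set.Icc (0 : ℝ) 1 then
          ((√|lam| : ℝ) : ℂ) * matCoeff m n lam x else 0 := by
  have h1 := isPlancherelTransform_paleyWienerKernel.reflectL2 x
  filter_upwards [ae_ne_zero, (isPlancherelTransform_iff.1 h1).2] with lam h0 h2 m n
  have h3 : (paleyWienerFiber lam).adjoint = paleyWienerFiber lam :=
    (isStarProjection_paleyWienerFiber h0).isSelfAdjoint
  have h4 : opCoeff (fun lam => (schrodinger lam x).comp (paleyWienerFiber lam).adjoint)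
        (lam, (m, n))
      = opCoeff (fun lam => (schrodinger lam x).comp (paleyWienerFiber lam)) (lam, (m, n)) := by
    simp only [opCoeff, h3]
  rw [h2, h4, opCoeff_comp_paleyWienerFiber (fun lam => schrodinger lam x) h0, Set.indicator,
    opCoeff, inner_schrodinger_dilatedHermite h0]
  simp only [Set.mem_preimage]

/-- Restriction of `c` to the region where the oscillator symbol of the sheet `(m, n)` lies in
`[0, 1]`. -/
def spectralCut (m n : ℕ) (c : ℝ → ℂ) (lam : ℝ) : ℂ :=
  if oscillatorSymbol (lam, (m, n)) ∈ Set.Icc (0 : ℝ) 1 then c lam else 0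

theorem IsCutoffFun.spectralCut (m n : ℕ) {c : ℝ → ℂ} (hc : IsCutoffFun c) :
    IsCutoffFun (spectralCut m n c) := by
  obtain ⟨C, hC⟩ := hc.bound
  obtain ⟨R, hR⟩ := hc.support
  refine ⟨?_, ⟨C, fun lam => ?_⟩, R, fun lam h => ?_⟩
  · exact Measurable.ite ((measurable_oscillatorSymbol.comp measurable_prodMk_right)
      measurableSet_Icc) hc.measurable measurable_const
  · unfold _root_.spectralCut
    split_ifs
    · exact hC lam
    · simpa using (norm_nonneg _).trans (hC lam)
  · simp [_root_.spectralCut, hR lam h]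

theorem proj_packet {E : ProjectionValuedMeasure L2H} (hE : IsSpectralMeasure subLaplacian E)
    (m n : ℕ) {c : ℝ → ℂ} (hc : IsCutoffFun c) :
    E.proj (Set.Icc 0 1) (packet m n hc) = packet m n (hc.spectralCut m n) := by
  refine coeffEquiv.injective (Lp.ext ?_)
  rw [coeffEquiv_packet]
  filter_upwards [coeffEquiv_proj hE (packet m n hc), (memLp_sheetFun m n hc).coeFn_toLp,
    (memLp_sheetFun m n (hc.spectralCut m n)).coeFn_toLp] with z h1 h2 h3
  rw [h1, coeffEquiv_packet]
  change (oscillatorSymbol ⁻¹' Set.Icc 0 1).indicator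
    ((memLp_sheetFun m n hc).toLp (sheetFun m n c)) z
      = (memLp_sheetFun m n (hc.spectralCut m n)).toLp (sheetFun m n (spectralCut m n c)) z
  rw [h3, Set.indicator, h2]
  obtain ⟨lam, k⟩ := z
  by_cases hk : k = (m, n)
  · subst hk
    simp [sheetFun, spectralCut]
  · simp [sheetFun, hk]

/-- On wave packets, convolution with the kernel truncates the Fourier side to `[0, 1]`. -/
theorem heisenbergConvolution_packet (m n : ℕ) {c : ℝ → ℂ} (hc : IsCutoffFun c) (x : Heisenberg) :
    heisenbergConvolution (packet m n hc) paleyWienerKernel x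
      = wavePacket m n (spectralCut m n c) x := by
  rw [heisenbergConvolution_eq_inner, ← inner_conj_symm, inner_packet_eq_integral, ← integral_conj,
    wavePacket]
  refine integral_congr_ae ?_
  filter_upwards [coeffEquiv_reflectL2_paleyWienerKernel x] with lam h
  rw [h, spectralCut]
  split_ifs
  · rw [map_mul, map_mul, Complex.conj_conj, Complex.conj_ofReal]
    ring
  · simp

theorem proj_packet_ae_eq_heisenbergConvolution {E : ProjectionValuedMeasure L2H}
    (hE : IsSpectralMeasure subLaplacian E) (m n : ℕ) {c : ℝ → ℂ} (hc : IsCutoffFun c) :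
    E.proj (Set.Icc 0 1) (packet m n hc) =ᵐ[volume]
      heisenbergConvolution (packet m n hc) paleyWienerKernel := by
  rw [proj_packet hE, funext (heisenbergConvolution_packet m n hc)]
  exact (memLp_wavePacket m n (hc.spectralCut m n)).coeFn_toLp

/-- The span of the wave packets. -/
def packetSpan : Submodule ℂ L2H :=
  Submodule.span ℂ {u | ∃ (m n : ℕ) (c : ℝ → ℂ) (hc : IsCutoffFun c), u = packet m n hc}

/-- Wave packets span a dense subspace. -/
theorem topologicalClosure_packetSpan : packetSpan.topologicalClosure = ⊤ := by
  rw [Submodule.topologicalClosure_eq_top_iff, Submodule.eq_bot_iff]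
  intro u hu
  rw [← coeffEquiv.map_eq_zero_iff]
  refine Lp.ext (EventuallyEq.trans ?_ (Lp.coeFn_zero _ _ _).symm)
  refine ae_eq_zero_of_sheets (Lp.stronglyMeasurable _).measurable fun m n c hc => ?_
  rw [← inner_packet_eq_integral m n hc]
  exact (Submodule.mem_orthogonal _ _).1 hu _ (Submodule.subset_span ⟨m, n, c, hc, rfl⟩)

/-- Agreement of a bounded operator with a convolution passes to limits in `L²`. -/
theorem ae_eq_heisenbergConvolution_of_tendsto {T : L2H →L[ℂ] L2H} {p f : L2H} {u : ℕ → L2H}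
    (hu : ∀ n, T (u n) =ᵐ[volume] heisenbergConvolution (u n) p)
    (hlim : Tendsto u atTop (𝓝 f)) : T f =ᵐ[volume] heisenbergConvolution f p := by
  have h1 := tendstoInMeasure_of_tendsto_Lp ((T.continuous.tendsto f).comp hlim)
  obtain ⟨ns, hns, h2⟩ := h1.exists_seq_tendsto_ae
  filter_upwards [h2, ae_all_iff.2 hu] with x hx hux
  have h3 : Tendsto (fun i => heisenbergConvolution (u (ns i)) p x) atTop
      (𝓝 (heisenbergConvolution f p x)) := by
    simp_rw [heisenbergConvolution_eq_inner]
    exact tendsto_const_nhds.inner (hlim.comp hns.tendsto_atTop)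
  exact tendsto_nhds_unique hx (h3.congr fun i => (hux (ns i)).symm)

theorem proj_ae_eq_heisenbergConvolution {E : ProjectionValuedMeasure L2H}
    (hE : IsSpectralMeasure subLaplacian E) (f : L2H) :
    E.proj (Set.Icc 0 1) f =ᵐ[volume] heisenbergConvolution f paleyWienerKernel := by
  have hspan : ∀ u ∈ packetSpan,
      E.proj (Set.Icc 0 1) u =ᵐ[volume] heisenbergConvolution u paleyWienerKernel := by
    intro u hu
    refine Submodule.span_induction ?_ ?_ ?_ ?_ hu
    · rintro _ ⟨m, n, c, hc, rfl⟩
      exact proj_packet_ae_eq_heisenbergConvolution hE m n hc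
    · rw [map_zero]
      filter_upwards [Lp.coeFn_zero ℂ 2 (volume : Measure Heisenberg)] with x hx
      rw [hx, heisenbergConvolution_eq_inner, inner_zero_right, Pi.zero_apply]
    · intro v w _ _ hv hw
      rw [map_add]
      filter_upwards [hv, hw, Lp.coeFn_add (E.proj (Set.Icc 0 1) v) (E.proj (Set.Icc 0 1) w)]
        with x h1 h2 h3
      rw [h3, Pi.add_apply, h1, h2]
      simp only [heisenbergConvolution_eq_inner, inner_add_right]
    · intro a v _ hv
      rw [map_smul]
      filter_upwards [hv, Lp.coeFn_smul a (E.proj (Set.Icc 0 1) v)] with x h1 h2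
      rw [h2, Pi.smul_apply, h1]
      simp only [heisenbergConvolution_eq_inner, inner_smul_right, smul_eq_mul]
  have hf : f ∈ closure (packetSpan : Set L2H) := by
    rw [← Submodule.topologicalClosure_coe, topologicalClosure_packetSpan]
    trivial
  obtain ⟨u, hu, hlim⟩ := mem_closure_iff_seq_limit.1 hf
  exact ae_eq_heisenbergConvolution_of_tendsto (fun n => hspan (u n) (hu n)) hlim

theorem mainTheorem4 :
    (∀ f : L2H, ∃ F : ℝ → L2R →L[ℂ] L2R, IsPlancherelTransform f F ∧
      ∀ G : ℝ → L2R →L[ℂ] L2R, IsPlancherelTransform f G → ∀ᵐ lam : ℝ, G lam = F lam) ∧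
    (∃ E : ProjectionValuedMeasure L2H, IsSpectralMeasure subLaplacian E) ∧
    (∀ lam : ℝ, lam ≠ 0 → IsStarProjection (paleyWienerFiber lam) ∧
      (paleyWienerFiber lam).range =
        Submodule.span ℂ {u | ∃ n : ℕ, (n : ℤ) ≤ hermiteCutoff lam ∧ u = dilatedHermite n lam}) ∧
    ∀ E : ProjectionValuedMeasure L2H, IsSpectralMeasure subLaplacian E →
      (∀ (f : L2H) (F G : ℝ → L2R →L[ℂ] L2R), IsPlancherelTransform f F →
        IsPlancherelTransform (E.proj (Set.Icc 0 1) f) G →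
        ∀ᵐ lam : ℝ, G lam = (F lam).comp (paleyWienerFiber lam)) ∧
      ∃ p : L2H, IsPlancherelTransform p paleyWienerFiber ∧
        ∀ f : L2H, (∀ x, Integrable (convolutionIntegrand f p x) volume) ∧
          E.proj (Set.Icc 0 1) f =ᵐ[volume] heisenbergConvolution f p := by
  refine ⟨fun f => ?_, ?_, fun lam h0 => ?_, fun E hE => ⟨fun f F G hF hG => ?_, ?_⟩⟩
  · obtain ⟨F, hF⟩ := exists_isPlancherelTransform f
    exact ⟨F, hF, fun G hG => hF.ae_eq hG⟩
  · exact ⟨_, isMultiplication_subLaplacian.isSpectralMeasure measurable_oscillatorSymbol⟩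
  · exact ⟨isStarProjection_paleyWienerFiber h0, range_paleyWienerFiber h0⟩
  · exact hF.ae_eq_comp_paleyWienerFiber hE hG
  · exact ⟨paleyWienerKernel, isPlancherelTransform_paleyWienerKernel, fun f =>
      ⟨integrable_convolutionIntegrand f paleyWienerKernel,
        proj_ae_eq_heisenbergConvolution hE f⟩⟩

end
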